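/- Let $K=\mathbb{Q}(q,t)$, let $\lambda$ be a partition (Young diagram, English notation) with $n=|\lambda|\ge 0$ boxes, and let $c(\square)=\text{column}-\text{row}$ be the content of a box. *Tableaux.* $\mathrm{RYT}(\lambda)$ (resp. $\mathrm{RSSYT}(\lambda)$) is the set of labellings $T:\lambda\to\mathbb{Z}_{\ge0}$ weakly decreasing along rows and weakly (resp. strictly) decreasing along columns. $\mathrm{PSYT}(\lambda)$ is the set of labellings $\tau$ of $\lambda$ by formal symbols $jq^b$ ($1\le j\le n$, $b\ge0$), each $j$ occurring exactly once, strictly increasing along rows and columns for the order $jq^m<kq^\ell$ iff $m>\ell$, or $m=\ell$ and $j<k$; $\mathrm{SYT}(\lambda)\subset\mathrm{PSYT}(\lambda)$ is the subset with all $b=0$. If $\tau(\square)=iq^b$ put $c_\tau(i)=c(\square)$, $w_\tau(i)=b$. Let $\mathrm{PSYT}(\lambda;T)$ be the set of $\tau$ whose exponents form $T$. Let $s_i(\tau)$ be $\tau$ with $i$ and $i+1$ exchanged and the exponents left in place, when this lies in $\mathrm{PSYT}(\lambda)$; let $\Psi(\tau)$ be obtained by replacing $kq^a$ by $(k-1)q^a$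 for $k\ge2$ and $1q^a$ by $nq^{a+1}$. $\mathrm{PSYT}(\lambda)$ is partially ordered by the relations generated by $\Psi(\tau)>\tau$, and $s_i(\tau)>\tau$ if $w_\tau(i)<w_\tau(i+1)$ or if $w_\tau(i)=w_\tau(i+1)$ and $c_\tau(i)-c_\tau(i+1)>1$. $\mathrm{Top}(T)$ is the greatest element of $\mathrm{PSYT}(\lambda;T)$. *Algebras.* $\mathcal{H}_n$ is the $K$-algebra generated by $T_1,\dots,T_{n-1}$ with $(T_i-1)(T_i+t)=0$, $T_iT_{i+1}T_i=T_{i+1}T_iT_{i+1}$, and $T_iT_j=T_jT_i$ for $|i-j|>1$. $\mathcal{A}_n$ is generated by $T_i$ satisfying these relations and $\theta_1,\dots,\theta_n$ with $\theta_i\theta_j=\theta_j\theta_i$, $\theta_{i+1}=tT_i^{-1}\theta_iT_i^{-1}$, and $T_i\theta_j=\theta_jT_i$ for $j\notin\{i,i+1\}$. With $\pi_n=t^{n-1}\theta_1T_1^{-1}\cdots T_{n-1}^{-1}$, $\mathcal{D}_n$ is generated by $T_i,\theta_i$ satisfying the relations of $\mathcal{A}_n$ and $X_1,\dots,X_n$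 with $X_iX_j=X_jX_i$, $X_{i+1}=tT_i^{-1}X_iT_i^{-1}$, $T_iX_j=X_jT_i$ for $j\notin\{i,i+1\}$, $\pi_nX_i=X_{i+1}\pi_n$ for $i<n$, and $\pi_nX_n=qX_1\pi_n$. Let $\rho_n:\mathcal{A}_n\to\mathcal{H}_n$ be given by $T_i\mapsto T_i$, $\theta_i\mapsto\bar\theta_i$, where $\bar\theta_1=1$ and $\bar\theta_{i+1}=tT_i^{-1}\bar\theta_iT_i^{-1}$, and put $\bar\varphi_i=(tT_i^{-1})\bar\theta_i-\bar\theta_i(tT_i^{-1})$. Let $$\epsilon^{(n)}=\frac1{[n]_t!}\sum_{\sigma\in\mathfrak{S}_n}t^{\binom n2-\ell(\sigma)}T_\sigma,\qquad [n]_t!=\prod_{i=1}^n\frac{1-t^i}{1-t},$$ and $P^{(n)}_{0,\ell}=\epsilon^{(n)}\big(\sum_{i=1}^n\theta_i^\ell\big)\epsilon^{(n)}$ for $\ell>0$. *Modules.* Denote again by $\lambda$ the $\mathcal{H}_n$-module generated by the $\tau\in\mathrm{SYT}(\lambda)$ subject to: $\bar\theta_i\tau=t^{c_\tau(i)}\tau$;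 $\bar\varphi_i\tau=(t^{c_\tau(i)}-t^{c_\tau(i+1)})s_i(\tau)$ if $s_i(\tau)>\tau$; $T_i\tau=\tau$ (resp. $T_i\tau=-t\tau$) if $i,i+1$ lie in the same row (resp. column) of $\tau$. Let $V_\lambda=\mathrm{Ind}_{\mathcal{A}_n}^{\mathcal{D}_n}\rho_n^*(\lambda)$ and $W_\lambda=\epsilon^{(n)}(V_\lambda)$. **Proposition.** There is exactly one $K$-basis $\{F_\tau:\tau\in\mathrm{PSYT}(\lambda)\}$ of $V_\lambda$ such that $\theta_iF_\tau=q^{w_\tau(i)}t^{c_\tau(i)}F_\tau$ for all $i$; $F_\tau=1\otimes\tau$ for $\tau\in\mathrm{SYT}(\lambda)$; $$\left(tT_i^{-1}+\frac{(t-1)q^{w_\tau(i+1)}t^{c_\tau(i+1)}}{q^{w_\tau(i)}t^{c_\tau(i)}-q^{w_\tau(i+1)}t^{c_\tau(i+1)}}\right)F_\tau=F_{s_i(\tau)}\quad\text{whenever } s_i(\tau)>\tau;$$ and, for $n\ge1$, $F_{\Psi(\tau)}=q^{w_\tau(1)}X_n\pi_n^{-1}F_\tau$. For each $T\in\mathrm{RSSYT}(\lambda)$,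 with $U_T=\mathrm{span}_K\{F_\tau:\tau\in\mathrm{PSYT}(\lambda;T)\}$, there is exactly one element $P_T\in\epsilon^{(n)}(U_T)$ of the form $$P_T=F_{\mathrm{Top}(T)}+\sum_{y\in\mathrm{PSYT}(\lambda;T)\setminus\{\mathrm{Top}(T)\}}\kappa_yF_y,\qquad \kappa_y\in K.$$ The set $\{P_T:T\in\mathrm{RSSYT}(\lambda)\}$ is a $K$-basis of $W_\lambda$ consisting of weight vectors for $K[\theta_1,\dots,\theta_n]^{\mathfrak{S}_n}$ with pairwise distinct weights: each symmetric polynomial $f(\theta_1,\dots,\theta_n)$ acts on $P_T$ by the value of $f$ at the $n$ elements $q^{T(\square)}t^{c(\square)}$, $\square\in\lambda$, and for $T\ne T'$ some symmetric $f$ acts on $P_T$ and $P_{T'}$ by different scalars. Further, for all $\ell>0$, $$P^{(n)}_{0,\ell}(P_T)=\Big(\sum_{\square\in\lambda}q^{\ell T(\square)}t^{\ell c(\square)}\Big)P_T.$$ -/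

import Mathlib

noncomputable section

namespace VVMac

/-! ### Tableaux -/

/-- The boxes of a Young diagram; `(r, c)` is the box in row `r` and column `c` (0-based). -/
abbrev Box (lam : YoungDiagram) : Type := {b : ℕ × ℕ // b ∈ lam.cells}

/-- The content of a box: column minus row. -/
def content {lam : YoungDiagram} (b : Box lam) : ℤ := (b.1.2 : ℤ) - (b.1.1 : ℤ)

/-- `b` lies strictly to the left of `b'` in the same row. -/
def RowLT {lam : YoungDiagram} (b b' : Box lam) : Prop := b.1.1 = b'.1.1 ∧ b.1.2 < b'.1.2

/-- `b` lies strictly above `b'` in the same column. -/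
def ColLT {lam : YoungDiagram} (b b' : Box lam) : Prop := b.1.2 = b'.1.2 ∧ b.1.1 < b'.1.1

/-- Non-negative reverse Young tableaux: weakly decreasing along rows and columns. -/
structure RYT (lam : YoungDiagram) where
  val : Box lam → ℕ
  row_weak : ∀ b b', RowLT b b' → val b' ≤ val b
  col_weak : ∀ b b', ColLT b b' → val b' ≤ val b

/-- Non-negative reverse semi-standard Young tableaux: weakly decreasing along rows, strictly
decreasing along columns. -/
structure RSSYT (lam : YoungDiagram) where
  val : Box lam → ℕ
  row_weak : ∀ b b', RowLT b b' → val b' ≤ val b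
  col_strict : ∀ b b', ColLT b b' → val b' < val b

/-- A reverse semi-standard Young tableau is a reverse Young tableau. -/
def RSSYT.toRYT {lam : YoungDiagram} (T : RSSYT lam) : RYT lam where
  val := T.val
  row_weak := T.row_weak
  col_weak := fun b b' h => (T.col_strict b b' h).le

/-- The order on the formal labels `j q ^ m`, a label being the pair `(j, m)`:
`j q ^ m < k q ^ l` iff `m > l`, or `m = l` and `j < k`. -/
def LabelLT {n : ℕ} (x y : Fin n × ℕ) : Prop := y.2 < x.2 ∨ (x.2 = y.2 ∧ x.1 < y.1)

/-- Non-negative periodic standard Young tableaux: the box `b` carries the label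
`j q ^ m` with `j = idx b` and `m = pow b`; each `j` occurs in exactly one box (`idx` is a
bijection), and the labels strictly increase along rows and columns. The labels `1, …, n` are
numbered `0, …, n - 1` here. -/
@[ext] structure PSYT (lam : YoungDiagram) where
  idx : Box lam ≃ Fin lam.card
  pow : Box lam → ℕ
  row_strict : ∀ b b', RowLT b b' → LabelLT (idx b, pow b) (idx b', pow b')
  col_strict : ∀ b b', ColLT b b' → LabelLT (idx b, pow b) (idx b', pow b')

/-- Standard Young tableaux. -/
@[ext] structure SYT (lam : YoungDiagram) where
  idx : Box lam ≃ Fin lam.card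
  row_strict : ∀ b b', RowLT b b' → idx b < idx b'
  col_strict : ∀ b b', ColLT b b' → idx b < idx b'

/-- The inclusion `SYT(λ) ⊂ PSYT(λ)`, with all powers of `q` trivial. -/
def SYT.toPSYT {lam : YoungDiagram} (τ : SYT lam) : PSYT lam where
  idx := τ.idx
  pow := fun _ => 0
  row_strict := fun b b' h => Or.inr ⟨rfl, τ.row_strict b b' h⟩
  col_strict := fun b b' h => Or.inr ⟨rfl, τ.col_strict b b' h⟩

/-- `c_τ(i)`: the content of the box with label `i q ^ m`. -/
def PSYT.c {lam : YoungDiagram} (τ : PSYT lam) (i : Fin lam.card) : ℤ := content (τ.idx.symm i)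

/-- `w_τ(i)`: the exponent `m` of the label `i q ^ m`. -/
def PSYT.w {lam : YoungDiagram} (τ : PSYT lam) (i : Fin lam.card) : ℕ := τ.pow (τ.idx.symm i)

/-- The index `i`, for `1 ≤ i ≤ n - 1`, as one of the indices `1, …, n`. -/
def lo {n : ℕ} (i : Fin (n - 1)) : Fin n := ⟨i.1, by have := i.2; omega⟩

/-- The index `i + 1`, for `1 ≤ i ≤ n - 1`, as one of the indices `1, …, n`. -/
def hi {n : ℕ} (i : Fin (n - 1)) : Fin n := ⟨i.1 + 1, by have := i.2; omega⟩

/-- `τ' = s_i(τ)`: the tableau `τ'` arises from `τ` by exchanging `i` and `i + 1`, the exponents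
staying in their boxes. -/
def IsSwap {lam : YoungDiagram} (i : Fin (lam.card - 1)) (τ τ' : PSYT lam) : Prop :=
  τ'.pow = τ.pow ∧ ∀ b, τ'.idx b = Equiv.swap (lo i) (hi i) (τ.idx b)

/-- `s_i(τ)` is a periodic standard tableau `τ'` and `s_i(τ) > τ`. -/
def SwapUp {lam : YoungDiagram} (i : Fin (lam.card - 1)) (τ τ' : PSYT lam) : Prop :=
  IsSwap i τ τ' ∧
    (τ.w (lo i) < τ.w (hi i) ∨ (τ.w (lo i) = τ.w (hi i) ∧ 1 < τ.c (lo i) - τ.c (hi i)))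

lemma val_finRotate_symm {n : ℕ} (k : Fin n) :
    (((finRotate n).symm k : Fin n) : ℕ) = if k.1 = 0 then n - 1 else k.1 - 1 := by
  obtain ⟨j, rfl⟩ := (finRotate n).surjective k
  rw [Equiv.symm_apply_apply]
  cases n with
  | zero => exact j.elim0
  | succ n =>
    have := coe_finRotate j
    have hj := j.2
    rw [this]
    split_ifs with h1 h2 h3
    · simp [h1]
    · simp_all
    · simp_all
    · simp

lemma labelLT_rotate {n : ℕ} {x y : Fin n × ℕ} (h : LabelLT x y) :
    LabelLT ((finRotate n).symm x.1, if x.1.1 = 0 then x.2 + 1 else x.2)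
      ((finRotate n).symm y.1, if y.1.1 = 0 then y.2 + 1 else y.2) := by
  obtain ⟨j, a⟩ := x
  obtain ⟨k, b⟩ := y
  simp only [LabelLT, Fin.lt_def, val_finRotate_symm] at h ⊢
  have := j.2
  have := k.2
  split_ifs <;> omega

/-- `Ψ(τ)`: the label `k q ^ a` becomes `(k - 1) q ^ a` if `k ≥ 2` and `n q ^ (a + 1)` if
`k = 1`. -/
def PSYT.Psi {lam : YoungDiagram} (τ : PSYT lam) : PSYT lam where
  idx := τ.idx.trans (finRotate lam.card).symm
  pow := fun b => if (τ.idx b).1 = 0 then τ.pow b + 1 else τ.pow b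
  row_strict := fun b b' h => labelLT_rotate (τ.row_strict b b' h)
  col_strict := fun b b' h => labelLT_rotate (τ.col_strict b b' h)

/-- `Cover τ τ'`: the generating relation `τ < τ'` of the order on periodic standard tableaux. -/
inductive Cover {lam : YoungDiagram} : PSYT lam → PSYT lam → Prop
  | psi (h : 0 < lam.card) (τ : PSYT lam) : Cover τ τ.Psi
  | swap (i : Fin (lam.card - 1)) (τ τ' : PSYT lam) (h : SwapUp i τ τ') : Cover τ τ'

/-- The partial order on periodic standard tableaux. -/
def PSYT.Le {lam : YoungDiagram} (τ τ' : PSYT lam) : Prop := Relation.ReflTransGen Cover τ τ'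

/-- `PSYT(λ; T)`: the periodic standard tableaux whose exponents form `T`. -/
def PSYTOver {lam : YoungDiagram} (T : RYT lam) : Set (PSYT lam) := {τ | τ.pow = T.val}

/-- `τ = Top(T)`: the greatest element of `PSYT(λ; T)`. -/
def IsTop {lam : YoungDiagram} (T : RYT lam) (τ : PSYT lam) : Prop :=
  τ ∈ PSYTOver T ∧ ∀ τ' ∈ PSYTOver T, τ'.Le τ

/-! ### Hecke algebras -/

/-- The field `ℚ(q, t)`. -/
abbrev K : Type := FractionRing (MvPolynomial (Fin 2) ℚ)

def q : K := algebraMap (MvPolynomial (Fin 2) ℚ) K (MvPolynomial.X 0)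

def t : K := algebraMap (MvPolynomial (Fin 2) ℚ) K (MvPolynomial.X 1)

lemma t_ne_zero : t ≠ 0 := by
  unfold t
  rw [Ne, map_eq_zero_iff _ (IsFractionRing.injective (MvPolynomial (Fin 2) ℚ) K)]
  exact MvPolynomial.X_ne_zero 1

/-- The inverse `t⁻¹ (x + t - 1)` of an element `x` with `(x - 1)(x + t) = 0`. -/
def hinv {R : Type} [Ring R] [Algebra K R] (x : R) : R := t⁻¹ • (x + algebraMap K R (t - 1))

section hinv

variable {R : Type} [Ring R] [Algebra K R]

lemma mul_hinv {x : R} (h : (x - 1) * (x + algebraMap K R t) = 0) : x * hinv x = 1 := by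
  have h2 : x * (x + algebraMap K R (t - 1)) = algebraMap K R t := by
    rw [map_sub, map_one]
    have h3 : (x - 1) * (x + algebraMap K R t)
        = x * (x + (algebraMap K R t - 1)) - algebraMap K R t := by noncomm_ring
    rw [h3] at h
    exact sub_eq_zero.mp h
  rw [hinv, mul_smul_comm, h2, Algebra.algebraMap_eq_smul_one, smul_smul,
    inv_mul_cancel₀ t_ne_zero, one_smul]

lemma hinv_mul {x : R} (h : (x - 1) * (x + algebraMap K R t) = 0) : hinv x * x = 1 := by
  rw [← mul_hinv h, hinv, smul_mul_assoc, mul_smul_comm, add_mul, mul_add,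
    Algebra.commutes (t - 1) x]

lemma map_hinv {S : Type} [Ring S] [Algebra K S] (f : R →ₐ[K] S) (x : R) :
    f (hinv x) = hinv (f x) := by
  simp [hinv]

end hinv

/-- The relations of the finite Hecke algebra on the generators `T_1, …, T_{n-1}`. -/
inductive HeckeRel (n : ℕ) :
    FreeAlgebra K (Fin (n - 1)) → FreeAlgebra K (Fin (n - 1)) → Prop
  | quad (i : Fin (n - 1)) :
      HeckeRel n ((FreeAlgebra.ι K i - 1) * (FreeAlgebra.ι K i + algebraMap K _ t)) 0
  | braid (i j : Fin (n - 1)) (h : j.1 = i.1 + 1) :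
      HeckeRel n (FreeAlgebra.ι K i * FreeAlgebra.ι K j * FreeAlgebra.ι K i)
        (FreeAlgebra.ι K j * FreeAlgebra.ι K i * FreeAlgebra.ι K j)
  | comm (i j : Fin (n - 1)) (h : i.1 + 1 < j.1 ∨ j.1 + 1 < i.1) :
      HeckeRel n (FreeAlgebra.ι K i * FreeAlgebra.ι K j) (FreeAlgebra.ι K j * FreeAlgebra.ι K i)

/-- The finite Hecke algebra `H_n`. -/
def Hecke (n : ℕ) : Type := RingQuot (HeckeRel n)

instance (n : ℕ) : Ring (Hecke n) := inferInstanceAs (Ring (RingQuot (HeckeRel n)))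

instance (n : ℕ) : Algebra K (Hecke n) := inferInstanceAs (Algebra K (RingQuot (HeckeRel n)))

/-- The generators of the positive affine Hecke algebra. -/
inductive AffGen (n : ℕ) : Type
  | T (i : Fin (n - 1))
  | theta (i : Fin n)

namespace AffGen

/-- The generator `T_i` in the free algebra. -/
def fT {n : ℕ} (i : Fin (n - 1)) : FreeAlgebra K (AffGen n) := FreeAlgebra.ι K (AffGen.T i)

/-- The generator `θ_i` in the free algebra. -/
def fθ {n : ℕ} (i : Fin n) : FreeAlgebra K (AffGen n) := FreeAlgebra.ι K (AffGen.theta i)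

end AffGen

open AffGen in
/-- The relations of the positive affine Hecke algebra. -/
inductive AffRel (n : ℕ) : FreeAlgebra K (AffGen n) → FreeAlgebra K (AffGen n) → Prop
  | hecke {a b : FreeAlgebra K (Fin (n - 1))} (h : HeckeRel n a b) :
      AffRel n (FreeAlgebra.lift K fT a) (FreeAlgebra.lift K fT b)
  | comm (i j : Fin n) : AffRel n (fθ i * fθ j) (fθ j * fθ i)
  | step (i : Fin (n - 1)) :
      AffRel n (fθ (hi i)) (t • (hinv (fT i) * fθ (lo i) * hinv (fT i)))
  | far (i : Fin (n - 1)) (j : Fin n) (h1 : j ≠ lo i) (h2 : j ≠ hi i) :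
      AffRel n (fT i * fθ j) (fθ j * fT i)

/-- The positive affine Hecke algebra `A_n`. -/
def Aff (n : ℕ) : Type := RingQuot (AffRel n)

instance (n : ℕ) : Ring (Aff n) := inferInstanceAs (Ring (RingQuot (AffRel n)))

instance (n : ℕ) : Algebra K (Aff n) := inferInstanceAs (Algebra K (RingQuot (AffRel n)))

/-- The generators of the positive double affine Hecke algebra. -/
inductive DahaGen (n : ℕ) : Type
  | aff (g : AffGen n)
  | X (i : Fin n)

namespace DahaGen

/-- The free algebra on the `T_i, θ_i` inside the one on the `T_i, θ_i, X_i`. -/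
def incl (n : ℕ) : FreeAlgebra K (AffGen n) →ₐ[K] FreeAlgebra K (DahaGen n) :=
  FreeAlgebra.lift K fun g => FreeAlgebra.ι K (DahaGen.aff g)

/-- The generator `T_i` in the free algebra. -/
def fT {n : ℕ} (i : Fin (n - 1)) : FreeAlgebra K (DahaGen n) := incl n (AffGen.fT i)

/-- The generator `θ_i` in the free algebra. -/
def fθ {n : ℕ} (i : Fin n) : FreeAlgebra K (DahaGen n) := incl n (AffGen.fθ i)

/-- The generator `X_i` in the free algebra. -/
def fX {n : ℕ} (i : Fin n) : FreeAlgebra K (DahaGen n) := FreeAlgebra.ι K (DahaGen.X i)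

end DahaGen

/-- `t ^ (n - 1) θ_1 T_1⁻¹ ⋯ T_{n-1}⁻¹`, for elements `θ_i` and `T_i` of any algebra and
`n ≥ 1`. -/
def piOf {R : Type} [Ring R] [Algebra K R] {n : ℕ} (hn : 0 < n) (T : Fin (n - 1) → R)
    (θ : Fin n → R) : R :=
  t ^ (n - 1) • (θ ⟨0, hn⟩ * (List.ofFn fun i => hinv (T i)).prod)

open DahaGen in
/-- The relations of the positive double affine Hecke algebra. -/
inductive DahaRel (n : ℕ) : FreeAlgebra K (DahaGen n) → FreeAlgebra K (DahaGen n) → Prop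
  | aff {a b : FreeAlgebra K (AffGen n)} (h : AffRel n a b) : DahaRel n (incl n a) (incl n b)
  | comm (i j : Fin n) : DahaRel n (fX i * fX j) (fX j * fX i)
  | step (i : Fin (n - 1)) :
      DahaRel n (fX (hi i)) (t • (hinv (fT i) * fX (lo i) * hinv (fT i)))
  | far (i : Fin (n - 1)) (j : Fin n) (h1 : j ≠ lo i) (h2 : j ≠ hi i) :
      DahaRel n (fT i * fX j) (fX j * fT i)
  | pi (hn : 0 < n) (i : Fin (n - 1)) :
      DahaRel n (piOf hn fT fθ * fX (lo i)) (fX (hi i) * piOf hn fT fθ)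
  | pi_last (hn : 0 < n) :
      DahaRel n (piOf hn fT fθ * fX ⟨n - 1, Nat.sub_lt hn Nat.one_pos⟩)
        (q • (fX ⟨0, hn⟩ * piOf hn fT fθ))

/-- The positive double affine Hecke algebra `D_n`. -/
def Daha (n : ℕ) : Type := RingQuot (DahaRel n)

instance (n : ℕ) : Ring (Daha n) := inferInstanceAs (Ring (RingQuot (DahaRel n)))

instance (n : ℕ) : Algebra K (Daha n) := inferInstanceAs (Algebra K (RingQuot (DahaRel n)))

lemma commute_hinv {R : Type} [Ring R] [Algebra K R] {x y : R} (h : Commute x y) :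
    Commute x (hinv y) :=
  (h.add_right (Algebra.commutes (t - 1) x).symm).smul_right _

lemma braid_inv {R : Type} [Ring R] {a a' b b' : R} (ha : a * a' = 1) (ha' : a' * a = 1)
    (hb : b * b' = 1) (hb' : b' * b = 1) (h : a * b * a = b * a * b) :
    a * (b' * a') = b' * a' * b := by
  calc a * (b' * a') = b' * (a' * a) * b * (a * (b' * a')) := by
        rw [ha', mul_one, hb', one_mul]
    _ = b' * a' * (a * b * a) * (b' * a') := by simp only [mul_assoc]
    _ = b' * a' * b * (a * (b * b') * a') := by rw [h]; simp only [mul_assoc]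
    _ = b' * a' * b := by rw [hb, mul_one, ha, mul_one]

namespace Hecke

/-- The quotient map from the free algebra. -/
def mk (n : ℕ) : FreeAlgebra K (Fin (n - 1)) →ₐ[K] Hecke n := RingQuot.mkAlgHom K (HeckeRel n)

/-- The generator `T_i` of the finite Hecke algebra. -/
def T {n : ℕ} (i : Fin (n - 1)) : Hecke n := mk n (FreeAlgebra.ι K i)

variable {n : ℕ}

lemma mk_rel {a b : FreeAlgebra K (Fin (n - 1))} (h : HeckeRel n a b) : mk n a = mk n b :=
  RingQuot.mkAlgHom_rel K h

lemma quad (i : Fin (n - 1)) : (T i - 1) * (T i + algebraMap K (Hecke n) t) = 0 := by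
  simpa [T] using mk_rel (HeckeRel.quad i)

lemma braid (i j : Fin (n - 1)) (h : j.1 = i.1 + 1) :
    T i * T j * T i = T j * T i * T j := by
  simpa [T] using mk_rel (HeckeRel.braid i j h)

lemma comm (i j : Fin (n - 1)) (h : i.1 + 1 < j.1 ∨ j.1 + 1 < i.1) :
    Commute (T i) (T j) := by
  have := mk_rel (HeckeRel.comm i j h)
  simp only [map_mul] at this
  exact this

/-- `jm n k` is the element `θ̄_{k+1}` of `H_n`, for `k < n`:
`θ̄_1 = 1` and `θ̄_{i+1} = t T_i⁻¹ θ̄_i T_i⁻¹`. -/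
def jm (n : ℕ) : ℕ → Hecke n
  | 0 => 1
  | k + 1 => if h : k < n - 1 then t • (hinv (T ⟨k, h⟩) * jm n k * hinv (T ⟨k, h⟩)) else 0

/-- The elements `θ̄_1, …, θ̄_n` of the finite Hecke algebra. -/
def thetaBar (i : Fin n) : Hecke n := jm n i.1

/-- `φ̄_i = (t T_i⁻¹) θ̄_i - θ̄_i (t T_i⁻¹)`. -/
def phiBar (i : Fin (n - 1)) : Hecke n :=
  (t • hinv (T i)) * thetaBar (lo i) - thetaBar (lo i) * (t • hinv (T i))

lemma jm_comm_lt (i : Fin (n - 1)) : ∀ k : ℕ, k < i.1 → Commute (T i) (jm n k)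
  | 0, _ => Commute.one_right _
  | k + 1, h => by
    have hk : k < n - 1 := by have := i.2; omega
    have hc : Commute (T i) (hinv (T ⟨k, hk⟩)) := commute_hinv (comm i ⟨k, hk⟩ (Or.inr h))
    rw [jm, dif_pos hk]
    exact ((hc.mul_right (jm_comm_lt i k (by omega))).mul_right hc).smul_right t

lemma jm_comm_gt (i : Fin (n - 1)) : ∀ k : ℕ, i.1 + 1 < k → Commute (T i) (jm n k)
  | 0, h => by omega
  | 1, h => by omega
  | k + 2, h => by
    rw [jm]
    split_ifs with hk
    swap
    · exact Commute.zero_right _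
    rcases Nat.lt_or_ge (i.1 + 1) (k + 1) with h1 | h1
    · have hc : Commute (T i) (hinv (T ⟨k + 1, hk⟩)) :=
        commute_hinv (comm i ⟨k + 1, hk⟩ (Or.inl h1))
      exact ((hc.mul_right (jm_comm_gt i (k + 1) h1)).mul_right hc).smul_right t
    · obtain ⟨i, hi⟩ := i
      obtain rfl : i = k := by simp only at h h1; omega
      set a := T (⟨i, hi⟩ : Fin (n - 1)) with ha
      set b := T (⟨i + 1, hk⟩ : Fin (n - 1)) with hb
      have hab : a * b * a = b * a * b := braid _ _ rfl
      have qa : (a - 1) * (a + algebraMap K (Hecke n) t) = 0 := quad _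
      have qb : (b - 1) * (b + algebraMap K (Hecke n) t) = 0 := quad _
      have e1 := braid_inv (mul_hinv qa) (hinv_mul qa) (mul_hinv qb) (hinv_mul qb) hab
      have e2 := braid_inv (mul_hinv qb) (hinv_mul qb) (mul_hinv qa) (hinv_mul qa) hab.symm
      have e3 : Commute b (jm n i) := jm_comm_lt ⟨i + 1, hk⟩ i (Nat.lt_succ_self i)
      have e4 : Commute a (hinv b * (hinv a * jm n i * hinv a) * hinv b) := by
        calc a * (hinv b * (hinv a * jm n i * hinv a) * hinv b)
            = a * (hinv b * hinv a) * jm n i * (hinv a * hinv b) := by simp only [mul_assoc]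
          _ = hinv b * hinv a * (b * jm n i) * (hinv a * hinv b) := by
              rw [e1]; simp only [mul_assoc]
          _ = hinv b * hinv a * jm n i * (b * (hinv a * hinv b)) := by
              rw [e3.eq]; simp only [mul_assoc]
          _ = hinv b * (hinv a * jm n i * hinv a) * hinv b * a := by
              rw [e2]; simp only [mul_assoc]
      rw [jm, dif_pos hi, mul_smul_comm, smul_mul_assoc]
      exact (e4.smul_right t).smul_right t

lemma jm_comm (i : Fin (n - 1)) (k : ℕ) (h1 : k ≠ i.1) (h2 : k ≠ i.1 + 1) :
    Commute (T i) (jm n k) := by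
  rcases Nat.lt_or_ge k i.1 with h | h
  · exact jm_comm_lt i k h
  · exact jm_comm_gt i k (by omega)

lemma jm_commute_of_lt (l : ℕ) : ∀ k : ℕ, k < l → Commute (jm n k) (jm n l)
  | 0, _ => Commute.one_left _
  | k + 1, h => by
    rw [jm]
    split_ifs with hk
    swap
    · exact Commute.zero_left _
    have hc : Commute (hinv (T ⟨k, hk⟩)) (jm n l) :=
      (commute_hinv (jm_comm ⟨k, hk⟩ l (by simp only; omega) (by simp only; omega)).symm).symm
    exact ((hc.mul_left (jm_commute_of_lt l k (by omega))).mul_left hc).smul_left t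

lemma thetaBar_comm (i j : Fin n) : thetaBar i * thetaBar j = thetaBar j * thetaBar i := by
  rcases lt_trichotomy i.1 j.1 with h | h | h
  · exact jm_commute_of_lt _ _ h
  · rw [Fin.ext h]
  · exact (jm_commute_of_lt _ _ h).symm

lemma thetaBar_step (i : Fin (n - 1)) :
    thetaBar (hi i) = t • (hinv (T i) * thetaBar (lo i) * hinv (T i)) := by
  simp only [thetaBar, hi, lo, jm, i.2, dif_pos]

/-- The adjacent transposition `s_i`. -/
def s (i : Fin (n - 1)) : Equiv.Perm (Fin n) := Equiv.swap (lo i) (hi i)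

/-- `l` is a reduced expression of `σ`: `σ = s_{l_1} ⋯ s_{l_r}` with `r` minimal. -/
def IsReduced (σ : Equiv.Perm (Fin n)) (l : List (Fin (n - 1))) : Prop :=
  (l.map s).prod = σ ∧ ∀ l' : List (Fin (n - 1)), (l'.map s).prod = σ → l.length ≤ l'.length

lemma exists_word : ∀ {n : ℕ} (σ : Equiv.Perm (Fin n)),
    ∃ l : List (Fin (n - 1)), (l.map s).prod = σ
  | 0, σ => ⟨[], Subsingleton.elim _ _⟩
  | n + 1, σ => by
    have hσ : σ ∈ Submonoid.closure
        (Set.range fun i : Fin n => Equiv.swap i.castSucc i.succ) := by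
      rw [Equiv.Perm.mclosure_swap_castSucc_succ]
      trivial
    induction hσ using Submonoid.closure_induction with
    | mem x hx =>
      obtain ⟨i, rfl⟩ := hx
      exact ⟨[i], by simp; rfl⟩
    | one => exact ⟨[], rfl⟩
    | mul x y _ _ hx hy =>
      obtain ⟨l, hl⟩ := hx
      obtain ⟨l', hl'⟩ := hy
      exact ⟨l ++ l', by rw [List.map_append, List.prod_append, hl, hl']⟩

lemma exists_reduced (σ : Equiv.Perm (Fin n)) : ∃ l, IsReduced σ l := by
  classical
  have h : ∃ r, ∃ l : List (Fin (n - 1)), (l.map s).prod = σ ∧ l.length = r := by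
    obtain ⟨l, hl⟩ := exists_word σ
    exact ⟨_, l, hl, rfl⟩
  obtain ⟨l, hl, hr⟩ := Nat.find_spec h
  exact ⟨l, hl, fun l' hl' => hr ▸ Nat.find_min' h ⟨l', hl', rfl⟩⟩

/-- A reduced expression of `σ`. -/
def word (σ : Equiv.Perm (Fin n)) : List (Fin (n - 1)) := (exists_reduced σ).choose

/-- `T_σ = T_{i_1} ⋯ T_{i_r}` for a reduced expression `σ = s_{i_1} ⋯ s_{i_r}`; by the braid
relations it does not depend on the expression. -/
def Tperm (σ : Equiv.Perm (Fin n)) : Hecke n := ((word σ).map T).prod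

/-- The length `ℓ(σ)`. -/
def length (σ : Equiv.Perm (Fin n)) : ℕ := (word σ).length

/-- The trivial idempotent
`ε = ([n]_t !)⁻¹ ∑_σ t ^ (n choose 2 - ℓ(σ)) T_σ`. -/
def eps (n : ℕ) : Hecke n :=
  (∏ i ∈ Finset.Icc 1 n, (1 - t ^ i) / (1 - t))⁻¹ •
    ∑ σ : Equiv.Perm (Fin n), t ^ ((n.choose 2 : ℤ) - (length σ : ℤ)) • Tperm σ

end Hecke

namespace Aff

/-- The quotient map from the free algebra. -/
def mk (n : ℕ) : FreeAlgebra K (AffGen n) →ₐ[K] Aff n := RingQuot.mkAlgHom K (AffRel n)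

/-- The images of the generators under `ρ_n`. -/
def rhoGen (n : ℕ) : AffGen n → Hecke n
  | .T i => Hecke.T i
  | .theta i => Hecke.thetaBar i

lemma rho_rel {n : ℕ} {a b : FreeAlgebra K (AffGen n)} (h : AffRel n a b) :
    FreeAlgebra.lift K (rhoGen n) a = FreeAlgebra.lift K (rhoGen n) b := by
  have hT : ∀ i, FreeAlgebra.lift K (rhoGen n) (AffGen.fT i) = Hecke.T i := fun i => by
    simp [AffGen.fT, rhoGen]
  have hθ : ∀ i, FreeAlgebra.lift K (rhoGen n) (AffGen.fθ i) = Hecke.thetaBar i := fun i => by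
    simp [AffGen.fθ, rhoGen]
  cases h with
  | @hecke a b h =>
    have e : (FreeAlgebra.lift K (rhoGen n)).comp (FreeAlgebra.lift K AffGen.fT) = Hecke.mk n := by
      ext i
      simp [hT, Hecke.T]
    have e' := fun x => DFunLike.congr_fun e x
    simp only [AlgHom.comp_apply] at e'
    rw [e', e']
    exact Hecke.mk_rel h
  | comm i j => simpa only [map_mul, hθ] using Hecke.thetaBar_comm i j
  | step i => simpa only [map_mul, map_smul, map_hinv, hT, hθ] using Hecke.thetaBar_step i
  | far i j h1 h2 =>
    simp only [map_mul, hT, hθ]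
    exact Hecke.jm_comm i j.1 (fun h => h1 (Fin.ext h)) (fun h => h2 (Fin.ext h))

/-- The homomorphism `ρ_n : A_n → H_n` with `T_i ↦ T_i` and `θ_i ↦ θ̄_i`. -/
def rho (n : ℕ) : Aff n →ₐ[K] Hecke n :=
  RingQuot.liftAlgHom K ⟨FreeAlgebra.lift K (rhoGen n), fun _ _ h => rho_rel h⟩

/-- The map `H_n → A_n` with `T_i ↦ T_i`. -/
def ofHecke (n : ℕ) : Hecke n →ₐ[K] Aff n :=
  RingQuot.liftAlgHom K ⟨(mk n).comp (FreeAlgebra.lift K AffGen.fT),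
    fun _ _ h => RingQuot.mkAlgHom_rel K (AffRel.hecke h)⟩

end Aff

namespace Daha

/-- The quotient map from the free algebra. -/
def mk (n : ℕ) : FreeAlgebra K (DahaGen n) →ₐ[K] Daha n := RingQuot.mkAlgHom K (DahaRel n)

/-- The map `A_n → D_n` with `T_i ↦ T_i` and `θ_i ↦ θ_i`. -/
def ofAff (n : ℕ) : Aff n →ₐ[K] Daha n :=
  RingQuot.liftAlgHom K ⟨(mk n).comp (DahaGen.incl n),
    fun _ _ h => RingQuot.mkAlgHom_rel K (DahaRel.aff h)⟩

variable {n : ℕ}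

/-- The generator `T_i` of `D_n`. -/
def T (i : Fin (n - 1)) : Daha n := mk n (DahaGen.fT i)

/-- The generator `θ_i` of `D_n`. -/
def θ (i : Fin n) : Daha n := mk n (DahaGen.fθ i)

/-- The generator `X_i` of `D_n`. -/
def X (i : Fin n) : Daha n := mk n (DahaGen.fX i)

/-- The element `π_n = t ^ (n - 1) θ_1 T_1⁻¹ ⋯ T_{n-1}⁻¹` of `D_n`. -/
def pi (hn : 0 < n) : Daha n := piOf hn T θ

/-- The trivial idempotent `ε` as an element of `D_n`. -/
def eps (n : ℕ) : Daha n := ofAff n (Aff.ofHecke n (Hecke.eps n))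

/-- `P_{0,ℓ} = ε (∑_i θ_i ^ ℓ) ε`. -/
def P0 (n ℓ : ℕ) : Daha n := eps n * (∑ i : Fin n, θ i ^ ℓ) * eps n

/-- `f(θ_1, …, θ_n)` for a polynomial `f`: every monomial is evaluated as an ordered product, the
order being immaterial since the `θ_i` commute. -/
def evalθ (f : MvPolynomial (Fin n) K) : Daha n :=
  ∑ m ∈ f.support, f.coeff m • (List.ofFn fun i => θ i ^ m i).prod

end Daha

/-! ### The modules -/

open Hecke in
/-- The relations of the `H_n`-module labelled by `lam`, on the generators `τ ∈ SYT(lam)`. -/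
inductive SpechtRel (lam : YoungDiagram) :
    (SYT lam →₀ Hecke lam.card) → (SYT lam →₀ Hecke lam.card) → Prop
  | weight (τ : SYT lam) (i : Fin lam.card) :
      SpechtRel lam (thetaBar i • Finsupp.single τ 1) (t ^ τ.toPSYT.c i • Finsupp.single τ 1)
  | swap (τ τ' : SYT lam) (i : Fin (lam.card - 1)) (h : SwapUp i τ.toPSYT τ'.toPSYT) :
      SpechtRel lam (phiBar i • Finsupp.single τ 1)
        ((t ^ τ.toPSYT.c (lo i) - t ^ τ.toPSYT.c (hi i)) • Finsupp.single τ' 1)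
  | row (τ : SYT lam) (i : Fin (lam.card - 1))
      (h : (τ.idx.symm (lo i)).1.1 = (τ.idx.symm (hi i)).1.1) :
      SpechtRel lam (T i • Finsupp.single τ 1) (Finsupp.single τ 1)
  | col (τ : SYT lam) (i : Fin (lam.card - 1))
      (h : (τ.idx.symm (lo i)).1.2 = (τ.idx.symm (hi i)).1.2) :
      SpechtRel lam (T i • Finsupp.single τ 1) (-t • Finsupp.single τ 1)

/-- The `H_n`-module labelled by `lam`, `n = |lam|`: the module generated by the `τ ∈ SYT(lam)`
subject to the relations above. -/
abbrev Specht (lam : YoungDiagram) : Type :=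
  (SYT lam →₀ Hecke lam.card) ⧸
    Submodule.span (Hecke lam.card) {z | ∃ x y, SpechtRel lam x y ∧ z = x - y}

/-- The generator `τ` of the `H_n`-module labelled by `lam`. -/
def Specht.of {lam : YoungDiagram} (τ : SYT lam) : Specht lam :=
  Submodule.Quotient.mk (Finsupp.single τ 1)

open scoped TensorProduct in
/-- The `D_n`-module `V_lam = Ind (ρ_n^* lam) = D_n ⊗_{A_n} ρ_n^* lam`: the quotient of
`D_n ⊗_K lam` by the `D_n`-submodule generated by all `a ⊗ v - 1 ⊗ ρ_n(a) v` with
`a ∈ A_n` and `v ∈ lam`. -/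
abbrev V (lam : YoungDiagram) : Type :=
  (Daha lam.card ⊗[K] Specht lam) ⧸
    Submodule.span (Daha lam.card)
      {z : Daha lam.card ⊗[K] Specht lam | ∃ (a : Aff lam.card) (v : Specht lam),
        z = Daha.ofAff lam.card a ⊗ₜ[K] v - 1 ⊗ₜ[K] (Aff.rho lam.card a • v)}

open scoped TensorProduct in
/-- The element `1 ⊗ v` of `V_lam`. -/
def oneTmul {lam : YoungDiagram} (v : Specht lam) : V lam :=
  Submodule.Quotient.mk (1 ⊗ₜ[K] v)

/-- The action of an element of `D_n` on `V_lam`. -/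
def act {lam : YoungDiagram} (d : Daha lam.card) : V lam →ₗ[K] V lam :=
  Algebra.lsmul K K (V lam) d

/-- `W_lam = ε(V_lam)`. -/
def W (lam : YoungDiagram) : Submodule K (V lam) := LinearMap.range (act (Daha.eps lam.card))

/-! ### Macdonald polynomials -/

/-- The weight `q ^ (w_τ(i)) t ^ (c_τ(i))`. -/
def PSYT.weight {lam : YoungDiagram} (τ : PSYT lam) (i : Fin lam.card) : K :=
  q ^ τ.w i * t ^ τ.c i

/-- The properties that characterize the non-symmetric vector-valued Macdonald polynomials
`F_τ`, `τ ∈ PSYT(lam)`: they form a basis of `V_lam` consisting of `θ`-weight vectors,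
`F_τ = 1 ⊗ τ` for standard `τ`, and they are related by the intertwiners. -/
structure IsNonsymMacdonald {lam : YoungDiagram} (F : PSYT lam → V lam) : Prop where
  linearIndependent : LinearIndependent K F
  span_eq_top : Submodule.span K (Set.range F) = ⊤
  weight : ∀ τ i, act (Daha.θ i) (F τ) = τ.weight i • F τ
  syt : ∀ τ : SYT lam, F τ.toPSYT = oneTmul (Specht.of τ)
  swap : ∀ i τ τ', SwapUp i τ τ' →
    t • act (hinv (Daha.T i)) (F τ) +
      ((t - 1) * τ.weight (hi i) / (τ.weight (lo i) - τ.weight (hi i))) • F τ = F τ'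
  /-- `F_{Ψ(τ)} = q ^ (w_τ(1)) X_n π_n⁻¹ F_τ`; `π_n` acts invertibly on `V_lam`. -/
  psi : ∀ (hn : 0 < lam.card) (τ : PSYT lam),
    F τ.Psi = q ^ τ.w ⟨0, hn⟩ •
      act (Daha.X ⟨lam.card - 1, Nat.sub_lt hn Nat.one_pos⟩)
        (Ring.inverse (act (Daha.pi hn) : Module.End K (V lam)) (F τ))

/-- `U_T`: the span of the `F_τ` with `τ ∈ PSYT(lam; T)`. -/
def U {lam : YoungDiagram} (F : PSYT lam → V lam) (T : RYT lam) : Submodule K (V lam) :=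
  Submodule.span K (F '' PSYTOver T)

/-- `p` lies in `ε(U_T)` and has the form `F_{Top(T)} + ∑ κ_y F_y`, the sum over the
`y ∈ PSYT(lam; T)` other than `Top(T)`. -/
def IsSymMacdonald {lam : YoungDiagram} (F : PSYT lam → V lam) (T : RSSYT lam) (p : V lam) :
    Prop :=
  p ∈ (U F T.toRYT).map (act (Daha.eps lam.card)) ∧
    ∃ τ, IsTop T.toRYT τ ∧ p - F τ ∈ Submodule.span K (F '' (PSYTOver T.toRYT \ {τ}))

/-- The value `q ^ T(b) t ^ c(b)` of a box. -/
def RSSYT.boxWeight {lam : YoungDiagram} (T : RSSYT lam) (b : Box lam) : K :=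
  q ^ T.val b * t ^ content b

end VVMac

end

namespace VVMac

noncomputable section

/-! ### Powers of `q` and `t` -/

/-! The induced module is identified with an explicit model in which the `F_τ` are the coordinate
vectors. The model `Model lam` has the periodic standard tableaux as basis. On it `θ_i` is diagonal,
`T_i` is in seminormal form (diagonal coefficient `(1 - t) x / (x - y)`, where `x, y` are the
weights at `i, i + 1`, and off-diagonal coefficient `1` in the upward direction), and an operator
`ω` sends `τ` to a power of `t` times `Ψ(τ)`. The Hecke relations reduce to identities between
rational functions. They need adjacent weights to be distinct (`PSYT.u_ne`) and off-diagonal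
coefficients to vanish where a swap leaves the tableaux (`PSYT.off_eq_zero`). The `X_i` are
recovered from `X_1 = T_1 ⋯ T_{n-1} ω`, and their relations follow from a few relations between `T`,
`θ` and `ω` (`IsExtended`).

The universal property of induction gives a map from `V lam` to the model. It is surjective because
upward swaps and `Ψ` reach every tableau from the standard ones (`PSYT.up_induction`). It is
injective by counting dimensions degree by degree: `V lam` is spanned by the `X^a ⊗ τ`
(`span_spanFamily`), and their index set injects, preserving degree, into the tableaux
(`destandardize_injective`, `injective_of_graded`). Hence the `F_τ` exist. They are unique because
the required recursions fix them along `PSYT.up_induction`.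

The symmetrizer projects onto the vectors fixed by all `T_i` (`Hecke.T_mul_eps`,
`Hecke.eps_smul_of_invariant`). In coordinates, invariance says that an upward swap changes the
coordinate by a known factor and that coordinates vanish when `i, i + 1` are column neighbours with
equal exponents (`Model.apply_of_mem_inv`, `Model.mem_inv_of`). So an invariant vector is determined
by its coordinates at the top tableaux, and these vanish unless the exponents are strict along
columns. For strict `T` a product over the box pairs in the wrong order solves the equations. This
gives `P_T`, the basis of `W lam` and uniqueness at once.

All tableaux over `T` have the same multiset of weights, so symmetric functions of the `θ_i` act on
`P_T` by scalars. The multiset determines `T`, because entries decrease along each diagonal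
(`RSSYT.val_le_of_count`). -/

lemma q_ne_zero : q ≠ 0 := by
  unfold q
  rw [Ne, map_eq_zero_iff _ (IsFractionRing.injective (MvPolynomial (Fin 2) ℚ) K)]
  exact MvPolynomial.X_ne_zero 0

lemma qt_pow_injective {a a' b b' : ℕ} (h : q ^ a * t ^ b = q ^ a' * t ^ b') :
    a = a' ∧ b = b' := by
  unfold q t at h
  simp only [← map_pow, ← map_mul] at h
  replace h := IsFractionRing.injective (MvPolynomial (Fin 2) ℚ) K h
  rw [MvPolynomial.X_pow_eq_monomial, MvPolynomial.X_pow_eq_monomial,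
    MvPolynomial.X_pow_eq_monomial, MvPolynomial.X_pow_eq_monomial, MvPolynomial.monomial_mul,
    MvPolynomial.monomial_mul, mul_one] at h
  have h' := MvPolynomial.monomial_left_injective (one_ne_zero (α := ℚ)) h
  have h0 := DFunLike.congr_fun h' 0
  have h1 := DFunLike.congr_fun h' 1
  simp at h0 h1
  exact ⟨h0, h1⟩

/-- The value `q ^ w t ^ c` of a pair `(w, c)`. -/
def val (x : ℕ × ℤ) : K := q ^ x.1 * t ^ x.2

lemma val_ne_zero (x : ℕ × ℤ) : val x ≠ 0 :=
  mul_ne_zero (pow_ne_zero _ q_ne_zero) (zpow_ne_zero _ t_ne_zero)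

lemma val_injective : Function.Injective val := by
  rintro ⟨a, b⟩ ⟨a', b'⟩ h
  simp only [val] at h
  -- Multiplying by `t ^ N` with `N = |b| + |b'|` makes both exponents of `t` natural numbers, so
  -- that monomials can be compared.
  obtain ⟨N, m, m', hm, hm'⟩ : ∃ N m m' : ℕ, b + N = m ∧ b' + N = m' :=
    ⟨b.natAbs + b'.natAbs, (b + b.natAbs + b'.natAbs).toNat, (b' + b.natAbs + b'.natAbs).toNat,
      by omega, by omega⟩
  have h2 : q ^ a * t ^ m = q ^ a' * t ^ m' := by
    rw [← zpow_natCast t m, ← zpow_natCast t m', ← hm, ← hm', zpow_add₀ t_ne_zero,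
      zpow_add₀ t_ne_zero, ← mul_assoc, ← mul_assoc, h]
  obtain ⟨h3, h4⟩ := qt_pow_injective h2
  ext
  · exact h3
  · simp only; omega

lemma val_sub_ne_zero {x y : ℕ × ℤ} (h : x ≠ y) : val x - val y ≠ 0 :=
  sub_ne_zero.mpr fun h' => h (val_injective h')

lemma t_mul_val (x : ℕ × ℤ) : t * val x = val (x.1, x.2 + 1) := by
  simp only [val, zpow_add_one₀ t_ne_zero]
  ring

lemma q_mul_val (x : ℕ × ℤ) : q * val x = val (x.1 + 1, x.2) := by
  simp only [val, pow_succ]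
  ring

lemma one_sub_t_pow_ne_zero {i : ℕ} (h : i ≠ 0) : 1 - t ^ i ≠ 0 := by
  have : val (0, 0) - val (0, i) ≠ 0 := val_sub_ne_zero (by simp; omega)
  simpa [val] using this

lemma one_sub_t_ne_zero : 1 - t ≠ 0 := by simpa using one_sub_t_pow_ne_zero one_ne_zero

lemma one_add_t_ne_zero : 1 + t ≠ 0 := fun h => by
  have : 1 - t ^ 2 = (1 - t) * (1 + t) := by ring
  exact one_sub_t_pow_ne_zero two_ne_zero (by rw [this, h, mul_zero])

end

end VVMac

namespace VVMac

noncomputable section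

/-! ### Inversions and reduced words -/

namespace Hecke

variable {n : ℕ}

/-- The inversions of a permutation. -/
def invSet (σ : Equiv.Perm (Fin n)) : Finset (Fin n × Fin n) :=
  Finset.univ.filter fun p => p.1 < p.2 ∧ σ p.2 < σ p.1

/-- The number of inversions of a permutation. -/
def inv (σ : Equiv.Perm (Fin n)) : ℕ := (invSet σ).card

lemma mem_invSet {σ : Equiv.Perm (Fin n)} {p : Fin n × Fin n} :
    p ∈ invSet σ ↔ p.1 < p.2 ∧ σ p.2 < σ p.1 := by simp [invSet]

lemma lo_lt_hi (i : Fin (n - 1)) : lo i < hi i := by simp [lo, hi, Fin.lt_def]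

lemma s_lo (i : Fin (n - 1)) : s i (lo i) = hi i := Equiv.swap_apply_left _ _

lemma s_hi (i : Fin (n - 1)) : s i (hi i) = lo i := Equiv.swap_apply_right _ _

lemma s_of_ne {i : Fin (n - 1)} {j : Fin n} (h1 : j ≠ lo i) (h2 : j ≠ hi i) : s i j = j :=
  Equiv.swap_apply_of_ne_of_ne h1 h2

lemma s_mul_self (i : Fin (n - 1)) : s i * s i = 1 := Equiv.swap_mul_self _ _

lemma s_mul_s_mul (i : Fin (n - 1)) (σ : Equiv.Perm (Fin n)) : s i * (s i * σ) = σ := by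
  rw [← mul_assoc, s_mul_self, one_mul]

lemma s_inv (i : Fin (n - 1)) : (s i)⁻¹ = s i := Equiv.swap_inv _ _

lemma inv_s_mul_apply (i : Fin (n - 1)) (σ : Equiv.Perm (Fin n)) (k : Fin n) :
    (s i * σ)⁻¹ k = σ⁻¹ (s i k) := by
  rw [mul_inv_rev, Equiv.Perm.mul_apply, s_inv]

lemma val_s (i : Fin (n - 1)) (j : Fin n) :
    (s i j).1 = if j.1 = i.1 then i.1 + 1 else if j.1 = i.1 + 1 then i.1 else j.1 := by
  by_cases h1 : j = lo i
  · subst h1; rw [s_lo]; simp [lo, hi]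
  by_cases h2 : j = hi i
  · subst h2; rw [s_hi]; simp [lo, hi]
  rw [s_of_ne h1 h2]
  have h1' : j.1 ≠ i.1 := fun h => h1 (Fin.ext h)
  have h2' : j.1 ≠ i.1 + 1 := fun h => h2 (Fin.ext h)
  rw [if_neg h1', if_neg h2']

/-- Exchanging two adjacent values alters the relative order of a single pair of positions, namely
those holding the two values. By hypothesis that pair was not an inversion and becomes one. -/
lemma inv_s_mul {i : Fin (n - 1)} {σ : Equiv.Perm (Fin n)} (h : σ⁻¹ (lo i) < σ⁻¹ (hi i)) :
    inv (s i * σ) = inv σ + 1 := by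
  have : invSet (s i * σ) = insert (σ⁻¹ (lo i), σ⁻¹ (hi i)) (invSet σ) := by
    ext ⟨a, b⟩
    have e1 : σ a = σ b → a = b := fun e => σ.injective e
    have e2 : ∀ c, c = σ⁻¹ (lo i) ↔ σ c = lo i := fun c => Equiv.Perm.eq_inv_iff_eq
    have e3 : ∀ c, c = σ⁻¹ (hi i) ↔ σ c = hi i := fun c => Equiv.Perm.eq_inv_iff_eq
    have ea2 := e2 a
    have ea3 := e3 a
    have eb2 := e2 b
    have eb3 := e3 b
    rw [Finset.mem_insert, mem_invSet, mem_invSet]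
    generalize σ⁻¹ (lo i) = p at *
    generalize σ⁻¹ (hi i) = r at *
    simp only [Equiv.Perm.mul_apply, Prod.mk.injEq, Fin.lt_def, Fin.ext_iff, val_s] at *
    generalize (σ a).1 = x at *
    generalize (σ b).1 = y at *
    simp only [lo, hi] at *
    split_ifs <;> omega
  rw [inv, this, Finset.card_insert_of_notMem, inv]
  rw [mem_invSet]
  simp [(lo_lt_hi i).le]

lemma inv_s_mul_of_gt {i : Fin (n - 1)} {σ : Equiv.Perm (Fin n)} (h : σ⁻¹ (hi i) < σ⁻¹ (lo i)) :
    inv (s i * σ) + 1 = inv σ := by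
  have h2 : (s i * σ)⁻¹ (lo i) < (s i * σ)⁻¹ (hi i) := by
    rwa [inv_s_mul_apply, inv_s_mul_apply, s_lo, s_hi]
  rw [← inv_s_mul h2, s_mul_s_mul]

lemma inv_one : inv (1 : Equiv.Perm (Fin n)) = 0 := by
  rw [inv, Finset.card_eq_zero, Finset.eq_empty_iff_forall_notMem]
  intro p hp
  rw [mem_invSet] at hp
  exact lt_asymm hp.1 hp.2

/-- Without such an index `σ⁻¹` would be increasing, and the only monotone permutation is the
identity. -/
lemma exists_descent {σ : Equiv.Perm (Fin n)} (h : σ ≠ 1) :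
    ∃ i : Fin (n - 1), σ⁻¹ (hi i) < σ⁻¹ (lo i) := by
  by_contra! hc
  apply h
  rw [← _root_.inv_inj, _root_.inv_one]
  have hm : StrictMono (σ⁻¹ : Equiv.Perm (Fin n)) := by
    cases n with
    | zero => exact fun a => a.elim0
    | succ n =>
      rw [Fin.strictMono_iff_lt_succ]
      intro i
      refine lt_of_le_of_ne (hc i) fun e => ?_
      exact (Fin.castSucc_lt_succ (i := i)).ne (σ⁻¹.injective e)
  exact (Equiv.Perm.monotone_iff _).mp hm.monotone

lemma inv_prod_le (l : List (Fin (n - 1))) : inv (l.map s).prod ≤ l.length := by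
  induction l with
  | nil => simp [inv_one]
  | cons i l ih =>
    rw [List.map_cons, List.prod_cons, List.length_cons]
    rcases lt_trichotomy ((l.map s).prod⁻¹ (lo i)) ((l.map s).prod⁻¹ (hi i)) with h | h | h
    · rw [inv_s_mul h]; omega
    · exact absurd (Equiv.injective _ h) (lo_lt_hi i).ne
    · have := inv_s_mul_of_gt h; omega

lemma exists_word_length_eq_inv (σ : Equiv.Perm (Fin n)) :
    ∃ l : List (Fin (n - 1)), (l.map s).prod = σ ∧ l.length = inv σ := by
  induction h : inv σ generalizing σ with
  | zero =>
    refine ⟨[], ?_, rfl⟩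
    by_contra hσ
    obtain ⟨i, hi⟩ := exists_descent (Ne.symm hσ)
    have := inv_s_mul_of_gt hi
    omega
  | succ r ih =>
    have hσ : σ ≠ 1 := by rintro rfl; rw [inv_one] at h; omega
    obtain ⟨i, hi⟩ := exists_descent hσ
    have := inv_s_mul_of_gt hi
    obtain ⟨l, hl, hr⟩ := ih (s i * σ) (by omega)
    exact ⟨i :: l, by rw [List.map_cons, List.prod_cons, hl, s_mul_s_mul], by simp [hr]⟩

/-- Removing descents one at a time yields a word of length `inv σ`, and no word is shorter since a
generator changes the number of inversions by one. Minimality of a word thus becomes a numerical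
condition. -/
lemma isReduced_iff {σ : Equiv.Perm (Fin n)} {l : List (Fin (n - 1))} :
    IsReduced σ l ↔ (l.map s).prod = σ ∧ l.length = inv σ := by
  constructor
  · rintro ⟨h1, h2⟩
    obtain ⟨l', h3, h4⟩ := exists_word_length_eq_inv σ
    have h5 := h2 l' h3
    have h6 := inv_prod_le l
    rw [h1] at h6
    exact ⟨h1, by omega⟩
  · rintro ⟨h1, h2⟩
    refine ⟨h1, fun l' h3 => ?_⟩
    rw [h2, ← h3]
    exact inv_prod_le l'

lemma word_spec (σ : Equiv.Perm (Fin n)) : ((word σ).map s).prod = σ ∧ (word σ).length = inv σ :=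
  isReduced_iff.mp (exists_reduced σ).choose_spec

lemma length_eq_inv (σ : Equiv.Perm (Fin n)) : length σ = inv σ := (word_spec σ).2

/-- A shortest word starts with a descent. -/
lemma descent_of_cons {i : Fin (n - 1)} {l : List (Fin (n - 1))} {σ : Equiv.Perm (Fin n)}
    (h1 : ((i :: l).map s).prod = σ) (h2 : (i :: l).length = inv σ) :
    σ⁻¹ (hi i) < σ⁻¹ (lo i) ∧ (l.map s).prod = s i * σ ∧ l.length = inv (s i * σ) := by
  have h3 : (l.map s).prod = s i * σ := by
    rw [← h1, List.map_cons, List.prod_cons, s_mul_s_mul]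
  have h4 := inv_prod_le l
  rw [h3] at h4
  rw [List.length_cons] at h2
  rcases lt_trichotomy (σ⁻¹ (lo i)) (σ⁻¹ (hi i)) with h | h | h
  · have := inv_s_mul h; omega
  · exact absurd (Equiv.injective _ h) (lo_lt_hi i).ne
  · have := inv_s_mul_of_gt h; exact ⟨h, h3, by omega⟩

lemma s_braid {i j : Fin (n - 1)} (h : j.1 = i.1 + 1) : s i * s j * s i = s j * s i * s j := by
  have e : lo j = hi i := Fin.ext h
  have h1 : lo i ≠ hi i := (lo_lt_hi i).ne
  have h2 : hi i ≠ hi j := e ▸ (lo_lt_hi j).ne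
  have h3 : lo i ≠ hi j := ((lo_lt_hi i).trans (e ▸ lo_lt_hi j)).ne
  simp only [s, e]
  rw [Equiv.swap_mul_swap_mul_swap h1 h3, Equiv.swap_comm (lo i) (hi i),
    Equiv.swap_comm (hi i) (hi j), Equiv.swap_mul_swap_mul_swap h2.symm h3.symm, Equiv.swap_comm]

lemma s_comm {i j : Fin (n - 1)} (h : i.1 + 1 < j.1 ∨ j.1 + 1 < i.1) : s i * s j = s j * s i := by
  apply (Equiv.Perm.Disjoint.commute _).eq
  intro k
  simp only [Fin.ext_iff, val_s]
  split_ifs <;> omega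

/-- A distant descent `j` survives multiplication by `s i`, so two letters can be split off in
either order. This is the commuting case of Matsumoto's theorem. -/
lemma exists_word_cons_cons {i j : Fin (n - 1)} {σ : Equiv.Perm (Fin n)}
    (hi : σ⁻¹ (hi i) < σ⁻¹ (lo i)) (hj : σ⁻¹ (VVMac.hi j) < σ⁻¹ (lo j))
    (h : i.1 + 1 < j.1 ∨ j.1 + 1 < i.1) :
    ∃ l : List (Fin (n - 1)), (l.map s).prod = s j * (s i * σ) ∧ l.length + 2 = inv σ := by
  obtain ⟨l, h1, h2⟩ := exists_word_length_eq_inv (s j * (s i * σ))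
  refine ⟨l, h1, ?_⟩
  have h3 := inv_s_mul_of_gt hi
  have h4 : (s i * σ)⁻¹ (VVMac.hi j) < (s i * σ)⁻¹ (lo j) := by
    have e1 : s i (VVMac.hi j) = VVMac.hi j := by
      apply s_of_ne <;> simp only [ne_eq, Fin.ext_iff, VVMac.hi, lo] <;> omega
    have e2 : s i (lo j) = lo j := by
      apply s_of_ne <;> simp only [ne_eq, Fin.ext_iff, VVMac.hi, lo] <;> omega
    rwa [inv_s_mul_apply, inv_s_mul_apply, e1, e2]
  have h5 := inv_s_mul_of_gt h4
  omega

/-- Two adjacent descents mean that three consecutive values occur in reverse order, so all three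
letters of a braid word can be split off, each lowering the number of inversions. -/
lemma exists_word_cons_cons_cons {i j : Fin (n - 1)} {σ : Equiv.Perm (Fin n)}
    (hi : σ⁻¹ (hi i) < σ⁻¹ (lo i)) (hj : σ⁻¹ (VVMac.hi j) < σ⁻¹ (lo j))
    (h : j.1 = i.1 + 1 ∨ i.1 = j.1 + 1) :
    ∃ l : List (Fin (n - 1)),
      (l.map s).prod = s i * (s j * (s i * σ)) ∧ l.length + 3 = inv σ := by
  obtain ⟨l, h1, h2⟩ := exists_word_length_eq_inv (s i * (s j * (s i * σ)))
  refine ⟨l, h1, ?_⟩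
  have h3 := inv_s_mul_of_gt hi
  have h4 : (s i * σ)⁻¹ (VVMac.hi j) < (s i * σ)⁻¹ (lo j) := by
    rw [inv_s_mul_apply, inv_s_mul_apply]
    rcases h with h | h
    · have e1 : s i (VVMac.hi j) = VVMac.hi j := by
        ext
        simp only [val_s, VVMac.hi]; split_ifs <;> omega
      have e2 : s i (lo j) = lo i := by ext; rw [val_s]; simp [lo, h]
      have e4 : lo j = VVMac.hi i := by ext; simp [lo, VVMac.hi, h]
      rw [e1, e2]
      rw [e4] at hj
      exact hj.trans hi
    · have e1 : s i (VVMac.hi j) = VVMac.hi i := by ext; rw [val_s]; simp [VVMac.hi, h]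
      have e2 : s i (lo j) = lo j := by ext; simp only [val_s, lo]; split_ifs <;> omega
      have e4 : VVMac.hi j = lo i := by ext; simp [lo, VVMac.hi, h]
      rw [e1, e2]
      rw [e4] at hj
      exact hi.trans hj
  have h5 := inv_s_mul_of_gt h4
  have h6 : (s j * (s i * σ))⁻¹ (VVMac.hi i) < (s j * (s i * σ))⁻¹ (lo i) := by
    rw [inv_s_mul_apply, inv_s_mul_apply, inv_s_mul_apply, inv_s_mul_apply]
    have e1 : s j (s i (VVMac.hi j)) = VVMac.hi i := by
      ext; 
        simp only [val_s, VVMac.hi]; split_ifs <;> omega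
    have e2 : s j (s i (lo j)) = lo i := by
      ext; simp only [val_s, lo]; split_ifs <;> omega
    have e3 : ∀ k l, s j (s i k) = l → s i (s j l) = k := by
      rintro k l rfl
      rw [← Equiv.Perm.mul_apply (s j) (s j), s_mul_self, Equiv.Perm.one_apply,
        ← Equiv.Perm.mul_apply, s_mul_self, Equiv.Perm.one_apply]
    rwa [e3 _ _ e1, e3 _ _ e2]
  have h7 := inv_s_mul_of_gt h6
  omega

/-- Matsumoto's theorem for the symmetric group: the products of the `T_i` along two reduced words
of the same permutation agree. -/
lemma prod_T_eq_of_reduced (l l' : List (Fin (n - 1))) (σ : Equiv.Perm (Fin n))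
    (h1 : (l.map s).prod = σ) (h2 : l.length = inv σ)
    (h1' : (l'.map s).prod = σ) (h2' : l'.length = inv σ) :
    (l.map T).prod = (l'.map T).prod := by
  induction hr : inv σ using Nat.strong_induction_on generalizing l l' σ with
  | _ r ih =>
  match l, l' with
  | [], [] => rfl
  | [], _ :: _ => rw [List.length_nil] at h2; rw [← h2] at h2'; simp at h2'
  | _ :: _, [] => rw [List.length_nil] at h2'; rw [← h2'] at h2; simp at h2
  | i :: m, j :: m' =>
    obtain ⟨d1, d2, d3⟩ := descent_of_cons h1 h2
    obtain ⟨d1', d2', d3'⟩ := descent_of_cons h1' h2'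
    have hi := inv_s_mul_of_gt d1
    have hj := inv_s_mul_of_gt d1'
    rw [List.map_cons, List.prod_cons, List.map_cons, List.prod_cons]
    by_cases hij : i = j
    · subst hij
      rw [ih _ (by omega) m m' _ d2 d3 d2' d3' rfl]
    have hij' : i.1 ≠ j.1 := fun h => hij (Fin.ext h)
    by_cases hc : j.1 = i.1 + 1 ∨ i.1 = j.1 + 1
    · obtain ⟨p, p1, p2⟩ := exists_word_cons_cons_cons d1 d1' hc
      have hb : s i * s j * s i = s j * s i * s j := by
        rcases hc with hc | hc
        · exact s_braid hc
        · exact (s_braid hc).symm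
      have hT : T i * T j * T i = T j * T i * T j := by
        rcases hc with hc | hc
        · exact braid _ _ hc
        · exact (braid _ _ hc).symm
      have p1' : (p.map s).prod = s j * (s i * (s j * σ)) := by
        rw [p1]; simp only [← mul_assoc]; rw [hb]
      rw [ih _ (by omega) m (j :: i :: p) _ d2 d3
          (by simp only [List.map_cons, List.prod_cons, p1, s_mul_s_mul])
          (by simp only [List.length_cons]; omega) rfl,
        ih _ (by omega) m' (i :: j :: p) _ d2' d3'
          (by simp only [List.map_cons, List.prod_cons, p1', s_mul_s_mul])
          (by simp only [List.length_cons]; omega) rfl]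
      simp only [List.map_cons, List.prod_cons, ← mul_assoc]
      rw [hT]
    · have hc' : i.1 + 1 < j.1 ∨ j.1 + 1 < i.1 := by omega
      obtain ⟨p, p1, p2⟩ := exists_word_cons_cons d1 d1' hc'
      have p1' : (p.map s).prod = s i * (s j * σ) := by
        rw [p1]; simp only [← mul_assoc]; rw [s_comm hc']
      rw [ih _ (by omega) m (j :: p) _ d2 d3
          (by simp only [List.map_cons, List.prod_cons, p1, s_mul_s_mul])
          (by simp only [List.length_cons]; omega) rfl,
        ih _ (by omega) m' (i :: p) _ d2' d3'
          (by simp only [List.map_cons, List.prod_cons, p1', s_mul_s_mul])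
          (by simp only [List.length_cons]; omega) rfl]
      simp only [List.map_cons, List.prod_cons, ← mul_assoc]
      rw [(comm i j hc').eq]

/-! ### The symmetrizer and the Poincaré polynomial. -/

lemma T_mul_Tperm {i : Fin (n - 1)} {σ : Equiv.Perm (Fin n)} (h : σ⁻¹ (lo i) < σ⁻¹ (hi i)) :
    T i * Tperm σ = Tperm (s i * σ) := by
  rw [Tperm, ← List.prod_cons, ← List.map_cons]
  refine prod_T_eq_of_reduced _ _ (s i * σ) ?_ ?_ (word_spec _).1 (word_spec _).2
  · rw [List.map_cons, List.prod_cons, (word_spec σ).1]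
  · rw [List.length_cons, (word_spec σ).2, inv_s_mul h]

lemma T_mul_T (i : Fin (n - 1)) : T i * T i = (1 - t) • T i + t • 1 := by
  have h := quad i
  rw [Algebra.algebraMap_eq_smul_one] at h
  have : (T i - 1) * (T i + t • 1) = T i * T i - ((1 - t) • T i + t • 1) := by
    simp only [sub_mul, mul_add, one_mul, mul_smul_comm, mul_one, sub_smul, one_smul, smul_sub]
    abel
  rw [this] at h
  exact sub_eq_zero.mp h

/-- The image of the symmetrizer consists of invariants. -/
lemma T_mul_eps (i : Fin (n - 1)) : T i * eps n = eps n := by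
  rw [eps, mul_smul_comm]
  congr 1
  rw [Finset.mul_sum]
  simp only [mul_smul_comm, length_eq_inv]
  set A := Finset.univ.filter fun σ : Equiv.Perm (Fin n) => σ⁻¹ (lo i) < σ⁻¹ (hi i)
  -- The permutations are paired as `σ`, `s i * σ` with `σ` the shorter one. Up to a power of `t` a
  -- pair contributes `t T_σ + T_{s_i σ}`, which the quadratic relation shows to be fixed by `T i`.
  have hsplit : ∀ f : Equiv.Perm (Fin n) → Hecke n,
      ∑ σ, f σ = ∑ σ ∈ A, (f σ + f (s i * σ)) := by
    intro f
    rw [Finset.sum_add_distrib, ← Finset.sum_filter_add_sum_filter_not Finset.univ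
      (fun σ : Equiv.Perm (Fin n) => σ⁻¹ (lo i) < σ⁻¹ (hi i)) f]
    congr 1
    refine (Finset.sum_bij' (fun σ _ => s i * σ) (fun σ _ => s i * σ) ?_ ?_ ?_ ?_ ?_).symm
    · intro σ hσ
      refine Finset.mem_filter.mpr ⟨Finset.mem_univ _, ?_⟩
      rw [inv_s_mul_apply, inv_s_mul_apply, s_lo, s_hi]
      exact (Finset.mem_filter.mp hσ).2.asymm
    · intro σ hσ
      have h := (Finset.mem_filter.mp hσ).2
      refine Finset.mem_filter.mpr ⟨Finset.mem_univ _, ?_⟩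
      have h2 : σ⁻¹ (lo i) ≠ σ⁻¹ (hi i) := fun e => (lo_lt_hi i).ne (Equiv.injective _ e)
      rw [inv_s_mul_apply, inv_s_mul_apply, s_lo, s_hi]
      exact lt_of_le_of_ne (not_lt.mp h) h2.symm
    · intro σ _; exact s_mul_s_mul i σ
    · intro σ _; exact s_mul_s_mul i σ
    · intro σ _; rfl
  rw [hsplit, hsplit]
  refine Finset.sum_congr rfl fun σ hσ => ?_
  have hσ' := (Finset.mem_filter.mp hσ).2
  have hT : T i * Tperm (s i * σ) = (1 - t) • Tperm (s i * σ) + t • Tperm σ := by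
    rw [← T_mul_Tperm hσ', ← mul_assoc, T_mul_T, add_mul, smul_mul_assoc, smul_mul_assoc, one_mul]
  rw [T_mul_Tperm hσ', hT, inv_s_mul hσ']
  set N : ℤ := (n.choose 2 : ℤ) - (inv σ : ℤ) - 1 with hN
  have e1 : (n.choose 2 : ℤ) - (inv σ : ℤ) = N + 1 := by omega
  have e2 : (n.choose 2 : ℤ) - ((inv σ + 1 : ℕ) : ℤ) = N := by push_cast; omega
  rw [e1, e2, zpow_add_one₀ t_ne_zero]
  simp only [smul_add, smul_sub, sub_smul, one_smul, smul_smul]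
  abel

/-- Insertion of the value `p` at position `0` in front of a permutation. -/
def consPerm (x : Fin (n + 1) × Equiv.Perm (Fin n)) : Equiv.Perm (Fin (n + 1)) :=
  (finSuccEquiv n).trans ((Equiv.optionCongr x.2).trans (finSuccEquiv' x.1).symm)

lemma consPerm_zero (x : Fin (n + 1) × Equiv.Perm (Fin n)) : consPerm x 0 = x.1 := by
  simp [consPerm]

lemma consPerm_succ (x : Fin (n + 1) × Equiv.Perm (Fin n)) (i : Fin n) :
    consPerm x i.succ = x.1.succAbove (x.2 i) := by
  simp [consPerm]

lemma consPerm_bijective : Function.Bijective (consPerm (n := n)) := by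
  rw [Fintype.bijective_iff_injective_and_card]
  constructor
  · rintro ⟨p, σ⟩ ⟨p', σ'⟩ h
    have h0 := congrArg (fun e : Equiv.Perm (Fin (n + 1)) => e 0) h
    simp only [consPerm_zero] at h0
    subst h0
    congr
    ext1 i
    have hi := congrArg (fun e : Equiv.Perm (Fin (n + 1)) => e i.succ) h
    simp only [consPerm_succ] at hi
    exact Fin.succAbove_right_injective hi
  · simp [Fintype.card_perm, Nat.factorial_succ]

/-- The inversions involving position `0` correspond to the values smaller than the inserted one.
All others are inversions of the original permutation, as `succAbove` is increasing. -/
lemma inv_consPerm (x : Fin (n + 1) × Equiv.Perm (Fin n)) :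
    inv (consPerm x) = x.1.1 + inv x.2 := by
  have h : invSet (consPerm x) =
      (Finset.univ.filter fun j : Fin n => (x.2 j).castSucc < x.1).image (fun j => (0, j.succ)) ∪
        (invSet x.2).image (Prod.map Fin.succ Fin.succ) := by
    ext ⟨a, b⟩
    simp only [mem_invSet, Finset.mem_union, Finset.mem_image, Finset.mem_filter,
      Finset.mem_univ, true_and, Prod.exists, Prod.map_apply, Prod.mk.injEq]
    refine Fin.cases ?_ (fun a => ?_) a <;> refine Fin.cases ?_ (fun b => ?_) b
    · simp
    · simp [consPerm_zero, consPerm_succ, Fin.succAbove_lt_iff_castSucc_lt, (Fin.succ_ne_zero _)]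
    · simp [(Fin.succ_ne_zero _), (Fin.succ_ne_zero _).symm]
    · simp [consPerm_succ, (Fin.succ_ne_zero _).symm]
  have hc : (Finset.univ.filter fun j : Fin n => (x.2 j).castSucc < x.1).card = x.1.1 := by
    have : (Finset.univ.filter fun j : Fin n => (x.2 j).castSucc < x.1).map x.2.toEmbedding
        = Finset.univ.filter fun j : Fin n => j.1 < x.1.1 := by
      ext j
      simp only [Finset.mem_map_equiv, Finset.mem_filter, Finset.mem_univ, true_and,
        Equiv.apply_symm_apply, Fin.lt_def, Fin.val_castSucc]
    rw [← Finset.card_map, this]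
    have h2 : (Finset.univ.filter fun j : Fin n => j.1 < x.1.1).map Fin.valEmbedding
        = Finset.range x.1.1 := by
      ext j
      simp only [Finset.mem_map, Finset.mem_filter, Finset.mem_univ, true_and,
        Fin.valEmbedding_apply, Finset.mem_range]
      constructor
      · rintro ⟨a, h, rfl⟩; exact h
      · intro h; exact ⟨⟨j, by omega⟩, h, rfl⟩
    rw [← Finset.card_map, h2, Finset.card_range]
  rw [inv, h, Finset.card_union_of_disjoint, Finset.card_image_of_injective,
    Finset.card_image_of_injective, hc, inv]
  · exact (Fin.succ_injective _).prodMap (Fin.succ_injective _)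
  · intro a b hab
    simpa using hab
  · rw [Finset.disjoint_left]
    rintro ⟨a, b⟩ h1 h2
    simp only [Finset.mem_image, Prod.mk.injEq, Prod.exists, Prod.map_apply] at h1 h2
    obtain ⟨_, _, rfl, _⟩ := h1
    obtain ⟨_, _, _, h, _⟩ := h2
    exact Fin.succ_ne_zero _ h

/-- The generating function of the number of inversions. -/
lemma sum_pow_inv (x : K) : ∀ n : ℕ,
    ∑ σ : Equiv.Perm (Fin n), x ^ inv σ = ∏ i ∈ Finset.range n, ∑ j ∈ Finset.range (i + 1), x ^ j
  | 0 => by simp [inv, invSet]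
  | n + 1 => by
    rw [← consPerm_bijective.sum_comp, Fintype.sum_prod_type, Finset.prod_range_succ,
      ← sum_pow_inv x n, mul_comm, Finset.sum_mul_sum, Finset.sum_range]
    exact Finset.sum_congr rfl fun p _ => Finset.sum_congr rfl fun σ _ => by
      rw [inv_consPerm, pow_add]

/-- The Poincaré polynomial of the symmetric group. -/
lemma sum_zpow_length (n : ℕ) :
    ∑ σ : Equiv.Perm (Fin n), t ^ ((n.choose 2 : ℤ) - (length σ : ℤ)) =
      ∏ i ∈ Finset.Icc 1 n, (1 - t ^ i) / (1 - t) := by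
  -- The sum is the inversion generating function at `t⁻¹`, rescaled. In the induction below, the
  -- growth of `n.choose 2` by `n` supplies the factor `t ^ n` that turns the geometric sum in `t⁻¹`
  -- into the one in `t`.
  have h1 : ∀ σ : Equiv.Perm (Fin n), t ^ ((n.choose 2 : ℤ) - (length σ : ℤ)) =
      t ^ n.choose 2 * t⁻¹ ^ inv σ := fun σ => by
    rw [zpow_sub₀ t_ne_zero, zpow_natCast, zpow_natCast, length_eq_inv, inv_pow, div_eq_mul_inv]
  rw [Finset.sum_congr rfl fun σ _ => h1 σ, ← Finset.mul_sum, sum_pow_inv]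
  have ht := t_ne_zero
  have ht1 := one_sub_t_ne_zero
  have ht2 : t⁻¹ ≠ 1 := fun h => ht1 (by rw [← inv_inv t, h]; simp)
  have ht3 : t - 1 ≠ 0 := fun h => ht1 (by rw [← neg_sub, h, neg_zero])
  induction n with
  | zero => simp
  | succ n ih =>
    rw [Finset.prod_range_succ, Finset.prod_Icc_succ_top (by omega), ← ih,
      Nat.choose_succ_succ' n 1,
      pow_add, Nat.choose_one_right, geom_sum_eq ht2]
    · have : t⁻¹ - 1 ≠ 0 := sub_ne_zero.mpr ht2
      have h4 : t ^ n * ((t⁻¹ ^ (n + 1) - 1) / (t⁻¹ - 1)) = (1 - t ^ (n + 1)) / (1 - t) := by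
        rw [mul_div_assoc', div_eq_div_iff this ht1, pow_succ t⁻¹ n, inv_pow]
        field_simp
        ring
      rw [← h4]
      ring
    · intro σ
      rw [zpow_sub₀ ht, zpow_natCast, zpow_natCast, length_eq_inv, inv_pow, div_eq_mul_inv]

/-- The symmetrizer fixes the invariants. -/
lemma eps_smul_of_invariant {M : Type*} [AddCommGroup M] [Module K M] [Module (Hecke n) M]
    [IsScalarTower K (Hecke n) M] {v : M} (h : ∀ i : Fin (n - 1), (T i : Hecke n) • v = v) :
    eps n • v = v := by
  have hT : ∀ l : List (Fin (n - 1)), (l.map (T (n := n))).prod • v = v := by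
    intro l
    induction l with
    | nil => simp
    | cons i l ih => rw [List.map_cons, List.prod_cons, mul_smul, ih, h]
  rw [eps, smul_assoc, Finset.sum_smul]
  simp only [smul_assoc, Tperm, hT]
  rw [← Finset.sum_smul, sum_zpow_length, smul_smul, inv_mul_cancel₀, one_smul]
  refine Finset.prod_ne_zero_iff.mpr fun i hi => ?_
  exact div_ne_zero (one_sub_t_pow_ne_zero (by have := (Finset.mem_Icc.mp hi).1; omega))
    one_sub_t_ne_zero

end Hecke
end
end VVMac

namespace VVMac

noncomputable section

/-! ### The elements `X_i` of an extended affine Hecke algebra -/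

section Ordered

variable {R : Type*} [Monoid R]

/-- The product `f 0 * f 1 * ⋯ * f (k - 1)`. -/
def up (f : ℕ → R) : ℕ → R
  | 0 => 1
  | k + 1 => up f k * f k

/-- The product `f (k - 1) * ⋯ * f 1 * f 0`. -/
def down (f : ℕ → R) : ℕ → R
  | 0 => 1
  | k + 1 => f k * down f k

lemma up_succ' (f : ℕ → R) : ∀ k, up f (k + 1) = f 0 * up (fun j => f (j + 1)) k
  | 0 => by simp [up]
  | k + 1 => by rw [up, up_succ' f k, up, mul_assoc]

lemma up_mul_down {f g : ℕ → R} : ∀ {k : ℕ}, (∀ j < k, f j * g j = 1) → up f k * down g k = 1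
  | 0, _ => by simp [up, down]
  | k + 1, h => by
    rw [up, down, mul_assoc, ← mul_assoc (f k), h k k.lt_succ_self, one_mul,
      up_mul_down fun j hj => h j (by omega)]

lemma down_mul_up {f g : ℕ → R} : ∀ {k : ℕ}, (∀ j < k, f j * g j = 1) → down f k * up g k = 1
  | 0, _ => by simp [up, down]
  | k + 1, h => by
    rw [up, down, mul_assoc, ← mul_assoc (down f k), down_mul_up fun j hj => h j (by omega),
      one_mul, h k k.lt_succ_self]

lemma mul_up_of_forall {a : R} {f g : ℕ → R} :
    ∀ {k : ℕ}, (∀ j < k, a * f j = g j * a) → a * up f k = up g k * a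
  | 0, _ => by simp [up]
  | k + 1, h => by
    rw [up, up, ← mul_assoc, mul_up_of_forall fun j hj => h j (by omega), mul_assoc,
      h k k.lt_succ_self, mul_assoc]

lemma prod_ofFn_eq_up (f : ℕ → R) : ∀ m : ℕ, (List.ofFn fun i : Fin m => f i).prod = up f m
  | 0 => rfl
  | m + 1 => by
    rw [List.ofFn_succ', List.concat_eq_append, List.prod_append, List.prod_singleton, up,
      ← prod_ofFn_eq_up f m]
    rfl

/-- Passing through the ordered product shifts the index of a generator by one. Only one braid
relation is used; every other factor commutes. -/
lemma mul_up {f : ℕ → R} {m : ℕ}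
    (hb : ∀ i, i + 1 < m → f i * f (i + 1) * f i = f (i + 1) * f i * f (i + 1))
    (hc : ∀ i j, i + 1 < j → j < m → f i * f j = f j * f i)
    {j k : ℕ} (h : j + 1 < k) (hk : k ≤ m) :
    f (j + 1) * up f k = up f k * f j := by
  induction k with
  | zero => omega
  | succ k ih =>
    rw [up]
    rcases Nat.lt_or_ge (j + 1) k with h1 | h1
    · rw [← mul_assoc, ih h1 (by omega), mul_assoc, hc j k h1 (by omega), mul_assoc]
    · obtain rfl : k = j + 1 := by omega
      have h2 : f (j + 1) * up f j = up f j * f (j + 1) :=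
        mul_up_of_forall fun i hi => (hc i (j + 1) (by omega) (by omega)).symm
      rw [up]
      calc f (j + 1) * (up f j * f j * f (j + 1))
          = f (j + 1) * up f j * f j * f (j + 1) := by simp only [mul_assoc]
        _ = up f j * (f (j + 1) * f j * f (j + 1)) := by rw [h2]; simp only [mul_assoc]
        _ = up f j * f j * f (j + 1) * f j := by rw [← hb j (by omega)]; simp only [mul_assoc]

/-- The square of the ordered product carries the last generator to the first. By the index shift
the square equals `(f 1 ⋯ f k) (f 0 ⋯ f k) f k`, and multiplying by `f 0` on the left completes the
first factor. -/
lemma mul_up_mul_up {f : ℕ → R} {m : ℕ}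
    (hb : ∀ i, i + 1 < m → f i * f (i + 1) * f i = f (i + 1) * f i * f (i + 1))
    (hc : ∀ i j, i + 1 < j → j < m → f i * f j = f j * f i)
    {k : ℕ} (hk : k < m) :
    f 0 * (up f (k + 1) * up f (k + 1)) = up f (k + 1) * up f (k + 1) * f k := by
  have h : up f (k + 1) * up f k = up (fun j => f (j + 1)) k * up f (k + 1) :=
    mul_up_of_forall fun j hj => (mul_up hb hc (by omega) (by omega)).symm
  have h2 : up f (k + 1) * up f (k + 1) = up (fun j => f (j + 1)) k * up f (k + 1) * f k := by
    rw [← h, mul_assoc]; rfl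
  conv_lhs => rw [h2, ← mul_assoc, ← mul_assoc, ← up_succ']

end Ordered

section Affine

variable {R : Type} [Ring R] [Algebra K R]

/-- The relations between the generators `T_i`, `θ_i` and an element `ω` that make the
`X_1 = T_1 ⋯ T_m ω`, `X_{i+1} = t T_i⁻¹ X_i T_i⁻¹` satisfy the relations of the double affine
Hecke algebra. -/
structure IsExtended (m : ℕ) (T θ : ℕ → R) (ω : R) : Prop where
  quad : ∀ i < m, (T i - 1) * (T i + algebraMap K R t) = 0
  braid : ∀ i, i + 1 < m → T i * T (i + 1) * T i = T (i + 1) * T i * T (i + 1)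
  comm : ∀ i j, i + 1 < j → j < m → T i * T j = T j * T i
  step : ∀ i < m, θ (i + 1) = t • (hinv (T i) * θ i * hinv (T i))
  far : ∀ i < m, ∀ j ≤ m, j ≠ i → j ≠ i + 1 → T i * θ j = θ j * T i
  ω_T : ∀ i, i + 1 < m → T i * ω = ω * T (i + 1)
  ω_ω : ∀ k, m = k + 1 → ω * ω * T 0 = T k * (ω * ω)
  ω_θ : ∀ i < m, θ i * ω = ω * θ (i + 1)
  ω_θ_last : θ m * ω = q • (ω * θ 0)

/-- The elements `x`, `t T_1⁻¹ x T_1⁻¹`, …. -/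
def conjSeq (T : ℕ → R) (x : R) : ℕ → R
  | 0 => x
  | k + 1 => t • (hinv (T k) * conjSeq T x k * hinv (T k))

lemma conjSeq_eq (T : ℕ → R) (x : R) : ∀ k, conjSeq T x k =
    t ^ k • (down (fun j => hinv (T j)) k * x * up (fun j => hinv (T j)) k)
  | 0 => by simp [conjSeq, up, down]
  | k + 1 => by
    rw [conjSeq, conjSeq_eq T x k, up, down, mul_smul_comm, smul_mul_assoc, smul_smul, pow_succ']
    simp only [mul_assoc]

lemma hinv_braid {x y : R} (hx : (x - 1) * (x + algebraMap K R t) = 0)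
    (hy : (y - 1) * (y + algebraMap K R t) = 0) (h : x * y * x = y * x * y) :
    hinv x * hinv y * hinv x = hinv y * hinv x * hinv y := by
  have h1 : (hinv x * hinv y * hinv x) * (x * y * x) = 1 := by
    calc _ = hinv x * (hinv y * (hinv x * x) * y) * x := by simp only [mul_assoc]
      _ = 1 := by rw [hinv_mul hx, mul_one, hinv_mul hy, mul_one, hinv_mul hx]
  have h2 : (y * x * y) * (hinv y * hinv x * hinv y) = 1 := by
    calc _ = y * (x * (y * hinv y) * hinv x) * hinv y := by simp only [mul_assoc]
      _ = 1 := by rw [mul_hinv hy, mul_one, mul_hinv hx, mul_one, mul_hinv hy]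
  rw [h] at h1
  exact left_inv_eq_right_inv h1 h2

lemma hinv_comm {x y : R} (h : x * y = y * x) : hinv x * hinv y = hinv y * hinv x :=
  (commute_hinv (commute_hinv (show Commute x y from h)).symm).symm.eq

lemma hinv_intertwine {a x y : R} (h : a * x = y * a) : a * hinv x = hinv y * a := by
  simp only [hinv, mul_smul_comm, smul_mul_assoc, mul_add, add_mul, h,
    (Algebra.commutes (t - 1) a).symm]

namespace IsExtended

variable {m : ℕ} {T θ : ℕ → R} {ω : R} (H : IsExtended m T θ ω)

/-- The element `X_{i+1}`. -/
abbrev x (_ : IsExtended m T θ ω) : ℕ → R := conjSeq T (up T m * ω)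

/-- The element `t ^ m θ_1 T_1⁻¹ ⋯ T_m⁻¹`. -/
abbrev π (_ : IsExtended m T θ ω) : R := t ^ m • (θ 0 * up (fun j => hinv (T j)) m)

lemma S_braid (H : IsExtended m T θ ω) (i : ℕ) (h : i + 1 < m) :
    hinv (T i) * hinv (T (i + 1)) * hinv (T i) =
     
    hinv (T (i + 1)) * hinv (T i) * hinv (T (i + 1)) :=
  hinv_braid (H.quad i (by omega)) (H.quad _ h) (H.braid i h)

lemma S_comm (H : IsExtended m T θ ω) (i j : ℕ) (h : i + 1 < j) (hj : j < m) :
    hinv (T i) * hinv (T j) = hinv (T j) * hinv (T i) := hinv_comm (H.comm i j h hj)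

lemma T_mul_upS (H : IsExtended m T θ ω) {j : ℕ} (h : j + 1 < m) :
    T (j + 1) * up (fun j => hinv (T j)) m = up (fun j => hinv (T j)) m * T j := by
  have h1 : hinv (T (j + 1)) * up (fun j => hinv (T j)) m =
      up (fun j => hinv (T j)) m * hinv (T j) :=
    mul_up (f := fun j => hinv (T j)) H.S_braid H.S_comm h le_rfl
  calc _ = T (j + 1) * (up (fun j => hinv (T j)) m * hinv (T j)) * T j := by
        rw [mul_assoc, mul_assoc, hinv_mul (H.quad j (by omega)), mul_one]
    _ = T (j + 1) * hinv (T (j + 1)) * up (fun j => hinv (T j)) m * T j := by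
        rw [← h1]; simp only [mul_assoc]
    _ = _ := by rw [mul_hinv (H.quad _ h), one_mul]

/-- The product of the `T i` lowers the index by one and `ω` raises it again. -/
lemma T_mul_x_zero {j : ℕ} (h : j + 1 < m) : T (j + 1) * H.x 0 = H.x 0 * T (j + 1) := by
  simp only [x, conjSeq]
  rw [← mul_assoc, mul_up H.braid H.comm h le_rfl, mul_assoc, H.ω_T j h, mul_assoc]

lemma T_mul_x_of_lt {i : ℕ} (hi : i < m) : ∀ k : ℕ, k < i → Commute (T i) (H.x k)
  | 0, h => by
    obtain ⟨j, rfl⟩ : ∃ j, i = j + 1 := ⟨i - 1, by omega⟩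
    exact H.T_mul_x_zero hi
  | k + 1, h => by
    have hc : Commute (T i) (hinv (T k)) := commute_hinv (H.comm k i h hi).symm
    exact ((hc.mul_right (T_mul_x_of_lt hi k (by omega))).mul_right hc).smul_right t

/-- The essential case is `k = i + 2`. The braid relation moves `T i` through the inverses of `T (i
+ 1)` and `T i`, turning it into `T (i + 1)`, which commutes with `x i`; on the other side it is
turned back. -/
lemma T_mul_x_of_gt {i : ℕ} : ∀ k : ℕ, k ≤ m → i + 1 < k → Commute (T i) (H.x k)
  | 0, _, h => by omega
  | 1, _, h => by omega
  | k + 2, hk, h => by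
    rcases Nat.lt_or_ge (i + 1) (k + 1) with h1 | h1
    · have hc : Commute (T i) (hinv (T (k + 1))) := commute_hinv (H.comm i (k + 1) h1 (by omega))
      exact ((hc.mul_right (T_mul_x_of_gt (k + 1) (by omega) h1)).mul_right hc).smul_right t
    · obtain rfl : i = k := by omega
      have hab := H.braid i (by omega)
      have qa := H.quad i (by omega)
      have qb := H.quad (i + 1) (by omega)
      have e3 : Commute (T (i + 1)) (H.x i) := H.T_mul_x_of_lt (by omega) i (Nat.lt_succ_self i)
      simp only [x, conjSeq] at e3 ⊢
      generalize conjSeq T (up T m * ω) i = y at *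
      generalize T i = a at *
      generalize T (i + 1) = b at *
      have e1 := braid_inv (mul_hinv qa) (hinv_mul qa) (mul_hinv qb) (hinv_mul qb) hab
      have e2 := braid_inv (mul_hinv qb) (hinv_mul qb) (mul_hinv qa) (hinv_mul qa) hab.symm
      have e4 : Commute a (hinv b * (hinv a * y * hinv a) * hinv b) := by
        calc a * (hinv b * (hinv a * y * hinv a) * hinv b)
            = a * (hinv b * hinv a) * y * (hinv a * hinv b) := by simp only [mul_assoc]
          _ = hinv b * hinv a * (b * y) * (hinv a * hinv b) := by
              rw [e1]; simp only [mul_assoc]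
          _ = hinv b * hinv a * y * (b * (hinv a * hinv b)) := by
              rw [e3.eq]; simp only [mul_assoc]
          _ = hinv b * (hinv a * y * hinv a) * hinv b * a := by
              rw [e2]; simp only [mul_assoc]
      rw [mul_smul_comm, smul_mul_assoc]
      exact (e4.smul_right t).smul_right t

lemma T_mul_x {i k : ℕ} (hi : i < m) (hk : k ≤ m) (h1 : k ≠ i) (h2 : k ≠ i + 1) :
    Commute (T i) (H.x k) := by
  rcases Nat.lt_or_ge k i with h | h
  · exact H.T_mul_x_of_lt hi k h
  · exact H.T_mul_x_of_gt k hk (by omega)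

/-- Write `S_0` for the inverse of `T 0`. It suffices that `x_0 S_0 x_0` commutes with `T 0`. With
`D` the product of all `T i` this element is `D² T_k⁻¹ ω²`: moving `T 0` through `D²` gives `T k`,
which commutes with its own inverse, and `ω²` turns `T k` back into `T 0`. -/
lemma x_zero_comm_x_one (hm : 0 < m) : Commute (H.x 0) (H.x 1) := by
  obtain ⟨k, rfl⟩ : ∃ k, m = k + 1 := ⟨m - 1, by omega⟩
  have q0 := H.quad 0 hm
  have qk := H.quad k (by omega)
  have h1 : ω * up (fun j => T (j + 1)) k = up T k * ω :=
    mul_up_of_forall fun j hj => (H.ω_T j (by omega)).symm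
  set D := up T (k + 1) with hD
  have hD' : hinv (T 0) * D = up (fun j => T (j + 1)) k := by
    rw [hD, up_succ', ← mul_assoc, hinv_mul q0, one_mul]
  have hDk : D * hinv (T k) = up T k := by
    rw [hD, up, mul_assoc, mul_hinv qk, mul_one]
  have hDD : T 0 * (D * D) = D * D * T k := mul_up_mul_up H.braid H.comm (by omega)
  have e : D * ω * hinv (T 0) * (D * ω) = D * D * hinv (T k) * (ω * ω) := by
    calc _ = D * (ω * (hinv (T 0) * D)) * ω := by simp only [mul_assoc]
      _ = D * (D * hinv (T k)) * ω * ω := by rw [hD', h1, hDk]; simp only [mul_assoc]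
      _ = _ := by simp only [mul_assoc]
  have e1 : T 0 * (D * ω * hinv (T 0) * (D * ω)) = D * ω * hinv (T 0) * (D * ω) * T 0 := by
    rw [e]
    calc _ = T 0 * (D * D) * hinv (T k) * (ω * ω) := by simp only [mul_assoc]
      _ = D * D * (T k * hinv (T k)) * (ω * ω) := by rw [hDD]; simp only [mul_assoc]
      _ = D * D * (hinv (T k) * T k) * (ω * ω) := by rw [mul_hinv qk, hinv_mul qk]
      _ = D * D * hinv (T k) * (T k * (ω * ω)) := by simp only [mul_assoc]
      _ = _ := by rw [← H.ω_ω k rfl]; simp only [mul_assoc]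
  have e2 : D * ω * (hinv (T 0) * (D * ω) * hinv (T 0)) =
      hinv (T 0) * (D * ω) * hinv (T 0) * (D * ω) := by
    calc _ = hinv (T 0) * T 0 * (D * ω * hinv (T 0) * (D * ω)) * hinv (T 0) := by
          rw [hinv_mul q0, one_mul]; simp only [mul_assoc]
      _ = hinv (T 0) * (D * ω * hinv (T 0) * (D * ω) * T 0) * hinv (T 0) := by
          rw [← e1]; simp only [mul_assoc]
      _ = hinv (T 0) * (D * ω * hinv (T 0) * (D * ω)) * (T 0 * hinv (T 0)) := by
          simp only [mul_assoc]
      _ = _ := by rw [mul_hinv q0, mul_one]; simp only [mul_assoc]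
  exact Commute.smul_right (show Commute _ _ from e2) t

lemma x_zero_comm : ∀ l : ℕ, l ≤ m → Commute (H.x 0) (H.x l)
  | 0, _ => Commute.refl _
  | 1, h => H.x_zero_comm_x_one h
  | l + 2, h => by
    have hc : Commute (H.x 0) (hinv (T (l + 1))) :=
      commute_hinv (H.T_mul_x_of_lt (by omega) 0 (by omega)).symm
    exact ((hc.mul_right (x_zero_comm (l + 1) (by omega))).mul_right hc).smul_right t

lemma x_comm_of_lt {l : ℕ} (hl : l ≤ m) : ∀ k : ℕ, k < l → Commute (H.x k) (H.x l)
  | 0, _ => H.x_zero_comm l hl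
  | k + 1, h => by
    have hc : Commute (hinv (T k)) (H.x l) :=
      (commute_hinv (H.T_mul_x (i := k) (by omega) hl (by omega) (by omega)).symm).symm
    exact ((hc.mul_left (x_comm_of_lt hl k (by omega))).mul_left hc).smul_left t

lemma x_comm {k l : ℕ} (hk : k ≤ m) (hl : l ≤ m) : H.x k * H.x l = H.x l * H.x k := by
  rcases lt_trichotomy k l with h | rfl | h
  · exact H.x_comm_of_lt hl k h
  · rfl
  · exact (H.x_comm_of_lt hk l h).symm

lemma θ_eq (H : IsExtended m T θ ω) : ∀ k ≤ m, θ k = conjSeq T (θ 0) k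
  | 0, _ => rfl
  | k + 1, h => by rw [H.step k h, H.θ_eq k (by omega), conjSeq]

/-- The inverses accumulated on the left cancel the product `T 0 ⋯ T (m - 1)` in `x 0`. -/
lemma x_last : H.x m = t ^ m • (ω * up (fun j => hinv (T j)) m) := by
  rw [x, conjSeq_eq, ← mul_assoc, down_mul_up fun j hj => hinv_mul (H.quad j hj), one_mul]

lemma up_mul_θ_last : up T m * θ m = H.π := by
  rw [H.θ_eq m le_rfl, conjSeq_eq, mul_smul_comm, mul_assoc, ← mul_assoc,
    up_mul_down fun j hj => mul_hinv (H.quad j hj), one_mul]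

/-- When `π` is written as `T 0 ⋯ T (m - 1) θ m`, the factors `θ m` and `ω` meet, and their relation
is the source of `q`. -/
lemma π_mul_x_last : H.π * H.x m = q • (H.x 0 * H.π) := by
  conv_lhs => rw [← H.up_mul_θ_last, H.x_last]
  rw [x, conjSeq, π, mul_smul_comm, mul_smul_comm, smul_comm q]
  congr 1
  calc _ = up T m * (θ m * ω) * up (fun j => hinv (T j)) m := by simp only [mul_assoc]
    _ = _ := by rw [H.ω_θ_last]; simp only [mul_assoc, smul_mul_assoc, mul_smul_comm]

lemma π_mul_T {j : ℕ} (h : j + 1 < m) : H.π * T j = T (j + 1) * H.π := by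
  rw [π, smul_mul_assoc, mul_smul_comm, mul_assoc, ← H.T_mul_upS h, ← mul_assoc, ← mul_assoc,
    H.far (j + 1) h 0 (by omega) (by omega) (by omega)]

/-- The product of inverses is first moved past the product of the `T i`. Then `θ 0` meets `ω` and
becomes `θ 1`, and `θ 1 T_0 = t T_0⁻¹ θ 0` produces the conjugation that defines `x 1`. -/
lemma π_mul_x_zero (hm : 0 < m) : H.π * H.x 0 = H.x 1 * H.π := by
  obtain ⟨k, rfl⟩ : ∃ k, m = k + 1 := ⟨m - 1, by omega⟩
  have q0 := H.quad 0 hm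
  have qk := H.quad k (by omega)
  have hC : up (fun j => hinv (T j)) (k + 1) * up T (k + 1) =
      up (fun j => T (j + 1)) k * up (fun j => hinv (T j)) k := by
    have h1 : up (fun j => hinv (T j)) (k + 1) * up T k =
        up (fun j => T (j + 1)) k * up (fun j => hinv (T j)) (k + 1) :=
      mul_up_of_forall fun j hj => (H.T_mul_upS (by omega)).symm
    calc _ = up (fun j => hinv (T j)) (k + 1) * up T k * T k := by
          rw [mul_assoc]; rfl
      _ = up (fun j => T (j + 1)) k * up (fun j => hinv (T j)) k * (hinv (T k) * T k) := by
          rw [h1, up]; simp only [mul_assoc]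
      _ = _ := by rw [hinv_mul qk, mul_one]
  have hω : ω * up (fun j => hinv (T (j + 1))) k = up (fun j => hinv (T j)) k * ω :=
    mul_up_of_forall fun j hj => hinv_intertwine (H.ω_T j (by omega)).symm
  have hθ : t • (hinv (T 0) * θ 0) = θ 1 * T 0 := by
    rw [H.step 0 hm, smul_mul_assoc, mul_assoc, hinv_mul q0, mul_one]
  have hD : hinv (T 0) * up T (k + 1) = up (fun j => T (j + 1)) k := by
    rw [up_succ', ← mul_assoc, hinv_mul q0, one_mul]
  have hCC : T 0 * up (fun j => hinv (T j)) (k + 1) = up (fun j => hinv (T (j + 1))) k := by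
    rw [up_succ', ← mul_assoc, mul_hinv q0, one_mul]
  have hθD : θ 0 * up (fun j => T (j + 1)) k = up (fun j => T (j + 1)) k * θ 0 :=
    mul_up_of_forall fun j hj =>
      (H.far (j + 1) (by omega) 0 (by omega) (by omega) (by omega)).symm
  rw [π, smul_mul_assoc, mul_smul_comm]
  congr 1
  calc θ 0 * up (fun j => hinv (T j)) (k + 1) * (up T (k + 1) * ω)
      = θ 0 * (up (fun j => hinv (T j)) (k + 1) * up T (k + 1)) * ω := by simp only [mul_assoc]
    _ = up (fun j => T (j + 1)) k * θ 0 * (up (fun j => hinv (T j)) k * ω) := by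
        rw [hC, ← hθD]; simp only [mul_assoc]
    _ = up (fun j => T (j + 1)) k * (θ 0 * ω) * up (fun j => hinv (T (j + 1))) k := by
        rw [← hω]; simp only [mul_assoc]
    _ = hinv (T 0) * up T (k + 1) * ω * (θ 1 * T 0) * up (fun j => hinv (T j)) (k + 1) := by
        rw [H.ω_θ 0 hm, ← hCC, ← hD]; simp only [mul_assoc]
    _ = _ := by
        rw [← hθ]
        simp only [conjSeq, mul_assoc, smul_mul_assoc, mul_smul_comm]

/-- Since `π` shifts the index of the `T i` as well, it respects the recursion defining the `x i`,
and only the case `i = 0` needs its own computation. -/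
lemma π_mul_x : ∀ i < m, H.π * H.x i = H.x (i + 1) * H.π
  | 0, h => H.π_mul_x_zero h
  | i + 1, h => by
    have e : H.π * hinv (T i) = hinv (T (i + 1)) * H.π := hinv_intertwine (H.π_mul_T h)
    calc H.π * (t • (hinv (T i) * H.x i * hinv (T i)))
        = t • (H.π * hinv (T i) * H.x i * hinv (T i)) := by
          simp only [mul_smul_comm, mul_assoc]
      _ = t • (hinv (T (i + 1)) * (H.π * H.x i) * hinv (T i)) := by rw [e]; simp only [mul_assoc]
      _ = t • (hinv (T (i + 1)) * H.x (i + 1) * (H.π * hinv (T i))) := by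
          rw [π_mul_x i (by omega)]; simp only [mul_assoc]
      _ = t • (hinv (T (i + 1)) * H.x (i + 1) * hinv (T (i + 1))) * H.π := by
          rw [e]; simp only [mul_assoc, smul_mul_assoc]

end IsExtended

end Affine

end

end VVMac

namespace VVMac

noncomputable section

/-! ### Combinatorics of periodic standard tableaux -/

/-- The pairs `(w, c)` and `(w', c')` at positions `i` and `i + 1` for which `s_i` goes up. -/
def Up (x y : ℕ × ℤ) : Prop := x.1 < y.1 ∨ (x.1 = y.1 ∧ 1 < x.2 - y.2)

instance (x y : ℕ × ℤ) : Decidable (Up x y) := by unfold Up; infer_instance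

variable {lam : YoungDiagram}

/-- The box in row `r` and column `c`, if it lies weakly north-west of the box `b`. -/
def boxOf (b : Box lam) (r c : ℕ) (hr : r ≤ b.1.1) (hc : c ≤ b.1.2) : Box lam :=
  ⟨(r, c), by
    have := b.2
    rw [YoungDiagram.mem_cells] at this ⊢
    exact lam.up_left_mem hr hc this⟩

lemma box_ext {b b' : Box lam} (h1 : b.1.1 = b'.1.1) (h2 : b.1.2 = b'.1.2) : b = b' :=
  Subtype.ext (Prod.ext h1 h2)

lemma LabelLT.trans {n : ℕ} {x y z : Fin n × ℕ} (h1 : LabelLT x y) (h2 : LabelLT y z) :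
    LabelLT x z := by
  unfold LabelLT at *
  simp only [Fin.lt_def] at *
  omega

namespace PSYT

/-- The pair of exponent and content at `i`. -/
def u (τ : PSYT lam) (i : Fin lam.card) : ℕ × ℤ := (τ.w i, τ.c i)

lemma val_u (τ : PSYT lam) (i : Fin lam.card) : val (τ.u i) = τ.weight i := rfl

/-- The label of a box. -/
def label (τ : PSYT lam) (b : Box lam) : Fin lam.card × ℕ := (τ.idx b, τ.pow b)

lemma label_lt_of_le (τ : PSYT lam) {b b' : Box lam} (h1 : b.1.1 ≤ b'.1.1) (h2 : b.1.2 ≤ b'.1.2)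
    (hne : b ≠ b') : LabelLT (τ.label b) (τ.label b') := by
  rcases h1.eq_or_lt with h1' | h1'
  · exact τ.row_strict _ _ ⟨h1', lt_of_le_of_ne h2 fun h => hne (box_ext h1' h)⟩
  rcases h2.eq_or_lt with h2' | h2'
  · exact τ.col_strict _ _ ⟨h2', h1'⟩
  exact LabelLT.trans (τ.col_strict b (boxOf b' b'.1.1 b.1.2 le_rfl h2) ⟨rfl, h1'⟩)
    (τ.row_strict _ b' ⟨rfl, h2'⟩)

lemma pow_le_of_le (τ : PSYT lam) {b b' : Box lam} (h1 : b.1.1 ≤ b'.1.1) (h2 : b.1.2 ≤ b'.1.2) :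
    τ.pow b' ≤ τ.pow b := by
  by_cases hne : b = b'
  · rw [hne]
  · rcases τ.label_lt_of_le h1 h2 hne with h | h
    · exact h.le
    · exact h.1.ge

lemma idx_lt_of_le (τ : PSYT lam) {b b' : Box lam} (h1 : b.1.1 ≤ b'.1.1) (h2 : b.1.2 ≤ b'.1.2)
    (hne : b ≠ b') (hp : τ.pow b = τ.pow b') : τ.idx b < τ.idx b' := by
  rcases τ.label_lt_of_le h1 h2 hne with h | h
  · exact absurd hp (ne_of_gt h)
  · exact h.2

/-- A box between two boxes with the same exponent has this exponent and an intermediate index. -/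
lemma between (τ : PSYT lam) {b d b' : Box lam} (h1 : b.1.1 ≤ d.1.1) (h2 : b.1.2 ≤ d.1.2)
    (h3 : d.1.1 ≤ b'.1.1) (h4 : d.1.2 ≤ b'.1.2) (hb : b ≠ d) (hb' : d ≠ b')
    (hp : τ.pow b = τ.pow b') : τ.idx b < τ.idx d ∧ τ.idx d < τ.idx b' := by
  have e1 := τ.pow_le_of_le h1 h2
  have e2 := τ.pow_le_of_le h3 h4
  exact ⟨τ.idx_lt_of_le h1 h2 hb (by omega), τ.idx_lt_of_le h3 h4 hb' (by omega)⟩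

/-- The two boxes lie on one diagonal and carry the same exponent. The right and the lower neighbour
of the upper box lie between them, so they have that exponent too and two distinct indices strictly
between. Consequently no denominator in the quadratic and braid relations vanishes. -/
lemma add_three_le (τ : PSYT lam) {i j : Fin lam.card} (h : τ.u i = τ.u j) (hij : i < j) :
    i.1 + 3 ≤ j.1 := by
  obtain ⟨b, rfl⟩ := τ.idx.surjective i
  obtain ⟨b', rfl⟩ := τ.idx.surjective j
  simp only [u, w, c, content, Equiv.symm_apply_apply, Prod.mk.injEq] at h
  obtain ⟨hp, hc⟩ := h
  have hne : b ≠ b' := by rintro rfl; exact lt_irrefl _ hij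
  -- Otherwise `b'` is weakly north-west of `b`, because the contents agree, and would carry the
  -- smaller index.
  have hr : b.1.1 < b'.1.1 := by
    by_contra hr
    exact lt_asymm hij (τ.idx_lt_of_le (b := b') (b' := b) (by omega) (by omega) hne.symm hp.symm)
  set d := boxOf b' b.1.1 (b.1.2 + 1) (by omega) (by omega) with hd
  set d' := boxOf b' (b.1.1 + 1) b.1.2 (by omega) (by omega) with hd'
  have n1 : b ≠ d := fun e => by
    have := congrArg (fun x : Box lam => x.1.2) e
    simp [hd, boxOf] at this
  have n2 : d ≠ b' := fun e => by
    have := congrArg (fun x : Box lam => x.1.1) e; simp [hd, boxOf] at this; omega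
  have n1' : b ≠ d' := fun e => by
    have := congrArg (fun x : Box lam => x.1.1) e; simp [hd', boxOf] at this
  have n2' : d' ≠ b' := fun e => by
    have := congrArg (fun x : Box lam => x.1.2) e; simp [hd', boxOf] at this; omega
  have n3 : τ.idx d ≠ τ.idx d' := fun e => by
    have := congrArg (fun x : Box lam => x.1.2) (τ.idx.injective e)
    simp [hd, hd', boxOf] at this
  have b1 := τ.between (b := b) (d := d) (b' := b') (by simp [hd, boxOf]) (by simp [hd, boxOf])
    (by simp [hd, boxOf]; omega) (by simp [hd, boxOf]; omega) n1 n2 hp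
  have b2 := τ.between (b := b) (d := d') (b' := b') (by simp [hd', boxOf]) (by simp [hd', boxOf])
    (by simp [hd', boxOf]; omega) (by simp [hd', boxOf]; omega) n1' n2' hp
  simp only [Fin.lt_def, ne_eq, Fin.ext_iff] at b1 b2 n3
  omega

lemma u_ne (τ : PSYT lam) {i j : Fin lam.card} (hij : i.1 < j.1) (hj : j.1 < i.1 + 3) :
    τ.u i ≠ τ.u j := fun h => by
  have := τ.add_three_le h hij
  omega

lemma u_lo_ne_u_hi (τ : PSYT lam) (i : Fin (lam.card - 1)) : τ.u (lo i) ≠ τ.u (hi i) :=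
  τ.u_ne (by simp [lo, hi]) (by simp [lo, hi])

/-- `i` and `i + 1` stand in the same row and have the same exponent. -/
def SameRow (τ : PSYT lam) (i : Fin (lam.card - 1)) : Prop :=
  τ.w (lo i) = τ.w (hi i) ∧ RowLT (τ.idx.symm (lo i)) (τ.idx.symm (hi i))

/-- `i` and `i + 1` stand in the same column and have the same exponent. -/
def SameCol (τ : PSYT lam) (i : Fin (lam.card - 1)) : Prop :=
  τ.w (lo i) = τ.w (hi i) ∧ ColLT (τ.idx.symm (lo i)) (τ.idx.symm (hi i))

/-- A box strictly between the two would have an index strictly between `i` and `i + 1`, so they are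
neighbours. -/
lemma SameRow.c_hi {τ : PSYT lam} {i : Fin (lam.card - 1)} (h : τ.SameRow i) :
    τ.c (hi i) = τ.c (lo i) + 1 := by
  obtain ⟨hp, h1, h2⟩ := h
  unfold w at hp
  unfold c content
  set b := τ.idx.symm (lo i) with hb
  set b' := τ.idx.symm (hi i) with hb'
  by_contra hne
  set d := boxOf b' b.1.1 (b.1.2 + 1) (by omega) (by omega) with hd
  have n1 : b ≠ d := fun e => by
    have := congrArg (fun x : Box lam => x.1.2) e
    simp [hd, boxOf] at this
  have n2 : d ≠ b' := fun e => by
    have := congrArg (fun x : Box lam => x.1.2) e; simp [hd, boxOf] at this; omega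
  have b1 := τ.between (b := b) (d := d) (b' := b') (by simp [hd, boxOf]) (by simp [hd, boxOf])
    (by simp [hd, boxOf]; omega) (by simp [hd, boxOf]; omega) n1 n2 hp
  simp only [hb, hb', Equiv.apply_symm_apply, Fin.lt_def, lo, hi] at b1
  omega

lemma SameCol.c_lo {τ : PSYT lam} {i : Fin (lam.card - 1)} (h : τ.SameCol i) :
    τ.c (lo i) = τ.c (hi i) + 1 := by
  obtain ⟨hp, h1, h2⟩ := h
  unfold w at hp
  unfold c content
  set b := τ.idx.symm (lo i) with hb
  set b' := τ.idx.symm (hi i) with hb'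
  by_contra hne
  set d := boxOf b' (b.1.1 + 1) b.1.2 (by omega) (by omega) with hd
  have n1 : b ≠ d := fun e => by
    have := congrArg (fun x : Box lam => x.1.1) e
    simp [hd, boxOf] at this
  have n2 : d ≠ b' := fun e => by
    have := congrArg (fun x : Box lam => x.1.1) e; simp [hd, boxOf] at this; omega
  have b1 := τ.between (b := b) (d := d) (b' := b') (by simp [hd, boxOf]) (by simp [hd, boxOf])
    (by simp [hd, boxOf]; omega) (by simp [hd, boxOf]; omega) n1 n2 hp
  simp only [hb, hb', Equiv.apply_symm_apply, Fin.lt_def, lo, hi] at b1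
  omega

/-- The exchange reverses a comparison of labels only for the pair `i, i + 1` itself, and only when
the exponents agree. That comparison is imposed only when the boxes share a row or a column. -/
lemma exists_swap {τ : PSYT lam} {i : Fin (lam.card - 1)} (h1 : ¬ τ.SameRow i)
    (h2 : ¬ τ.SameCol i) : ∃ τ', IsSwap i τ τ' := by
  have key : ∀ b b' : Box lam, LabelLT (τ.idx b, τ.pow b) (τ.idx b', τ.pow b') →
      ¬ (τ.pow b = τ.pow b' ∧ b = τ.idx.symm (lo i) ∧ b' = τ.idx.symm (hi i)) →
      LabelLT (Hecke.s i (τ.idx b), τ.pow b) (Hecke.s i (τ.idx b'), τ.pow b') := by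
    intro b b' h h'
    rcases h with h | ⟨h3, h4⟩
    · exact Or.inl h
    · refine Or.inr ⟨h3, ?_⟩
      rw [Equiv.eq_symm_apply, Equiv.eq_symm_apply] at h'
      simp only [Fin.lt_def, Hecke.val_s, Fin.ext_iff, lo, hi] at h' h3 h4 ⊢
      split_ifs <;> omega
  refine ⟨⟨τ.idx.trans (Hecke.s i), τ.pow, fun b b' h => key b b' (τ.row_strict b b' h) ?_,
    fun b b' h => key b b' (τ.col_strict b b' h) ?_⟩, rfl, fun b => rfl⟩
  · rintro ⟨e, rfl, rfl⟩
    exact h1 ⟨e, h⟩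
  · rintro ⟨e, rfl, rfl⟩
    exact h2 ⟨e, h⟩

lemma exists_swap_of_up {τ : PSYT lam} {i : Fin (lam.card - 1)}
    (h : Up (τ.u (lo i)) (τ.u (hi i))) : ∃ τ', SwapUp i τ τ' := by
  obtain ⟨τ', hτ'⟩ := exists_swap (τ := τ) (i := i)
    (fun h' => by
      have e1 := h'.c_hi
      have e2 := h'.1
      simp only [Up, u] at h
      omega)
    (fun h' => by
      have e1 := h'.c_lo
      have e2 := h'.1
      simp only [Up, u] at h
      omega)
  exact ⟨τ', hτ', h⟩

end PSYT

lemma IsSwap.unique {i : Fin (lam.card - 1)} {τ τ' τ'' : PSYT lam} (h1 : IsSwap i τ τ')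
    (h2 : IsSwap i τ τ'') : τ' = τ'' := by
  ext1
  · ext1 b
    rw [h1.2, h2.2]
  · rw [h1.1, h2.1]

lemma IsSwap.symm {i : Fin (lam.card - 1)} {τ τ' : PSYT lam} (h : IsSwap i τ τ') :
    IsSwap i τ' τ :=
  ⟨h.1.symm, fun b => by rw [h.2, Equiv.swap_apply_self]⟩

lemma IsSwap.idx_symm {i : Fin (lam.card - 1)} {τ τ' : PSYT lam} (h : IsSwap i τ τ')
    (k : Fin lam.card) : τ'.idx.symm k = τ.idx.symm (Hecke.s i k) := by
  rw [Equiv.symm_apply_eq, h.2, Equiv.apply_symm_apply]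
  exact (Equiv.swap_apply_self _ _ _).symm

lemma IsSwap.u {i : Fin (lam.card - 1)} {τ τ' : PSYT lam} (h : IsSwap i τ τ')
    (k : Fin lam.card) : τ'.u k = τ.u (Hecke.s i k) := by
  simp only [PSYT.u, PSYT.w, PSYT.c, h.idx_symm, h.1]

lemma SwapUp.up {i : Fin (lam.card - 1)} {τ τ' : PSYT lam} (h : SwapUp i τ τ') :
    Up (τ.u (lo i)) (τ.u (hi i)) := h.2

lemma swapUp_iff {i : Fin (lam.card - 1)} {τ τ' : PSYT lam} :
    SwapUp i τ τ' ↔ IsSwap i τ τ' ∧ Up (τ.u (lo i)) (τ.u (hi i)) := Iff.rfl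

/-- For a swappable pair one of the two directions goes up. -/
lemma IsSwap.up_or_up {i : Fin (lam.card - 1)} {τ τ' : PSYT lam} (h : IsSwap i τ τ') :
    SwapUp i τ τ' ∨ SwapUp i τ' τ := by
  have hne := τ.u_lo_ne_u_hi i
  have e1 : τ'.u (lo i) = τ.u (hi i) := by rw [h.u, Hecke.s_lo]
  have e2 : τ'.u (hi i) = τ.u (lo i) := by rw [h.u, Hecke.s_hi]
  rw [swapUp_iff, swapUp_iff, e1, e2]
  by_cases hp : τ.w (lo i) = τ.w (hi i)
  · have hc : τ.c (lo i) ≠ τ.c (hi i) := fun hc => hne (Prod.ext hp hc)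
    -- Boxes whose contents differ by one are comparable in the north-west order. With equal
    -- exponents this order fixes which box has the smaller index, so it fails in `τ` or in `τ'`.
    have hincomp : ¬ ((τ.c (lo i) - τ.c (hi i)) = 1 ∨ (τ.c (lo i) - τ.c (hi i)) = -1) := by
      intro hd
      set b := τ.idx.symm (lo i) with hb
      set b' := τ.idx.symm (hi i) with hb'
      have hne' : b ≠ b' := fun e => by
        have := τ.idx.symm.injective e
        exact (Hecke.lo_lt_hi i).ne this
      have k1 : τ'.pow b = τ'.pow b' := by rw [h.1]; exact hp
      have k2 : τ'.idx b = hi i := by rw [h.2, hb, Equiv.apply_symm_apply, Equiv.swap_apply_left]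
      have k3 : τ'.idx b' = lo i := by rw [h.2, hb', Equiv.apply_symm_apply, Equiv.swap_apply_right]
      have k4 : τ.idx b = lo i := by rw [hb, Equiv.apply_symm_apply]
      have k5 : τ.idx b' = hi i := by rw [hb', Equiv.apply_symm_apply]
      have hlt := Hecke.lo_lt_hi i
      simp only [PSYT.c, content, ← hb, ← hb'] at hd
      rcases le_total b.1.1 b'.1.1 with hr | hr
      · rcases le_total b.1.2 b'.1.2 with hcl | hcl
        · have := τ'.idx_lt_of_le hr hcl hne' k1
          rw [k2, k3] at this
          exact lt_asymm hlt this
        · rcases hr.eq_or_lt with hr' | hr'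
          · have := τ.idx_lt_of_le (b := b') (b' := b) hr'.ge hcl hne'.symm hp.symm
            rw [k4, k5] at this
            exact lt_asymm hlt this
          · have hcc : b'.1.2 = b.1.2 := by omega
            have := τ'.idx_lt_of_le hr hcc.ge hne' k1
            rw [k2, k3] at this
            exact lt_asymm hlt this
      · rcases le_total b'.1.2 b.1.2 with hcl | hcl
        · have := τ.idx_lt_of_le hr hcl hne'.symm hp.symm
          rw [k4, k5] at this
          exact lt_asymm hlt this
        · rcases hr.eq_or_lt with hr' | hr'
          · have := τ'.idx_lt_of_le (b := b) (b' := b') hr'.ge hcl hne' k1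
            rw [k2, k3] at this
            exact lt_asymm hlt this
          · have hcc : b'.1.2 = b.1.2 := by omega
            have := τ.idx_lt_of_le hr hcc.le hne'.symm hp.symm
            rw [k4, k5] at this
            exact lt_asymm hlt this
    rcases lt_or_gt_of_ne hc with h3 | h3
    · exact Or.inr ⟨h.symm, Or.inr ⟨hp.symm, by simp only [PSYT.u]; omega⟩⟩
    · exact Or.inl ⟨h, Or.inr ⟨hp, by simp only [PSYT.u]; omega⟩⟩
  · rcases lt_or_gt_of_ne hp with h3 | h3
    · exact Or.inl ⟨h, Or.inl h3⟩
    · exact Or.inr ⟨h.symm, Or.inl h3⟩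

lemma not_up_symm {x y : ℕ × ℤ} (h : Up x y) : ¬ Up y x := by
  unfold Up at *
  omega

end

end VVMac

namespace VVMac

noncomputable section

variable {lam : YoungDiagram}

/-! ### Generation from the standard tableaux and destandardization. -/

/-- A periodic standard tableau without powers of `q` is a standard tableau. -/
def PSYT.toSYT (τ : PSYT lam) (h : ∀ b, τ.pow b = 0) : SYT lam where
  idx := τ.idx
  row_strict b b' hb := by
    rcases τ.row_strict b b' hb with h' | h'
    · simp [h] at h'
    · exact h'.2
  col_strict b b' hb := by
    rcases τ.col_strict b b' hb with h' | h'
    · simp [h] at h'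
    · exact h'.2

lemma PSYT.toSYT_toPSYT (τ : PSYT lam) (h : ∀ b, τ.pow b = 0) : (τ.toSYT h).toPSYT = τ := by
  ext1
  · rfl
  · funext b; exact (h b).symm

/-- The sum of the exponents. -/
def PSYT.deg (τ : PSYT lam) : ℕ := ∑ b, τ.pow b

lemma PSYT.deg_eq (τ : PSYT lam) : τ.deg = ∑ i, τ.w i :=
  (τ.idx.symm.sum_comp τ.pow).symm

lemma PSYT.deg_Psi (hn : 0 < lam.card) (τ : PSYT lam) : τ.Psi.deg = τ.deg + 1 := by
  have h : ∀ b, τ.Psi.pow b = τ.pow b + if b = τ.idx.symm ⟨0, hn⟩ then 1 else 0 := by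
    intro b
    simp only [PSYT.Psi, Equiv.eq_symm_apply, Fin.ext_iff]
    split_ifs <;> rfl
  simp only [PSYT.deg, h, Finset.sum_add_distrib, Finset.sum_ite_eq', Finset.mem_univ, if_true]

lemma val_finRotate {n : ℕ} (k : Fin n) :
    ((finRotate n k : Fin n) : ℕ) = if k.1 + 1 = n then 0 else k.1 + 1 := by
  cases n with
  | zero => exact k.elim0
  | succ n =>
    rw [coe_finRotate]
    have := k.2
    simp only [Fin.ext_iff, Fin.val_last]
    split_ifs <;> omega

lemma labelLT_rotate_symm {n : ℕ} {x y : Fin n × ℕ} (hx : x.1.1 + 1 = n → 0 < x.2)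
    (hy : y.1.1 + 1 = n → 0 < y.2) (h : LabelLT x y) :
    LabelLT (finRotate n x.1, if x.1.1 + 1 = n then x.2 - 1 else x.2)
      (finRotate n y.1, if y.1.1 + 1 = n then y.2 - 1 else y.2) := by
  obtain ⟨j, a⟩ := x
  obtain ⟨k, b⟩ := y
  simp only [LabelLT, Fin.lt_def, val_finRotate] at h hx hy ⊢
  have := j.2
  have := k.2
  split_ifs <;> omega

/-- Every periodic standard tableau with a positive exponent at `n` is of the form `Ψ(τ)`. -/
lemma PSYT.exists_Psi_eq {τ : PSYT lam} (h : ∀ b, (τ.idx b).1 + 1 = lam.card → 0 < τ.pow b) :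
    ∃ τ' : PSYT lam, τ'.Psi = τ := by
  refine ⟨⟨τ.idx.trans (finRotate _),
    fun b => if (τ.idx b).1 + 1 = lam.card then τ.pow b - 1 else τ.pow b,
    fun b b' hb => labelLT_rotate_symm (h b) (h b') (τ.row_strict b b' hb),
    fun b b' hb => labelLT_rotate_symm (h b) (h b') (τ.col_strict b b' hb)⟩, ?_⟩
  ext1
  · ext1 b
    exact Equiv.symm_apply_apply _ _
  · funext b
    have := h b
    by_cases hb : (τ.idx b).1 + 1 = lam.card
    · simp only [PSYT.Psi, Equiv.trans_apply, val_finRotate, hb, if_true]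
      omega
    · simp only [PSYT.Psi, Equiv.trans_apply, val_finRotate, hb, if_false, Nat.succ_ne_zero]

/-- All periodic standard tableaux are reached from the standard ones by going up. -/
lemma PSYT.up_induction {P : PSYT lam → Prop} (syt : ∀ τ : SYT lam, P τ.toPSYT)
    (swap : ∀ i τ τ', SwapUp i τ τ' → P τ → P τ')
    (psi : 0 < lam.card → ∀ τ : PSYT lam, P τ → P τ.Psi) (τ : PSYT lam) : P τ := by
  induction hd : τ.deg using Nat.strong_induction_on generalizing τ with
  | _ d ihd =>
  -- For fixed degree this sum decreases when a larger exponent is moved from `i` to `i + 1`, which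
  -- is what undoing an upward swap does.
  induction he : (∑ i, τ.w i * (lam.card - i.1)) using Nat.strong_induction_on
    generalizing τ with
  | _ e ihe =>
  by_cases h1 : ∃ i : Fin (lam.card - 1), τ.w (hi i) < τ.w (lo i)
  · obtain ⟨i, hi'⟩ := h1
    obtain ⟨τ', hτ'⟩ := PSYT.exists_swap (τ := τ) (i := i) (fun h => hi'.ne' h.1)
      fun h => hi'.ne' h.1
    have hu : SwapUp i τ' τ := by
      refine ⟨hτ'.symm, Or.inl ?_⟩
      have e1 := congrArg Prod.fst (hτ'.u (lo i))
      have e2 := congrArg Prod.fst (hτ'.u (hi i))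
      rw [Hecke.s_lo] at e1
      rw [Hecke.s_hi] at e2
      simp only [PSYT.u] at e1 e2
      omega
    refine swap i τ' τ hu (ihe _ ?_ τ' ?_ rfl)
    · rw [← he, ← Equiv.sum_comp (Hecke.s i) (fun k => τ'.w k * (lam.card - k.1))]
      have hw : ∀ k, τ'.w (Hecke.s i k) = τ.w k := fun k => by
        have := congrArg Prod.fst (hτ'.symm.u k)
        exact this.symm
      simp only [hw]
      rw [← Finset.add_sum_erase _ _ (Finset.mem_univ (lo i)),
        ← Finset.add_sum_erase _ _ (Finset.mem_univ (lo i)),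
        ← Finset.add_sum_erase _ _ (Finset.mem_erase.mpr
          ⟨(Hecke.lo_lt_hi i).ne', Finset.mem_univ (hi i)⟩),
        ← Finset.add_sum_erase _ _ (Finset.mem_erase.mpr
          ⟨(Hecke.lo_lt_hi i).ne', Finset.mem_univ (hi i)⟩)]
      have hrest : ∀ k ∈ (Finset.univ.erase (lo i)).erase (hi i),
          τ.w k * (lam.card - (Hecke.s i k).1) = τ.w k * (lam.card - k.1) := by
        intro k hk
        rw [Finset.mem_erase, Finset.mem_erase] at hk
        rw [Hecke.s_of_ne hk.2.1 hk.1]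
      rw [Finset.sum_congr rfl hrest, Hecke.s_lo, Hecke.s_hi, ← add_assoc, ← add_assoc]
      apply Nat.add_lt_add_right
      obtain ⟨N, hN⟩ : ∃ N, lam.card - (lo i).1 = N + 1 ∧ lam.card - (hi i).1 = N :=
        ⟨lam.card - (hi i).1, by have := i.2; simp only [lo, hi]; omega, rfl⟩
      rw [hN.1, hN.2]
      nlinarith
    · rw [← hd, PSYT.deg, PSYT.deg, hτ'.1]
  -- The exponents now increase weakly with the index. If the last one is positive then `Ψ` can be
  -- undone, which lowers the degree; if it is zero then all vanish and the tableau is standard.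
  by_cases h2 : ∃ b, (τ.idx b).1 + 1 = lam.card ∧ 0 < τ.pow b
  · obtain ⟨b, hb1, hb2⟩ := h2
    obtain ⟨τ', rfl⟩ := PSYT.exists_Psi_eq (τ := τ) fun b' hb' => by
      rwa [τ.idx.injective (Fin.ext (by omega) : τ.idx b' = τ.idx b)]
    have hn : 0 < lam.card := by omega
    exact psi hn τ' (ihd _ (by rw [← hd, PSYT.deg_Psi hn]; omega) τ' rfl)
  · push Not at h1 h2
    have h3 : ∀ k : ℕ, ∀ hk : k < lam.card, τ.w ⟨lam.card - 1 - k, by omega⟩ = 0 := by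
      intro k
      induction k with
      | zero =>
        intro hk
        have := h2 (τ.idx.symm ⟨lam.card - 1 - 0, by omega⟩) (by
          rw [Equiv.apply_symm_apply]; simp only; omega)
        unfold PSYT.w
        omega
      | succ k ih =>
        intro hk
        have e := h1 ⟨lam.card - 1 - (k + 1), by omega⟩
        have e2 : hi (⟨lam.card - 1 - (k + 1), by omega⟩ : Fin (lam.card - 1)) =
            ⟨lam.card - 1 - k, by omega⟩ := Fin.ext (by simp only [hi]; omega)
        rw [e2, ih (by omega)] at e
        exact Nat.le_zero.mp e
    have h4 : ∀ b, τ.pow b = 0 := by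
      intro b
      have := h3 (lam.card - 1 - (τ.idx b).1) (by have := (τ.idx b).2; omega)
      have e : (⟨lam.card - 1 - (lam.card - 1 - (τ.idx b).1), by
          have := (τ.idx b).2; omega⟩ : Fin lam.card) = τ.idx b :=
        Fin.ext (by have := (τ.idx b).2; simp only; omega)
      rw [e, PSYT.w, Equiv.symm_apply_apply] at this
      exact this
    rw [← τ.toSYT_toPSYT h4]
    exact syt _

/-- The sort by decreasing exponent is stable: ties are broken by the index, exactly as in the order
on labels. -/
lemma labelLT_sort {n : ℕ} (w : Fin n → ℕ) {i j : Fin n} (h : i < j) :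
    LabelLT (Tuple.sort (fun k => OrderDual.toDual (w k)) i,
        w (Tuple.sort (fun k => OrderDual.toDual (w k)) i))
      (Tuple.sort (fun k => OrderDual.toDual (w k)) j,
        w (Tuple.sort (fun k => OrderDual.toDual (w k)) j)) := by
  obtain ⟨h1, h2⟩ := Tuple.eq_sort_iff.mp
    (rfl : Tuple.sort (fun k => OrderDual.toDual (w k)) = _)
  have h3 := h1 h.le
  simp only [Function.comp_apply, OrderDual.toDual_le_toDual] at h3
  rcases h3.lt_or_eq with h4 | h4
  · exact Or.inl h4
  · exact Or.inr ⟨h4.symm, h2 i j h (congrArg OrderDual.toDual h4.symm)⟩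

/-- The periodic standard tableau with exponent `w i` at `i` that has the same shape of labels as
a standard tableau. -/
def destandardize (x : SYT lam × (Fin lam.card → ℕ)) : PSYT lam where
  idx := x.1.idx.trans (Tuple.sort fun k => OrderDual.toDual (x.2 k))
  pow b := x.2 (Tuple.sort (fun k => OrderDual.toDual (x.2 k)) (x.1.idx b))
  row_strict b b' h := labelLT_sort x.2 (x.1.row_strict b b' h)
  col_strict b b' h := labelLT_sort x.2 (x.1.col_strict b b' h)

lemma w_destandardize (x : SYT lam × (Fin lam.card → ℕ)) : (destandardize x).w = x.2 := by
  funext i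
  simp [PSYT.w, destandardize]

/-- The exponents determine the sorting permutation, which then recovers the standard tableau. This
injection provides the dimension bound that makes the map from the induced module to the model
injective. -/
lemma destandardize_injective : Function.Injective (destandardize (lam := lam)) := by
  rintro ⟨S, w⟩ ⟨S', w'⟩ h
  obtain rfl : w = w' := by
    have hw := congrArg PSYT.w h
    rwa [w_destandardize, w_destandardize] at hw
  congr 1
  ext1
  have h1 := congrArg PSYT.idx h
  ext1 b
  exact (Tuple.sort fun k => OrderDual.toDual (w k)).injective
    (congrArg (fun e : Box lam ≃ Fin lam.card => e b) h1)

lemma deg_destandardize (x : SYT lam × (Fin lam.card → ℕ)) :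
    (destandardize x).deg = ∑ i, x.2 i := by
  rw [PSYT.deg_eq, w_destandardize]

/-! ### The top tableau -/

/-- Position of a box in the order by decreasing exponent, then column, then row. -/
def TopLT (pow : Box lam → ℕ) (b b' : Box lam) : Prop :=
  pow b' < pow b ∨ (pow b = pow b' ∧ (b.1.2 < b'.1.2 ∨ (b.1.2 = b'.1.2 ∧ b.1.1 < b'.1.1)))

instance (pow : Box lam → ℕ) (b b' : Box lam) : Decidable (TopLT pow b b') := by
  unfold TopLT; infer_instance

lemma TopLT.trans {pow : Box lam → ℕ} {a b c : Box lam} (h1 : TopLT pow a b)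
    (h2 : TopLT pow b c) : TopLT pow a c := by
  unfold TopLT at *
  omega

lemma topLT_irrefl {pow : Box lam → ℕ} (a : Box lam) : ¬ TopLT pow a a := by
  unfold TopLT
  omega

lemma topLT_total {pow : Box lam → ℕ} {a b : Box lam} (h : a ≠ b) :
    TopLT pow a b ∨ TopLT pow b a := by
  have : a.1.1 ≠ b.1.1 ∨ a.1.2 ≠ b.1.2 := by
    by_contra! h'
    exact h (box_ext h'.1 h'.2)
  unfold TopLT
  omega

lemma card_box : Fintype.card (Box lam) = lam.card := by
  rw [Fintype.card_coe]

lemma card_topLT_lt (pow : Box lam → ℕ) (b : Box lam) :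
    (Finset.univ.filter fun b' => TopLT pow b' b).card < lam.card := by
  rw [← card_box, Fintype.card]
  exact Finset.card_lt_card ⟨Finset.filter_subset _ _, fun h =>
    topLT_irrefl b (Finset.mem_filter.mp (h (Finset.mem_univ b))).2⟩

/-- The rank of a box. -/
def topRank (pow : Box lam → ℕ) (b : Box lam) : Fin lam.card :=
  ⟨(Finset.univ.filter fun b' => TopLT pow b' b).card, card_topLT_lt pow b⟩

lemma topRank_lt {pow : Box lam → ℕ} {b b' : Box lam} (h : TopLT pow b b') :
    topRank pow b < topRank pow b' := by
  refine Finset.card_lt_card ⟨fun x hx => ?_, fun hs => ?_⟩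
  · rw [Finset.mem_filter] at hx ⊢
    exact ⟨hx.1, hx.2.trans h⟩
  · exact topLT_irrefl b (Finset.mem_filter.mp (hs (Finset.mem_filter.mpr
      ⟨Finset.mem_univ b, h⟩))).2

lemma topRank_bijective (pow : Box lam → ℕ) : Function.Bijective (topRank pow) := by
  rw [Fintype.bijective_iff_injective_and_card, card_box, Fintype.card_fin]
  refine ⟨fun b b' h => ?_, rfl⟩
  by_contra hne
  rcases topLT_total hne with h' | h'
  · exact (topRank_lt h').ne h
  · exact (topRank_lt h').ne' h

/-- The labelling of the boxes by decreasing exponent, then column, then row. -/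
def RYT.top (T : RYT lam) : PSYT lam where
  idx := Equiv.ofBijective _ (topRank_bijective T.val)
  pow := T.val
  row_strict b b' h := by
    rcases (T.row_weak b b' h).lt_or_eq with h' | h'
    · exact Or.inl h'
    · exact Or.inr ⟨h'.symm, topRank_lt (Or.inr ⟨h'.symm, Or.inl h.2⟩)⟩
  col_strict b b' h := by
    rcases (T.col_weak b b' h).lt_or_eq with h' | h'
    · exact Or.inl h'
    · exact Or.inr ⟨h'.symm, topRank_lt (Or.inr ⟨h'.symm, Or.inr h⟩)⟩

lemma RYT.top_idx_lt {T : RYT lam} {b b' : Box lam} (h : TopLT T.val b b') :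
    T.top.idx b < T.top.idx b' := topRank_lt h

lemma RYT.top_idx_lt_iff {T : RYT lam} {b b' : Box lam} :
    T.top.idx b < T.top.idx b' ↔ TopLT T.val b b' := by
  refine ⟨fun h => ?_, RYT.top_idx_lt⟩
  have hne : b ≠ b' := by rintro rfl; exact lt_irrefl _ h
  rcases topLT_total (pow := T.val) hne with h' | h'
  · exact h'
  · exact absurd (RYT.top_idx_lt h') h.asymm

/-- The exponents of a periodic standard tableau. -/
def PSYT.toRYT (τ : PSYT lam) : RYT lam where
  val := τ.pow
  row_weak b b' h := by
    rcases τ.row_strict b b' h with h' | h'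
    · exact h'.le
    · exact h'.1.ge
  col_weak b b' h := by
    rcases τ.col_strict b b' h with h' | h'
    · exact h'.le
    · exact h'.1.ge

lemma IsSwap.toRYT_eq {i : Fin (lam.card - 1)} {τ τ' : PSYT lam} (h : IsSwap i τ τ') :
    τ'.toRYT = τ.toRYT := by
  simp only [PSYT.toRYT, h.1]

/-- Pairs of boxes in the wrong order. -/
def PSYT.disorder (τ : PSYT lam) : Finset (Box lam × Box lam) :=
  Finset.univ.filter fun p => TopLT τ.pow p.1 p.2 ∧ τ.idx p.2 < τ.idx p.1

lemma PSYT.mem_disorder {τ : PSYT lam} {p : Box lam × Box lam} :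
    p ∈ τ.disorder ↔ TopLT τ.pow p.1 p.2 ∧ τ.idx p.2 < τ.idx p.1 := by
  simp [PSYT.disorder]

/-- When consecutive indices are in order, passing from the indices of `τ` to those of the top
tableau is an increasing permutation, hence the identity. -/
lemma PSYT.topLT_of_sorted {τ : PSYT lam}
    (h : ∀ i : Fin (lam.card - 1), TopLT τ.pow (τ.idx.symm (lo i)) (τ.idx.symm (hi i))) :
    τ = τ.toRYT.top := by
  have hm : ∀ i j : Fin lam.card, i < j → TopLT τ.pow (τ.idx.symm i) (τ.idx.symm j) := by
    intro i j hij
    obtain ⟨i, hi'⟩ := i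
    obtain ⟨j, hj'⟩ := j
    rw [Fin.lt_def] at hij
    simp only at hij
    induction j, hij using Nat.le_induction with
    | base => exact h ⟨i, by omega⟩
    | succ j hj ih => exact (ih (by omega)).trans (h ⟨j, by omega⟩)
  have hm2 : StrictMono fun i => τ.toRYT.top.idx (τ.idx.symm i) := fun i j hij =>
    RYT.top_idx_lt (hm i j hij)
  have h3 : τ.idx.symm.trans τ.toRYT.top.idx = Equiv.refl _ :=
    (Equiv.Perm.monotone_iff _).mp hm2.monotone
  ext1
  · ext1 b
    have := congrArg (fun e : Fin lam.card ≃ Fin lam.card => e (τ.idx b)) h3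
    simpa using this.symm
  · rfl

/-- A swap of two adjacent labels in the wrong order goes up. -/
lemma PSYT.exists_swapUp {τ : PSYT lam} {i : Fin (lam.card - 1)}
    (h : TopLT τ.pow (τ.idx.symm (hi i)) (τ.idx.symm (lo i))) : ∃ τ', SwapUp i τ τ' := by
  apply PSYT.exists_swap_of_up
  set b := τ.idx.symm (lo i) with hb
  set b' := τ.idx.symm (hi i) with hb'
  rcases h with h | ⟨hp, h⟩
  · exact Or.inl h
  refine Or.inr ⟨hp.symm, ?_⟩
  simp only [PSYT.u, PSYT.c, ← hb, ← hb', content]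
  have hlt : τ.idx b < τ.idx b' := by
    rw [hb, hb', Equiv.apply_symm_apply, Equiv.apply_symm_apply]
    exact Hecke.lo_lt_hi i
  have hne : b' ≠ b := by rintro e; rw [e] at hlt; exact lt_irrefl _ hlt
  -- If `b` were not above `b'`, then `b'` would be weakly north-west of `b` with the same exponent
  -- and would have the smaller index. Once `b` is strictly above and `b'` strictly to the left, the
  -- contents differ by at least two.
  have hr : b.1.1 < b'.1.1 := by
    by_contra hr
    have hcle : b'.1.2 ≤ b.1.2 := by omega
    exact lt_asymm hlt (τ.idx_lt_of_le (by omega) hcle hne hp)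
  omega

/-- Only the relative order of the boxes of `i` and `i + 1` changes, so exactly one pair leaves the
set. This serves both as the measure for `PSYT.top_induction` and as the recursion for the
coefficients of `P_T`. -/
lemma SwapUp.disorder {i : Fin (lam.card - 1)} {τ τ' : PSYT lam} (hs : SwapUp i τ τ')
    (h : TopLT τ.pow (τ.idx.symm (hi i)) (τ.idx.symm (lo i))) :
    τ.disorder = insert (τ.idx.symm (hi i), τ.idx.symm (lo i)) τ'.disorder ∧
      (τ.idx.symm (hi i), τ.idx.symm (lo i)) ∉ τ'.disorder := by
  have hidx : ∀ b, (τ'.idx b).1 = (Hecke.s i (τ.idx b)).1 := fun b => by rw [hs.1.2]; rfl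
  have h0 : ¬ TopLT τ.pow (τ.idx.symm (lo i)) (τ.idx.symm (hi i)) := fun h' =>
    topLT_irrefl _ (h.trans h')
  constructor
  · ext ⟨b, b'⟩
    rw [Finset.mem_insert, PSYT.mem_disorder, PSYT.mem_disorder, hs.1.1]
    simp only [Prod.mk.injEq, Fin.lt_def, hidx, Hecke.val_s]
    have e1 : ∀ b, b = τ.idx.symm (hi i) ↔ (τ.idx b).1 = i.1 + 1 := fun b => by
      rw [Equiv.eq_symm_apply, Fin.ext_iff]; rfl
    have e2 : ∀ b, b = τ.idx.symm (lo i) ↔ (τ.idx b).1 = i.1 := fun b => by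
      rw [Equiv.eq_symm_apply, Fin.ext_iff]; rfl
    have k1 : (τ.idx b).1 = i.1 + 1 → (τ.idx b').1 = i.1 → TopLT τ.pow b b' := by
      rw [← e1, ← e2]; rintro rfl rfl; exact h
    have k2 : (τ.idx b).1 = i.1 → (τ.idx b').1 = i.1 + 1 → ¬ TopLT τ.pow b b' := by
      rw [← e1, ← e2]; rintro rfl rfl; exact h0
    rw [e1, e2]
    have k3 : (τ.idx b).1 = (τ.idx b').1 → b = b' := fun e => τ.idx.injective (Fin.ext e)
    have k4 : b = b' → ¬ TopLT τ.pow b b' := by rintro rfl; exact topLT_irrefl _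
    by_cases hT : TopLT τ.pow b b'
    · simp only [hT, true_and, not_true, imp_false] at k1 k2 k3 k4 ⊢
      have k5 : (τ.idx b).1 ≠ (τ.idx b').1 := fun e => k4 (k3 e)
      split_ifs <;> omega
    · simp only [hT, false_and, imp_false, false_iff, or_false] at k1 ⊢
      omega
  · rw [PSYT.mem_disorder, hs.1.1]
    simp only [Fin.lt_def, hidx, Hecke.val_s, Equiv.apply_symm_apply, lo, hi]
    intro hh
    have := hh.2
    split_ifs at this <;> omega

/-- Induction downwards from the top tableaux. -/
lemma PSYT.top_induction {P : PSYT lam → Prop} (top : ∀ T : RYT lam, P T.top)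
    (swap : ∀ i τ τ', SwapUp i τ τ' →
      TopLT τ.pow (τ.idx.symm (hi i)) (τ.idx.symm (lo i)) → P τ' → P τ) (τ : PSYT lam) : P τ := by
  induction h : τ.disorder.card using Nat.strong_induction_on generalizing τ with
  | _ d ih =>
  by_cases hs : ∃ i : Fin (lam.card - 1), TopLT τ.pow (τ.idx.symm (hi i)) (τ.idx.symm (lo i))
  · obtain ⟨i, hi'⟩ := hs
    obtain ⟨τ', hτ'⟩ := PSYT.exists_swapUp hi'
    obtain ⟨h1, h2⟩ := hτ'.disorder hi'
    refine swap i τ τ' hτ' hi' (ih _ ?_ τ' rfl)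
    rw [← h, h1, Finset.card_insert_of_notMem h2]
    omega
  · push Not at hs
    rw [PSYT.topLT_of_sorted (τ := τ) fun i =>
      (topLT_total (pow := τ.pow) fun e =>
        (Hecke.lo_lt_hi i).ne (τ.idx.symm.injective e)).resolve_right
        (hs i)]
    exact top _

lemma PSYT.le_top (τ : PSYT lam) : τ.Le τ.toRYT.top := by
  induction τ using PSYT.top_induction with
  | top T => exact Relation.ReflTransGen.refl
  | swap i τ τ' h _ ih =>
    rw [← h.1.toRYT_eq]
    exact Relation.ReflTransGen.head (Cover.swap i τ τ' h) ih

lemma RYT.isTop_top (T : RYT lam) : IsTop T T.top := by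
  refine ⟨rfl, fun τ' h => ?_⟩
  have : τ'.toRYT = T := by
    cases T
    simp only [PSYT.toRYT, RYT.mk.injEq]
    exact h
  rw [← this]
  exact τ'.le_top

end

end VVMac

namespace VVMac

noncomputable section

/-! ### The coefficients of the seminormal form -/

/-- The diagonal coefficient of `T_i`. -/
def diag (x y : ℕ × ℤ) : K := (1 - t) * val x / (val x - val y)

/-- The product of the two off-diagonal coefficients of `T_i`. -/
def offProd (x y : ℕ × ℤ) : K :=
  (t * val x - val y) * (val x - t * val y) / (val x - val y) ^ 2

/-- The off-diagonal coefficient of `T_i`. -/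
def off (x y : ℕ × ℤ) : K := if Up x y then 1 else offProd x y

lemma diag_add_diag {x y : ℕ × ℤ} (h : x ≠ y) : diag x y + diag y x = 1 - t := by
  have h1 := val_sub_ne_zero h
  have h2 := val_sub_ne_zero h.symm
  unfold diag
  rw [div_add_div _ _ h1 h2, div_eq_iff (mul_ne_zero h1 h2)]
  ring

lemma offProd_comm (x y : ℕ × ℤ) : offProd x y = offProd y x := by
  unfold offProd
  congr 1 <;> ring

lemma offProd_eq_zero_of_left {x y : ℕ × ℤ} (h1 : x.1 = y.1) (h2 : y.2 = x.2 + 1) :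
    offProd x y = 0 := by
  have : t * val x = val y := by rw [t_mul_val, h1, ← h2]
  rw [offProd, this, sub_self, zero_mul, zero_div]

lemma offProd_eq_zero_of_right {x y : ℕ × ℤ} (h1 : x.1 = y.1) (h2 : x.2 = y.2 + 1) :
    offProd x y = 0 := by
  rw [offProd_comm, offProd_eq_zero_of_left h1.symm h2]

/-- If neither direction goes up, the exponents agree and the contents differ by one, and there
`offProd` vanishes. The relations only involve this product, so normalizing the upward coefficient
to `1` costs nothing. -/
lemma off_mul_off {x y : ℕ × ℤ} (h : x ≠ y) : off x y * off y x = offProd x y := by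
  unfold off
  by_cases h1 : Up x y
  · rw [if_pos h1, if_neg (not_up_symm h1), one_mul, offProd_comm]
  by_cases h2 : Up y x
  · rw [if_neg h1, if_pos h2, mul_one]
  rw [if_neg h1, if_neg h2]
  unfold Up at h1 h2
  have h3 : x.1 = y.1 := by omega
  have h4 : x.2 ≠ y.2 := fun e => h (Prod.ext h3 e)
  have h5 : offProd x y = 0 := by
    rcases lt_or_gt_of_ne h4 with h5 | h5
    · exact offProd_eq_zero_of_left h3 (by omega)
    · exact offProd_eq_zero_of_right h3 (by omega)
  rw [h5, zero_mul]

lemma diag_sq {x y : ℕ × ℤ} (h : x ≠ y) :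
    diag x y * diag x y + off x y * off y x = (1 - t) * diag x y + t := by
  have h1 := val_sub_ne_zero h
  rw [off_mul_off h]
  unfold diag offProd
  field_simp
  ring

/-- This identity and the next two compare, in the braid relation applied to a basis vector, the
coefficients of the vector itself and of its two adjacent swaps. The remaining coefficients agree
without any identity. -/
lemma diag_braid {x y z : ℕ × ℤ} (h1 : x ≠ y) (h2 : y ≠ z) (h3 : x ≠ z) :
    diag x y * diag y z * diag x y + off x y * diag x z * off y x =
      diag y z * diag x y * diag y z + off y z * diag x z * off z y := by
  have e : ∀ a b c : K, a * c * b = a * b * c := fun a b c => by ring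
  rw [e, e (off y z), e (off x y), off_mul_off h1, off_mul_off h2]
  have k1 := val_sub_ne_zero h1
  have k2 := val_sub_ne_zero h2
  have k3 := val_sub_ne_zero h3
  unfold diag offProd
  field_simp
  ring

lemma diag_mul_left {x y z : ℕ × ℤ} (h1 : x ≠ y) (h2 : y ≠ z) (h3 : x ≠ z) :
    diag x y * diag y z + diag x z * diag y x = diag y z * diag x z := by
  have k1 := val_sub_ne_zero h1
  have k1' := val_sub_ne_zero h1.symm
  have k2 := val_sub_ne_zero h2
  have k3 := val_sub_ne_zero h3
  unfold diag
  have e : val y - val x = -(val x - val y) := by ring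
  rw [e]
  field_simp
  ring

lemma diag_mul_right {x y z : ℕ × ℤ} (h1 : x ≠ y) (h2 : y ≠ z) (h3 : x ≠ z) :
    diag x y * diag x z = diag y z * diag x y + diag x z * diag z y := by
  have k1 := val_sub_ne_zero h1
  have k2 := val_sub_ne_zero h2
  have k3 := val_sub_ne_zero h3
  unfold diag
  have e : val z - val y = -(val y - val z) := by ring
  rw [e]
  field_simp
  ring

/-- The coefficients are homogeneous of degree zero in the two weights, so a common factor `q`
cancels. The relation between `ω²` and `T_i` rests on this. -/
lemma diag_shift (x y : ℕ × ℤ) : diag (x.1 + 1, x.2) (y.1 + 1, y.2) = diag x y := by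
  unfold diag
  rw [← q_mul_val, ← q_mul_val, ← mul_sub, ← mul_assoc, mul_comm (1 - t) q, mul_assoc,
    mul_div_mul_left _ _ q_ne_zero]

lemma off_shift (x y : ℕ × ℤ) : off (x.1 + 1, x.2) (y.1 + 1, y.2) = off x y := by
  have h : Up (x.1 + 1, x.2) (y.1 + 1, y.2) ↔ Up x y := by unfold Up; simp
  unfold off
  simp only [h]
  congr 1
  unfold offProd
  rw [← q_mul_val, ← q_mul_val]
  have e : (t * (q * val x) - q * val y) * (q * val x - t * (q * val y)) =
    q ^ 2 * ((t * val x - val y) * (val x - t * val y)) := by ring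
  rw [e, ← mul_sub, mul_pow, mul_div_mul_left _ _ (pow_ne_zero 2 q_ne_zero)]

/-! ### Linear identities behind the operator relations. -/

section Identities

variable {k M : Type*} [CommRing k] [AddCommGroup M] [Module k M]

lemma smul_quad {g g' h h' r : k} (e1 : g * g + h * h' = (1 - r) * g + r) (e2 : g + g' = 1 - r)
    (v w : M) :
    g • (g • v + h • w) + h • (g' • w + h' • v) = (1 - r) • (g • v + h • w) + r • v := by
  linear_combination (norm := module) e1 • v + (h * e2) • w

lemma smul_braid {gab gbc gac gba gcb hab hba hbc hcb hac : k}
    (e1 : gab * gbc * gab + hab * gac * hba = gbc * gab * gbc + hbc * gac * hcb)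
    (e2 : gab * gbc + gac * gba = gbc * gac) (e3 : gab * gac = gbc * gab + gac * gcb)
    (v w w' z z' y : M) :
    gab • (gbc • (gab • v + hab • w) + hbc • (gac • w' + hac • z)) +
        hab • (gac • (gba • w + hba • v) + hac • (gbc • z' + hbc • y)) =
      gbc • (gab • (gbc • v + hbc • w') + hab • (gac • w + hac • z')) +
        hbc • (gac • (gcb • w' + hcb • v) + hac • (gab • z + hab • y)) := by
  linear_combination (norm := module) e1 • v + (hab * e2) • w + (hbc * e3) • w'

lemma smul_comm_comm {g h g' h' : k} (v w w' z : M) :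
    g' • (g • v + h • w) + h' • (g • w' + h • z) =
      g • (g' • v + h' • w') + h • (g' • w + h' • z) := by
  module

lemma smul_theta {a b g h r : k} (e : b * g = a * g + (r - 1) * a) (v w : M) :
    b • (g • v + h • w) = g • a • v + h • b • w + (r - 1) • a • v := by
  linear_combination (norm := module) e • v

end Identities

/-! ### Operators in seminormal form -/

section Op

variable {Y : Type} {n : ℕ} (u : Y → Fin n → ℕ × ℤ) (sw : Fin (n - 1) → Y → Y) (rot : Y → Y)

/-- The operator `T_i` on a space with a basis of weight vectors. -/
def opT (i : Fin (n - 1)) : Module.End K (Y →₀ K) :=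
  Finsupp.linearCombination K fun y =>
    diag (u y (lo i)) (u y (hi i)) • Finsupp.single y 1 +
      off (u y (lo i)) (u y (hi i)) • Finsupp.single (sw i y) 1

/-- The operator `θ_i` on a space with a basis of weight vectors. -/
def opθ (i : Fin n) : Module.End K (Y →₀ K) :=
  Finsupp.linearCombination K fun y => val (u y i) • Finsupp.single y 1

/-- The operator `ω` on a space with a basis of weight vectors. -/
def opω (hn : 0 < n) : Module.End K (Y →₀ K) :=
  Finsupp.linearCombination K fun y => t ^ (u y ⟨0, hn⟩).2 • Finsupp.single (rot y) 1

lemma opT_single (i : Fin (n - 1)) (y : Y) : opT u sw i (Finsupp.single y 1) =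
    diag (u y (lo i)) (u y (hi i)) • Finsupp.single y 1 +
      off (u y (lo i)) (u y (hi i)) • Finsupp.single (sw i y) 1 := by
  rw [opT, Finsupp.linearCombination_single, one_smul]

lemma opθ_single (i : Fin n) (y : Y) :
    opθ u i (Finsupp.single y 1) = val (u y i) • Finsupp.single y 1 := by
  rw [opθ, Finsupp.linearCombination_single, one_smul]

lemma opω_single (hn : 0 < n) (y : Y) :
    opω u rot hn (Finsupp.single y 1) = t ^ (u y ⟨0, hn⟩).2 • Finsupp.single (rot y) 1 := by
  rw [opω, Finsupp.linearCombination_single, one_smul]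

variable {u sw rot}

/-- The swaps permute the weights and are involutions. -/
def IsSwapFamily (u : Y → Fin n → ℕ × ℤ) (sw : Fin (n - 1) → Y → Y) : Prop :=
  (∀ i y k, u (sw i y) k = u y (Hecke.s i k)) ∧ ∀ i y, sw i (sw i y) = y

lemma opT_quad (h : IsSwapFamily u sw) (i : Fin (n - 1)) (y : Y) (hy : u y (lo i) ≠ u y (hi i)) :
    opT u sw i (opT u sw i (Finsupp.single y 1)) =
      (1 - t) • opT u sw i (Finsupp.single y 1) + t • Finsupp.single y 1 := by
  simp only [opT_single, map_add, map_smul, h.1, h.2, Hecke.s_lo, Hecke.s_hi]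
  generalize u y (lo i) = a at *
  generalize u y (hi i) = b at *
  exact smul_quad (diag_sq hy) (diag_add_diag hy) _ _

lemma opT_braid (h : IsSwapFamily u sw) {i j : Fin (n - 1)} (hij : j.1 = i.1 + 1) (y : Y)
    (hs : sw i (sw j (sw i y)) = sw j (sw i (sw j y)))
    (h1 : u y (lo i) ≠ u y (hi i)) (h2 : u y (hi i) ≠ u y (hi j)) (h3 : u y (lo i) ≠ u y (hi j)) :
    opT u sw i (opT u sw j (opT u sw i (Finsupp.single y 1))) =
      opT u sw j (opT u sw i (opT u sw j (Finsupp.single y 1))) := by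
  have e1 : lo j = hi i := Fin.ext hij
  have e2 : Hecke.s i (hi j) = hi j := 
    Hecke.s_of_ne ((Hecke.lo_lt_hi i).trans (e1 ▸ Hecke.lo_lt_hi j)).ne'
      (e1 ▸ (Hecke.lo_lt_hi j).ne')
  have e3 : Hecke.s j (lo i) = lo i := Hecke.s_of_ne (e1 ▸ (Hecke.lo_lt_hi i).ne)
    ((Hecke.lo_lt_hi i).trans (e1 ▸ Hecke.lo_lt_hi j)).ne
  have e4 : Hecke.s j (hi i) = hi j := by rw [← e1, Hecke.s_lo]
  have e5 : Hecke.s j (hi j) = hi i := by rw [Hecke.s_hi, e1]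
  simp only [opT_single, map_add, map_smul, h.1, h.2, Hecke.s_lo, Hecke.s_hi, e1, e2, e3, e4, e5,
    hs]
  generalize u y (lo i) = a at *
  generalize u y (hi i) = b at *
  generalize u y (hi j) = c at *
  exact smul_braid (diag_braid h1 h2 h3) (diag_mul_left h1 h2 h3) (diag_mul_right h1 h2 h3)
    _ _ _ _ _ _

lemma opT_comm (h : IsSwapFamily u sw) {i j : Fin (n - 1)} (hij : i.1 + 1 < j.1) (y : Y)
    (hs : sw i (sw j y) = sw j (sw i y)) :
    opT u sw i (opT u sw j (Finsupp.single y 1)) =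
      opT u sw j (opT u sw i (Finsupp.single y 1)) := by
  have e1 : Hecke.s i (lo j) = lo j := by ext; simp only [Hecke.val_s, lo]; split_ifs <;> omega
  have e2 : Hecke.s i (hi j) = hi j := by ext; simp only [Hecke.val_s, hi]; split_ifs <;> omega
  have e3 : Hecke.s j (lo i) = lo i := by ext; simp only [Hecke.val_s, lo]; split_ifs <;> omega
  have e4 : Hecke.s j (hi i) = hi i := by ext; simp only [Hecke.val_s, hi]; split_ifs <;> omega
  simp only [opT_single, map_add, map_smul, h.1, e1, e2, e3, e4, hs]
  exact smul_comm_comm _ _ _ _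

/-- Since `T_i + t - 1 = t T_i⁻¹`, this is the relation `θ_{i+1} = t T_i⁻¹ θ_i T_i⁻¹` in a form free
of inverses, which can be checked on a basis vector. -/
lemma opT_opθ (h : IsSwapFamily u sw) (i : Fin (n - 1)) (y : Y) (hy : u y (lo i) ≠ u y (hi i)) :
    opT u sw i (opθ u (hi i) (Finsupp.single y 1)) =
      opθ u (lo i) (opT u sw i (Finsupp.single y 1) + (t - 1) • Finsupp.single y 1) := by
  simp only [opT_single, opθ_single, map_add, map_smul, h.1, Hecke.s_lo]
  generalize u y (lo i) = a at *
  generalize u y (hi i) = b at *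
  have e : val b * diag a b = val a * diag a b + (t - 1) * val a := by
    have := val_sub_ne_zero hy
    unfold diag
    field_simp
    ring
  exact smul_theta e _ _

lemma opT_opθ_of_ne (h : IsSwapFamily u sw) (i : Fin (n - 1)) (j : Fin n) (y : Y)
    (h1 : j ≠ lo i) (h2 : j ≠ hi i) :
    opT u sw i (opθ u j (Finsupp.single y 1)) = opθ u j (opT u sw i (Finsupp.single y 1)) := by
  simp only [opT_single, opθ_single, map_add, map_smul, h.1, Hecke.s_of_ne h1 h2, smul_add,
    smul_comm (val _)]

end Op

end

end VVMac

namespace VVMac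

noncomputable section

/-! ### Inverse-free forms of the Hecke relations. -/

section Algebra

variable {R : Type} [Ring R] [Algebra K R]

lemma quad_of_mul_self {x : R} (h : x * x = (1 - t) • x + t • (1 : R)) :
    (x - 1) * (x + algebraMap K R t) = 0 := by
  rw [Algebra.algebraMap_eq_smul_one, sub_mul, mul_add, h, one_mul, sub_smul, one_smul,
    mul_smul_comm, mul_one]
  abel

lemma add_smul_one_eq (x : R) : x + (t - 1) • (1 : R) = t • hinv x := by
  rw [hinv, smul_smul, mul_inv_cancel₀ t_ne_zero, one_smul, Algebra.algebraMap_eq_smul_one]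

lemma eq_conj_of_mul_eq {x a b : R} (hx : (x - 1) * (x + algebraMap K R t) = 0)
    (h : x * b = a * (x + (t - 1) • (1 : R))) : b = t • (hinv x * a * hinv x) := by
  rw [add_smul_one_eq] at h
  rw [← one_mul b, ← hinv_mul hx, mul_assoc, h]
  simp only [mul_smul_comm, mul_assoc]

end Algebra

section Op

variable {Y : Type} {n : ℕ} {u : Y → Fin n → ℕ × ℤ} {sw : Fin (n - 1) → Y → Y} {rot : Y → Y}

/-- The map `rot` rotates the weights and raises the exponent of the first one. -/
def IsRotation (u : Y → Fin n → ℕ × ℤ) (rot : Y → Y) : Prop :=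
  (∀ y (i : Fin (n - 1)), u (rot y) (lo i) = u y (hi i)) ∧
    ∀ y (hn : 0 < n), u (rot y) ⟨n - 1, Nat.sub_lt hn Nat.one_pos⟩ =
      ((u y ⟨0, hn⟩).1 + 1, (u y ⟨0, hn⟩).2)

lemma opT_opω (h : IsSwapFamily u sw) (hr : IsRotation u rot) (hn : 0 < n) {i j : Fin (n - 1)}
    (hij : j.1 = i.1 + 1) (y : Y) (hs : sw i (rot y) = rot (sw j y)) :
    opT u sw i (opω u rot hn (Finsupp.single y 1)) =
      opω u rot hn (opT u sw j (Finsupp.single y 1)) := by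
  have e1 : hi i = lo j := Fin.ext hij.symm
  have e2 : Hecke.s j ⟨0, hn⟩ = ⟨0, hn⟩ := by
    ext; rw [Hecke.val_s]; simp only; split_ifs <;> first | contradiction | omega
  simp only [opT_single, opω_single, map_add, map_smul, h.1, hr.1, hs, e2]
  rw [e1, hr.1, smul_add, smul_comm (t ^ _), smul_comm (t ^ _) (off _ _)]

/-- Two rotations place the first two weights at the last two positions, both multiplied by `q`,
which leaves the coefficients of `T` unchanged. The two powers of `t` collected by `ω²` occur in the
other order after a swap, with the same product. -/
lemma opω_opω_opT (h : IsSwapFamily u sw) (hr : IsRotation u rot) (hn : 0 < n)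
    {i j : Fin (n - 1)} (hi' : i.1 = 0) (hj : j.1 + 2 = n) (y : Y)
    (hs : sw j (rot (rot y)) = rot (rot (sw i y))) :
    opω u rot hn (opω u rot hn (opT u sw i (Finsupp.single y 1))) =
      opT u sw j (opω u rot hn (opω u rot hn (Finsupp.single y 1))) := by
  have e1 : (⟨0, hn⟩ : Fin n) = lo i := Fin.ext hi'.symm
  have e2 : hi j = ⟨n - 1, Nat.sub_lt hn Nat.one_pos⟩ := Fin.ext (by simp only [hi]; omega)
  have f1 : ∀ y, u (rot y) ⟨0, hn⟩ = u y (hi i) := fun y => by rw [e1, hr.1]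
  have f2 : ∀ y, u (rot (rot y)) (hi j) = ((u y (hi i)).1 + 1, (u y (hi i)).2) := fun y => by
    rw [e2, hr.2 _ hn, f1]
  have f3 : ∀ y, u (rot (rot y)) (lo j) = ((u y (lo i)).1 + 1, (u y (lo i)).2) := fun y => by
    rw [hr.1, e2, hr.2 _ hn, e1]
  simp only [opT_single, opω_single, map_add, map_smul, f1, f2, f3, hs, diag_shift, off_shift]
  simp only [e1, h.1, Hecke.s_lo, Hecke.s_hi, smul_add, smul_smul]
  congr 2 <;> ring

lemma opθ_opω (hr : IsRotation u rot) (hn : 0 < n) (i : Fin (n - 1)) (y : Y) :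
    opθ u (lo i) (opω u rot hn (Finsupp.single y 1)) =
      opω u rot hn (opθ u (hi i) (Finsupp.single y 1)) := by
  simp only [opθ_single, opω_single, map_smul, hr.1]
  rw [smul_comm]

lemma opθ_last_opω (hr : IsRotation u rot) (hn : 0 < n) (y : Y) :
    opθ u ⟨n - 1, Nat.sub_lt hn Nat.one_pos⟩ (opω u rot hn (Finsupp.single y 1)) =
      q • opω u rot hn (opθ u ⟨0, hn⟩ (Finsupp.single y 1)) := by
  simp only [opθ_single, opω_single, map_smul, hr.2 _ hn]
  rw [← q_mul_val, mul_smul, smul_comm, smul_comm (t ^ _)]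

end Op

variable {lam : YoungDiagram}

/-! ### All fillings -/

/-- Fillings of a diagram by labels, without conditions on rows and columns. -/
@[ext] structure Filling (lam : YoungDiagram) where
  idx : Box lam ≃ Fin lam.card
  pow : Box lam → ℕ

namespace Filling

/-- The pair of exponent and content at `i`. -/
def u (f : Filling lam) (i : Fin lam.card) : ℕ × ℤ :=
  (f.pow (f.idx.symm i), content (f.idx.symm i))

/-- The exchange of `i` and `i + 1`. -/
def swap (i : Fin (lam.card - 1)) (f : Filling lam) : Filling lam :=
  ⟨f.idx.trans (Hecke.s i), f.pow⟩

/-- The map `Ψ` on fillings. -/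
def rot (f : Filling lam) : Filling lam :=
  ⟨f.idx.trans (finRotate lam.card).symm, fun b => if (f.idx b).1 = 0 then f.pow b + 1 else f.pow b⟩

lemma isSwapFamily : IsSwapFamily (Filling.u (lam := lam)) Filling.swap := by
  refine ⟨fun i f k => ?_, fun i f => ?_⟩
  · have : (Hecke.s i).symm = Hecke.s i := Equiv.symm_swap _ _
    simp only [u, swap, Equiv.symm_trans_apply, this]
  · ext1
    · ext1 b
      exact Equiv.swap_apply_self _ _ _
    · rfl

lemma isRotation : IsRotation (Filling.u (lam := lam)) Filling.rot := by
  refine ⟨fun f i => ?_, fun f hn => ?_⟩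
  · have e : finRotate lam.card (lo i) = hi i := by
      ext; rw [val_finRotate, if_neg (by have := i.2; simp only [lo]; omega)]; rfl
    simp [u, rot, e, hi]
  · have e : finRotate lam.card ⟨lam.card - 1, Nat.sub_lt hn Nat.one_pos⟩ = ⟨0, hn⟩ := by
      ext; rw [val_finRotate, if_pos (by simp only; omega)]
    simp [u, rot, e]

lemma swap_braid {i j : Fin (lam.card - 1)} (h : j.1 = i.1 + 1) (f : Filling lam) :
    swap i (swap j (swap i f)) = swap j (swap i (swap j f)) := by
  ext1
  · ext1 b
    exact congrArg (fun e : Equiv.Perm (Fin lam.card) => e (f.idx b)) (Hecke.s_braid h)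
  · rfl

lemma swap_comm {i j : Fin (lam.card - 1)} (h : i.1 + 1 < j.1) (f : Filling lam) :
    swap i (swap j f) = swap j (swap i f) := by
  ext1
  · ext1 b
    exact congrArg (fun e : Equiv.Perm (Fin lam.card) => e (f.idx b)) (Hecke.s_comm (Or.inl h))
  · rfl

lemma swap_rot {i j : Fin (lam.card - 1)} (h : j.1 = i.1 + 1) (f : Filling lam) :
    swap i (rot f) = rot (swap j f) := by
  have hi := i.2
  have hj := j.2
  ext b
  · have := (f.idx b).2
    simp only [swap, rot, Equiv.trans_apply, Hecke.val_s, val_finRotate_symm]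
    split_ifs <;> first | contradiction | omega
  · simp only [swap, rot, Equiv.trans_apply, Hecke.val_s]
    split_ifs <;> first | contradiction | omega

lemma swap_rot_rot {i j : Fin (lam.card - 1)} (hi' : i.1 = 0) (hj' : j.1 + 2 = lam.card)
    (f : Filling lam) : swap j (rot (rot f)) = rot (rot (swap i f)) := by
  have hi := i.2
  have hj := j.2
  ext b
  · have := (f.idx b).2
    simp only [swap, rot, Equiv.trans_apply, Hecke.val_s, val_finRotate_symm]
    split_ifs <;> first | contradiction | omega
  · have := (f.idx b).2
    simp only [swap, rot, Equiv.trans_apply, Hecke.val_s, val_finRotate_symm]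
    split_ifs <;> first | contradiction | omega

end Filling

/-! ### The model of the module -/

namespace PSYT

/-- The filling underlying a periodic standard tableau. -/
def toFilling (τ : PSYT lam) : Filling lam := ⟨τ.idx, τ.pow⟩

lemma toFilling_injective : Function.Injective (toFilling (lam := lam)) := by
  intro τ τ' h
  ext1
  · exact congrArg Filling.idx h
  · exact congrArg Filling.pow h

lemma u_toFilling (τ : PSYT lam) : τ.toFilling.u = τ.u := rfl

open Classical in
/-- The tableau `s_i(τ)` if it is periodic standard, and `τ` otherwise. -/
def swap (i : Fin (lam.card - 1)) (τ : PSYT lam) : PSYT lam :=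
  if h : ∃ τ', IsSwap i τ τ' then h.choose else τ

lemma _root_.VVMac.IsSwap.swap_eq {i : Fin (lam.card - 1)} {τ τ' : PSYT lam} (h : IsSwap i τ τ') :
    τ.swap i = τ' := by
  have h' : ∃ τ', IsSwap i τ τ' := ⟨τ', h⟩
  rw [swap, dif_pos h']
  exact h'.choose_spec.unique h

/-- A swap is obstructed only by neighbours in a row or a column with equal exponents; their weights
differ by a factor `t`, where `offProd` vanishes. -/
lemma off_eq_zero {i : Fin (lam.card - 1)} {τ : PSYT lam} (h : ¬ ∃ τ', IsSwap i τ τ') :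
    off (τ.u (lo i)) (τ.u (hi i)) = 0 := by
  have h1 : ¬ Up (τ.u (lo i)) (τ.u (hi i)) := fun hu => by
    obtain ⟨τ', h'⟩ := exists_swap_of_up hu
    exact h ⟨τ', h'.1⟩
  rw [off, if_neg h1]
  by_cases h2 : τ.SameRow i
  · exact offProd_eq_zero_of_left h2.1 h2.c_hi
  by_cases h3 : τ.SameCol i
  · exact offProd_eq_zero_of_right h3.1 h3.c_lo
  exact absurd (exists_swap h2 h3) h

lemma isRotation : IsRotation (PSYT.u (lam := lam)) PSYT.Psi :=
  ⟨fun τ i => Filling.isRotation.1 τ.toFilling i, fun τ hn => Filling.isRotation.2 τ.toFilling hn⟩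

end PSYT

/-- The space with basis the periodic standard tableaux. -/
abbrev Model (lam : YoungDiagram) : Type := PSYT lam →₀ K

namespace Model

/-- The operator `T_i`. -/
def opT (i : Fin (lam.card - 1)) : Module.End K (Model lam) := VVMac.opT PSYT.u PSYT.swap i

/-- The operator `θ_i`. -/
def opθ (i : Fin lam.card) : Module.End K (Model lam) := VVMac.opθ PSYT.u i

/-- The operator `ω`. -/
def opω (hn : 0 < lam.card) : Module.End K (Model lam) := VVMac.opω PSYT.u PSYT.Psi hn

/-- The embedding into the space with basis all fillings. -/
def emb : Model lam →ₗ[K] Filling lam →₀ K := Finsupp.lmapDomain K K PSYT.toFilling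

lemma emb_injective : Function.Injective (emb (lam := lam)) :=
  Finsupp.mapDomain_injective PSYT.toFilling_injective

lemma emb_single (τ : PSYT lam) :
    emb (Finsupp.single τ 1) = Finsupp.single τ.toFilling 1 := by
  rw [emb, Finsupp.lmapDomain_apply, Finsupp.mapDomain_single]

lemma end_ext {M : Type*} [AddCommGroup M] [Module K M] {Y : Type} {f g : (Y →₀ K) →ₗ[K] M}
    (h : ∀ y, f (Finsupp.single y 1) = g (Finsupp.single y 1)) : f = g := by
  ext y
  exact h y

lemma opT_single (i : Fin (lam.card - 1)) (τ : PSYT lam) : opT i (Finsupp.single τ 1) =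
    diag (τ.u (lo i)) (τ.u (hi i)) • Finsupp.single τ 1 +
      off (τ.u (lo i)) (τ.u (hi i)) • Finsupp.single (τ.swap i) 1 := VVMac.opT_single _ _ _ _

lemma opθ_single (i : Fin lam.card) (τ : PSYT lam) :
    opθ i (Finsupp.single τ 1) = τ.weight i • Finsupp.single τ 1 := VVMac.opθ_single _ _ _

lemma opω_single (hn : 0 < lam.card) (τ : PSYT lam) :
    opω hn (Finsupp.single τ 1) = t ^ τ.c ⟨0, hn⟩ • Finsupp.single τ.Psi 1 :=
  VVMac.opω_single _ _ _ _

/-- The value that `PSYT.swap` takes when no swapped tableau exists is irrelevant, since it is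
multiplied by zero. So the operators on the model restrict those on arbitrary fillings, where swaps
are always defined and satisfy the braid relations. The fillings of the model also have the distinct
weights those relations require. -/
lemma emb_opT (i : Fin (lam.card - 1)) (x : Model lam) :
    emb (opT i x) = VVMac.opT Filling.u Filling.swap i (emb x) := by
  suffices h : emb ∘ₗ opT i = VVMac.opT Filling.u Filling.swap i ∘ₗ emb from
    LinearMap.congr_fun h x
  refine end_ext fun τ => ?_
  simp only [LinearMap.comp_apply, opT_single, map_add, map_smul, emb_single, VVMac.opT_single,
    PSYT.u_toFilling]
  by_cases h : ∃ τ', IsSwap i τ τ'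
  · obtain ⟨τ', hτ'⟩ := h
    rw [hτ'.swap_eq]
    congr 3
    ext1
    · ext1 b
      exact hτ'.2 b
    · exact hτ'.1
  · rw [PSYT.off_eq_zero h, zero_smul, zero_smul]

lemma emb_opθ (i : Fin lam.card) (x : Model lam) :
    emb (opθ i x) = VVMac.opθ Filling.u i (emb x) := by
  suffices h : emb ∘ₗ opθ i = VVMac.opθ Filling.u i ∘ₗ emb from LinearMap.congr_fun h x
  refine end_ext fun τ => ?_
  simp only [LinearMap.comp_apply, opθ_single, map_smul, emb_single, VVMac.opθ_single,
    PSYT.u_toFilling, PSYT.val_u]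

lemma emb_opω (hn : 0 < lam.card) (x : Model lam) :
    emb (opω hn x) = VVMac.opω Filling.u Filling.rot hn (emb x) := by
  suffices h : emb ∘ₗ opω hn = VVMac.opω Filling.u Filling.rot hn ∘ₗ emb from
    LinearMap.congr_fun h x
  refine end_ext fun τ => ?_
  simp only [LinearMap.comp_apply, opω_single, map_smul, emb_single, VVMac.opω_single,
    PSYT.u_toFilling]
  rfl

/-- Identities between operators can be checked on fillings. -/
lemma ext_emb {f g : Module.End K (Model lam)}
    (h : ∀ τ : PSYT lam, emb (f (Finsupp.single τ 1)) = emb (g (Finsupp.single τ 1))) : f = g :=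
  end_ext fun τ => emb_injective (h τ)

lemma opT_mul_opT (i : Fin (lam.card - 1)) :
    opT i * opT i = (1 - t) • opT i + t • (1 : Module.End K (Model lam)) := by
  refine ext_emb fun τ => ?_
  simp only [Module.End.mul_apply, LinearMap.add_apply, LinearMap.smul_apply, map_add, map_smul,
    emb_opT, emb_single, Module.End.one_apply]
  exact opT_quad Filling.isSwapFamily i _ (τ.u_lo_ne_u_hi i)

lemma opT_quad (i : Fin (lam.card - 1)) :
    (opT i - 1) * (opT i + algebraMap K (Module.End K (Model lam)) t) = 0 :=
  quad_of_mul_self (R := Module.End K (Model lam)) (opT_mul_opT i)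

lemma opT_braid {i j : Fin (lam.card - 1)} (h : j.1 = i.1 + 1) :
    opT i * opT j * opT i = opT j * opT i * opT j := by
  refine ext_emb fun τ => ?_
  simp only [Module.End.mul_apply, emb_opT, emb_single]
  refine VVMac.opT_braid Filling.isSwapFamily h _ (Filling.swap_braid h _) (τ.u_lo_ne_u_hi i)
    (τ.u_ne ?_ ?_) (τ.u_ne ?_ ?_) <;> simp only [lo, hi] <;> omega

lemma opT_comm {i j : Fin (lam.card - 1)} (h : i.1 + 1 < j.1) :
    opT i * opT j = opT j * opT i := by
  refine ext_emb fun τ => ?_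
  simp only [Module.End.mul_apply, emb_opT, emb_single]
  exact VVMac.opT_comm Filling.isSwapFamily h _ (Filling.swap_comm h _)

lemma opθ_comm (i j : Fin lam.card) : (opθ i * opθ j : Module.End K (Model lam)) =
    opθ j * opθ i := by
  refine end_ext fun τ => ?_
  simp only [Module.End.mul_apply, opθ_single, map_smul]
  rw [smul_comm]

lemma opθ_hi (i : Fin (lam.card - 1)) : (opθ (hi i) : Module.End K (Model lam)) =
    t • (hinv (opT i) * opθ (lo i) * hinv (opT i)) := by
  have h : opT i * opθ (hi i) = opθ (lo i) * (opT i + (t - 1) • 1) := by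
    refine ext_emb fun τ => ?_
    simp only [Module.End.mul_apply, LinearMap.add_apply, LinearMap.smul_apply, map_add, map_smul,
      emb_opT, emb_opθ, emb_single, Module.End.one_apply]
    rw [opT_opθ Filling.isSwapFamily i τ.toFilling (τ.u_lo_ne_u_hi i), map_add, map_smul]
  exact eq_conj_of_mul_eq (opT_quad i) h

lemma opT_opθ {i : Fin (lam.card - 1)} {j : Fin lam.card} (h1 : j ≠ lo i) (h2 : j ≠ hi i) :
    opT i * opθ j = opθ j * opT i := by
  refine ext_emb fun τ => ?_
  simp only [Module.End.mul_apply, emb_opT, emb_opθ, emb_single]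
  exact opT_opθ_of_ne Filling.isSwapFamily i j _ h1 h2

lemma opT_opω (hn : 0 < lam.card) {i j : Fin (lam.card - 1)} (h : j.1 = i.1 + 1) :
    opT i * opω hn = opω hn * opT j := by
  refine ext_emb fun τ => ?_
  simp only [Module.End.mul_apply, emb_opT, emb_opω, emb_single]
  exact VVMac.opT_opω Filling.isSwapFamily Filling.isRotation hn h _ (Filling.swap_rot h _)

lemma opω_opω_opT (hn : 0 < lam.card) {i j : Fin (lam.card - 1)} (hi' : i.1 = 0)
    (hj : j.1 + 2 = lam.card) : opω hn * opω hn * opT i = opT j * (opω hn * opω hn) := by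
  refine ext_emb fun τ => ?_
  simp only [Module.End.mul_apply, emb_opT, emb_opω, emb_single]
  exact VVMac.opω_opω_opT Filling.isSwapFamily Filling.isRotation hn hi' hj _
    (Filling.swap_rot_rot hi' hj _)

lemma opθ_opω (hn : 0 < lam.card) (i : Fin (lam.card - 1)) :
    opθ (lo i) * opω hn = opω hn * opθ (hi i) :=
  end_ext fun τ => VVMac.opθ_opω PSYT.isRotation hn i τ

lemma opθ_last_opω (hn : 0 < lam.card) :
    opθ ⟨lam.card - 1, Nat.sub_lt hn Nat.one_pos⟩ * opω hn = q • (opω hn * opθ ⟨0, hn⟩) :=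
  end_ext fun τ => VVMac.opθ_last_opω PSYT.isRotation hn τ

/-- `opT` with natural numbers as indices. -/
def natT (lam : YoungDiagram) (k : ℕ) : Module.End K (Model lam) :=
  if h : k < lam.card - 1 then opT ⟨k, h⟩ else 0

/-- `opθ` with natural numbers as indices. -/
def natθ (lam : YoungDiagram) (k : ℕ) : Module.End K (Model lam) :=
  if h : k < lam.card then opθ ⟨k, h⟩ else 0

lemma natT_of_lt {k : ℕ} (h : k < lam.card - 1) : natT lam k = opT ⟨k, h⟩ := dif_pos h

lemma natθ_of_lt {k : ℕ} (h : k < lam.card) : natθ lam k = opθ ⟨k, h⟩ := dif_pos h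

lemma natT_val (i : Fin (lam.card - 1)) : natT lam i = opT i := natT_of_lt i.2

/-- The default value `0` of `natT` and `natθ` plays no role, as these relations involve only
indices in range. -/
lemma isExtended (hn : 0 < lam.card) :
    IsExtended (lam.card - 1) (natT lam) (natθ lam) (opω hn) where
  quad i hi := by rw [natT_of_lt hi]; exact opT_quad _
  braid i hi := by rw [natT_of_lt hi, natT_of_lt (by omega)]; exact opT_braid rfl
  comm i j h hj := by rw [natT_of_lt hj, natT_of_lt (by omega)]; exact opT_comm h
  step i hi := by
    rw [natT_of_lt hi, natθ_of_lt (by omega), natθ_of_lt (by omega)]; exact opθ_hi ⟨i, hi⟩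
  far i hi j hj h1 h2 := by
    rw [natT_of_lt hi, natθ_of_lt (by omega)]
    exact opT_opθ (fun h => h1 (congrArg Fin.val h)) (fun h => h2 (congrArg Fin.val h))
  ω_T i hi := by rw [natT_of_lt hi, natT_of_lt (by omega)]; exact opT_opω hn rfl
  ω_ω k hk := by
    rw [natT_of_lt (by omega), natT_of_lt (by omega)]
    exact opω_opω_opT hn rfl (by simp only; omega)
  ω_θ i hi := by
    rw [natθ_of_lt (by omega), natθ_of_lt (by omega)]; exact opθ_opω hn ⟨i, hi⟩
  ω_θ_last := by rw [natθ_of_lt (by omega), natθ_of_lt hn]; exact opθ_last_opω hn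

end Model

end

end VVMac

namespace VVMac

noncomputable section

/-! ### Generators -/

namespace Aff

variable {n : ℕ}

/-- The generator `T_i` of `A_n`. -/
def T (i : Fin (n - 1)) : Aff n := mk n (AffGen.fT i)

/-- The generator `θ_i` of `A_n`. -/
def θ (i : Fin n) : Aff n := mk n (AffGen.fθ i)

lemma ofHecke_T (i : Fin (n - 1)) : ofHecke n (Hecke.T i) = T i := by
  unfold ofHecke Hecke.T Hecke.mk T
  erw [RingQuot.liftAlgHom_mkAlgHom_apply]
  simp

lemma rho_T (i : Fin (n - 1)) : rho n (T i) = Hecke.T i := by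
  unfold rho T mk
  erw [RingQuot.liftAlgHom_mkAlgHom_apply]
  simp [AffGen.fT, rhoGen]

lemma rho_θ (i : Fin n) : rho n (θ i) = Hecke.thetaBar i := by
  unfold rho θ mk
  erw [RingQuot.liftAlgHom_mkAlgHom_apply]
  simp [AffGen.fθ, rhoGen]

lemma induction {P : Aff n → Prop} (scalar : ∀ r : K, P (algebraMap K _ r))
    (hT : ∀ i, P (T i)) (hθ : ∀ i, P (θ i)) (mul : ∀ a b, P a → P b → P (a * b))
    (add : ∀ a b, P a → P b → P (a + b)) (a : Aff n) : P a := by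
  obtain ⟨x, rfl⟩ : ∃ x, mk n x = a := RingQuot.mkAlgHom_surjective K (AffRel n) a
  induction x using FreeAlgebra.induction with
  | grade0 r => rw [AlgHom.commutes]; exact scalar r
  | grade1 x =>
    cases x with
    | T i => exact hT i
    | theta i => exact hθ i
  | mul a b ha hb => rw [map_mul]; exact mul _ _ ha hb
  | add a b ha hb => rw [map_add]; exact add _ _ ha hb

end Aff

lemma Hecke.induction {n : ℕ} {P : Hecke n → Prop} (scalar : ∀ r : K, P (algebraMap K _ r))
    (hT : ∀ i, P (Hecke.T i)) (mul : ∀ a b, P a → P b → P (a * b))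
    (add : ∀ a b, P a → P b → P (a + b)) (a : Hecke n) : P a := by
  obtain ⟨x, rfl⟩ : ∃ x, Hecke.mk n x = a := RingQuot.mkAlgHom_surjective K (HeckeRel n) a
  induction x using FreeAlgebra.induction with
  | grade0 r => rw [AlgHom.commutes]; exact scalar r
  | grade1 x => exact hT x
  | mul a b ha hb => rw [map_mul]; exact mul _ _ ha hb
  | add a b ha hb => rw [map_add]; exact add _ _ ha hb

namespace Daha

variable {n : ℕ}

lemma ofAff_mk (x : FreeAlgebra K (AffGen n)) : ofAff n (Aff.mk n x) = mk n (DahaGen.incl n x) := by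
  unfold ofAff Aff.mk
  erw [RingQuot.liftAlgHom_mkAlgHom_apply]
  rfl

lemma ofAff_T (i : Fin (n - 1)) : ofAff n (Aff.T i) = T i := ofAff_mk _

lemma ofAff_θ (i : Fin n) : ofAff n (Aff.θ i) = θ i := ofAff_mk _

/-- The inclusion of the finite Hecke algebra. -/
def ofHecke (n : ℕ) : Hecke n →ₐ[K] Daha n := (ofAff n).comp (Aff.ofHecke n)

lemma ofHecke_T (i : Fin (n - 1)) : ofHecke n (Hecke.T i) = T i := by
  rw [ofHecke, AlgHom.comp_apply, Aff.ofHecke_T, ofAff_T]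

lemma eps_eq : eps n = ofHecke n (Hecke.eps n) := rfl

lemma induction {P : Daha n → Prop} (scalar : ∀ r : K, P (algebraMap K _ r))
    (hT : ∀ i, P (T i)) (hθ : ∀ i, P (θ i)) (hX : ∀ i, P (X i))
    (mul : ∀ a b, P a → P b → P (a * b))
    (add : ∀ a b, P a → P b → P (a + b)) (a : Daha n) : P a := by
  obtain ⟨x, rfl⟩ : ∃ x, mk n x = a := RingQuot.mkAlgHom_surjective K (DahaRel n) a
  induction x using FreeAlgebra.induction with
  | grade0 r => rw [AlgHom.commutes]; exact scalar r
  | grade1 x =>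
    rcases x with (i | i) | i
    · convert hT i
      simp [T, DahaGen.fT, DahaGen.incl, AffGen.fT]
    · convert hθ i
      simp [θ, DahaGen.fθ, DahaGen.incl, AffGen.fθ]
    · exact hX i
  | mul a b ha hb => rw [map_mul]; exact mul _ _ ha hb
  | add a b ha hb => rw [map_add]; exact add _ _ ha hb

lemma map_piOf {R S : Type} [Ring R] [Algebra K R] [Ring S] [Algebra K S] (f : R →ₐ[K] S)
    (hn : 0 < n) (T : Fin (n - 1) → R) (θ : Fin n → R) :
    f (piOf hn T θ) = piOf hn (fun i => f (T i)) (fun i => f (θ i)) := by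
  simp only [piOf, map_smul, map_mul, map_list_prod, List.map_ofFn, Function.comp_def, map_hinv]

end Daha

/-! ### The representation on the model -/

namespace Model

variable {lam : YoungDiagram}

/-- The operator `X_i`. -/
def opX (i : Fin lam.card) : Module.End K (Model lam) :=
  (isExtended (lt_of_le_of_lt (Nat.zero_le _) i.2)).x i

/-- The operators of the generators. -/
def gen (lam : YoungDiagram) : DahaGen lam.card → Module.End K (Model lam)
  | .aff (.T i) => opT i
  | .aff (.theta i) => opθ i
  | .X i => opX i

/-- The representation of the free algebra. -/
def freeRep (lam : YoungDiagram) :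
    FreeAlgebra K (DahaGen lam.card) →ₐ[K] Module.End K (Model lam) :=
  FreeAlgebra.lift K (gen lam)

lemma freeRep_hinv (x : FreeAlgebra K (DahaGen lam.card)) :
    freeRep lam (hinv x) = hinv (freeRep lam x) :=
  map_hinv (S := Module.End K (Model lam)) (freeRep lam) x

lemma freeRep_incl_hinv (x : FreeAlgebra K (AffGen lam.card)) :
    freeRep lam (DahaGen.incl _ (hinv x)) = hinv (freeRep lam (DahaGen.incl _ x)) := by
  rw [← freeRep_hinv]
  exact congrArg _ (map_hinv (DahaGen.incl _) x)

lemma freeRep_T (i : Fin (lam.card - 1)) : freeRep lam (DahaGen.fT i) = opT i := by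
  simp [freeRep, DahaGen.fT, AffGen.fT, DahaGen.incl, gen]

lemma freeRep_θ (i : Fin lam.card) : freeRep lam (DahaGen.fθ i) = opθ i := by
  simp [freeRep, DahaGen.fθ, AffGen.fθ, DahaGen.incl, gen]

lemma freeRep_X (i : Fin lam.card) : freeRep lam (DahaGen.fX i) = opX i := by
  simp [freeRep, DahaGen.fX, gen]

lemma freeRep_hecke {a b : FreeAlgebra K (Fin (lam.card - 1))} (h : HeckeRel lam.card a b) :
    FreeAlgebra.lift K (opT (lam := lam)) a = FreeAlgebra.lift K (opT (lam := lam)) b := by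
  cases h with
  | quad i =>
    have := opT_quad i
    simpa only [map_mul, map_sub, map_add, map_one, map_zero, FreeAlgebra.lift_ι_apply,
      AlgHom.commutes] using this
  | braid i j h => simpa only [map_mul, FreeAlgebra.lift_ι_apply] using opT_braid h
  | comm i j h =>
    rcases h with h | h
    · simpa only [map_mul, FreeAlgebra.lift_ι_apply] using opT_comm h
    · simpa only [map_mul, FreeAlgebra.lift_ι_apply] using (opT_comm h).symm

lemma freeRep_aff {a b : FreeAlgebra K (AffGen lam.card)} (h : AffRel lam.card a b) :
    freeRep lam (DahaGen.incl _ a) = freeRep lam (DahaGen.incl _ b) := by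
  have hT : ∀ i, freeRep lam (DahaGen.incl _ (AffGen.fT i)) = opT i := freeRep_T
  have hθ : ∀ i, freeRep lam (DahaGen.incl _ (AffGen.fθ i)) = opθ i := freeRep_θ
  cases h with
  | @hecke a b h =>
    have e : ((freeRep lam).comp (DahaGen.incl _)).comp (FreeAlgebra.lift K AffGen.fT) =
        FreeAlgebra.lift K (opT (lam := lam)) := by
      ext1
      funext i
      simpa using hT i
    have e' := fun x => DFunLike.congr_fun e x
    simp only [AlgHom.comp_apply] at e'
    rw [e', e']
    exact freeRep_hecke h
  | comm i j => simpa only [map_mul, hθ] using opθ_comm i j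
  | step i => simpa only [map_mul, map_smul, freeRep_incl_hinv, hT, hθ] using opθ_hi i
  | far i j h1 h2 => simpa only [map_mul, hT, hθ] using opT_opθ h1 h2

lemma opX_eq (hn : 0 < lam.card) (i : Fin lam.card) : opX i = (isExtended hn).x i := rfl

lemma piOf_eq (hn : 0 < lam.card) :
    piOf hn (opT (lam := lam)) opθ = (isExtended hn).π := by
  have h := prod_ofFn_eq_up (fun k => hinv (natT lam k)) (lam.card - 1)
  simp only [natT_val] at h
  rw [piOf, h]
  have h0 : natθ lam 0 = opθ ⟨0, hn⟩ := natθ_of_lt hn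
  rw [IsExtended.π, h0]

lemma freeRep_piOf (hn : 0 < lam.card) :
    freeRep lam (piOf hn DahaGen.fT DahaGen.fθ) = (isExtended hn).π := by
  have h := Daha.map_piOf (S := Module.End K (Model lam)) (freeRep lam) hn DahaGen.fT DahaGen.fθ
  simp only [freeRep_T, freeRep_θ] at h
  exact h.trans (piOf_eq hn)

lemma freeRep_rel {a b : FreeAlgebra K (DahaGen lam.card)} (h : DahaRel lam.card a b) :
    freeRep lam a = freeRep lam b := by
  cases h with
  | @aff a b h => exact freeRep_aff h
  | comm i j =>
    simp only [map_mul, freeRep_X]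
    exact (isExtended (lt_of_le_of_lt (Nat.zero_le _) i.2)).x_comm (by omega) (by omega)
  | step i =>
    simp only [map_mul, map_smul, freeRep_hinv, freeRep_X, freeRep_T, ← natT_val]
    rfl
  | far i j h1 h2 =>
    have h := (isExtended (lt_of_le_of_lt (Nat.zero_le _) j.2)).T_mul_x (i := i) (k := j) i.2
      (by omega) (fun h => h1 (Fin.ext h)) (fun h => h2 (Fin.ext h))
    rw [natT_val] at h
    simp only [map_mul, freeRep_X, freeRep_T]
    exact h.eq
  | pi hn i =>
    simp only [map_mul, freeRep_X, freeRep_piOf]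
    exact (isExtended hn).π_mul_x i i.2
  | pi_last hn =>
    simp only [map_mul, map_smul, freeRep_X, freeRep_piOf]
    exact (isExtended hn).π_mul_x_last

/-- The representation of `D_n` on the model. -/
def rep (lam : YoungDiagram) : Daha lam.card →ₐ[K] Module.End K (Model lam) :=
  RingQuot.liftAlgHom K ⟨freeRep lam, fun _ _ h => freeRep_rel h⟩

lemma rep_mk (x : FreeAlgebra K (DahaGen lam.card)) : rep lam (Daha.mk _ x) = freeRep lam x := by
  unfold rep Daha.mk
  erw [RingQuot.liftAlgHom_mkAlgHom_apply]

lemma rep_T (i : Fin (lam.card - 1)) : rep lam (Daha.T i) = opT i :=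
  (rep_mk _).trans (freeRep_T i)

lemma rep_θ (i : Fin lam.card) : rep lam (Daha.θ i) = opθ i :=
  (rep_mk _).trans (freeRep_θ i)

lemma rep_X (i : Fin lam.card) : rep lam (Daha.X i) = opX i :=
  (rep_mk _).trans (freeRep_X i)

lemma rep_pi (hn : 0 < lam.card) : rep lam (Daha.pi hn) = (isExtended hn).π := by
  have h := Daha.map_piOf (S := Module.End K (Model lam)) (rep lam) hn Daha.T Daha.θ
  simp only [rep_T, rep_θ] at h
  exact h.trans (piOf_eq hn)

lemma rep_hinv (x : Daha lam.card) : rep lam (hinv x) = hinv (rep lam x) :=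
  map_hinv (S := Module.End K (Model lam)) (rep lam) x

instance : Module (Daha lam.card) (Model lam) := Module.compHom _ (rep lam).toRingHom

lemma smul_def (d : Daha lam.card) (x : Model lam) : d • x = rep lam d x := rfl

instance : IsScalarTower K (Daha lam.card) (Model lam) :=
  ⟨fun k d x => by rw [smul_def, smul_def, map_smul]; rfl⟩

instance : Module (Hecke lam.card) (Model lam) :=
  Module.compHom _ ((rep lam).comp (Daha.ofHecke _)).toRingHom

lemma hecke_smul_def (a : Hecke lam.card) (x : Model lam) :
    a • x = rep lam (Daha.ofHecke _ a) x := rfl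

instance : IsScalarTower K (Hecke lam.card) (Model lam) :=
  ⟨fun k d x => by rw [hecke_smul_def, hecke_smul_def, map_smul, map_smul]; rfl⟩

lemma hecke_T_smul (i : Fin (lam.card - 1)) (x : Model lam) :
    (Hecke.T i : Hecke lam.card) • x = opT i x := by
  rw [hecke_smul_def, Daha.ofHecke_T, rep_T]

/-! ### The action of `T_i` on the basis -/

lemma opT_single_of_up {i : Fin (lam.card - 1)} {τ τ' : PSYT lam} (h : SwapUp i τ τ') :
    opT i (Finsupp.single τ 1) =
      diag (τ.u (lo i)) (τ.u (hi i)) • Finsupp.single τ 1 + Finsupp.single τ' 1 := by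
  rw [opT_single, h.1.swap_eq, off, if_pos h.up, one_smul]

/-- For row neighbours `y = t x`, so the diagonal coefficient is `(1 - t) x / (x - t x) = 1` and the
off-diagonal one vanishes. For column neighbours `x = t y`, which gives `-t`. -/
lemma opT_single_of_sameRow {i : Fin (lam.card - 1)} {τ : PSYT lam} (h : τ.SameRow i) :
    opT i (Finsupp.single τ 1) = Finsupp.single τ 1 := by
  have h1 : ¬ Up (τ.u (lo i)) (τ.u (hi i)) := by
    have := h.1
    have := h.c_hi
    simp only [Up, PSYT.u]
    omega
  have h2 : diag (τ.u (lo i)) (τ.u (hi i)) = 1 := by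
    have e : val (τ.u (hi i)) = t * val (τ.u (lo i)) := by
      rw [t_mul_val]; congr 1; exact Prod.ext h.1.symm h.c_hi
    have := val_sub_ne_zero (τ.u_lo_ne_u_hi i)
    rw [e] at this
    rw [diag, e, div_eq_one_iff_eq this]
    ring
  rw [opT_single, h2, one_smul, off, if_neg h1, offProd_eq_zero_of_left h.1 h.c_hi, zero_smul,
    add_zero]

lemma opT_single_of_sameCol {i : Fin (lam.card - 1)} {τ : PSYT lam} (h : τ.SameCol i) :
    opT i (Finsupp.single τ 1) = -t • Finsupp.single τ 1 := by
  have h1 : ¬ Up (τ.u (lo i)) (τ.u (hi i)) := by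
    have := h.1
    have := h.c_lo
    simp only [Up, PSYT.u]
    omega
  have h2 : diag (τ.u (lo i)) (τ.u (hi i)) = -t := by
    have e : val (τ.u (lo i)) = t * val (τ.u (hi i)) := by
      rw [t_mul_val]; congr 1; exact Prod.ext h.1 h.c_lo
    have := val_sub_ne_zero (τ.u_lo_ne_u_hi i)
    rw [e] at this
    rw [diag, e, div_eq_iff this]
    ring
  rw [opT_single, h2, off, if_neg h1, offProd_eq_zero_of_right h.1 h.c_lo, zero_smul, add_zero]

/-- The span of the tableaux with given exponents. -/
def withPow (p : Box lam → ℕ) : Submodule K (Model lam) := Finsupp.supported K K {τ | τ.pow = p}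

lemma single_mem_withPow (τ : PSYT lam) : Finsupp.single τ 1 ∈ withPow τ.pow :=
  Finsupp.single_mem_supported K 1 rfl

lemma withPow_induction {p : Box lam → ℕ} {P : Model lam → Prop}
    (single : ∀ τ : PSYT lam, τ.pow = p → P (Finsupp.single τ 1)) (zero : P 0)
    (add : ∀ x y, P x → P y → P (x + y)) (smul : ∀ (k : K) x, P x → P (k • x)) {x : Model lam}
    (hx : x ∈ withPow p) : P x := by
  rw [withPow, Finsupp.supported_eq_span_single] at hx
  induction hx using Submodule.span_induction with
  | mem x hx => obtain ⟨τ, hτ, rfl⟩ := hx; exact single τ hτ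
  | zero => exact zero
  | add x y _ _ hx hy => exact add x y hx hy
  | smul k x _ hx => exact smul k x hx

lemma pow_swap (i : Fin (lam.card - 1)) (τ : PSYT lam) : (τ.swap i).pow = τ.pow := by
  by_cases h : ∃ τ', IsSwap i τ τ'
  · obtain ⟨τ', hτ'⟩ := h
    rw [hτ'.swap_eq, hτ'.1]
  · rw [PSYT.swap, dif_neg h]

lemma opT_mem_withPow (i : Fin (lam.card - 1)) {p : Box lam → ℕ} {x : Model lam}
    (hx : x ∈ withPow p) : opT i x ∈ withPow p := by
  refine withPow_induction (P := fun x => opT i x ∈ withPow p) ?_ ?_ ?_ ?_ hx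
  · rintro τ rfl
    rw [opT_single]
    refine Submodule.add_mem _ (Submodule.smul_mem _ _ (single_mem_withPow τ))
      (Submodule.smul_mem _ _ ?_)
    rw [← pow_swap i τ]
    exact single_mem_withPow _
  · rw [map_zero]; exact Submodule.zero_mem _
  · intro x y hx hy; rw [map_add]; exact Submodule.add_mem _ hx hy
  · intro k x hx; rw [map_smul]; exact Submodule.smul_mem _ _ hx

lemma hecke_smul_mem_withPow {p : Box lam → ℕ} (a : Hecke lam.card) {x : Model lam}
    (hx : x ∈ withPow p) : a • x ∈ withPow p := by
  induction a using Hecke.induction generalizing x with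
  | scalar r =>
    rw [algebraMap_smul]; exact Submodule.smul_mem _ _ hx
  | hT i => rw [hecke_T_smul]; exact opT_mem_withPow i hx
  | mul a b ha hb => rw [mul_smul]; exact ha (hb hx)
  | add a b ha hb => rw [add_smul]; exact Submodule.add_mem _ (ha hx) (hb hx)

end Model

end

end VVMac

namespace VVMac

noncomputable section

variable {lam : YoungDiagram}

namespace Model

/-! ### Standard tableaux in the model -/

lemma hinv_opT_mem_withPow (i : Fin (lam.card - 1)) {p : Box lam → ℕ} {x : Model lam}
    (hx : x ∈ withPow p) : hinv (opT i) x ∈ withPow p := by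
  rw [hinv, Algebra.algebraMap_eq_smul_one]
  exact Submodule.smul_mem _ _ (Submodule.add_mem _ (opT_mem_withPow i hx)
    (Submodule.smul_mem _ _ hx))

lemma hecke_hinv_T_smul (i : Fin (lam.card - 1)) (x : Model lam) :
    hinv (Hecke.T i : Hecke lam.card) • x = hinv (opT i) x := by
  rw [hecke_smul_def, map_hinv, Daha.ofHecke_T, rep_hinv, rep_T]

/-- With no powers of `q` the corner box has the smallest index. This makes `θ_1` the identity on
the standard part. -/
lemma _root_.VVMac.PSYT.c_zero {τ : PSYT lam} (hp : τ.pow = 0) (hn : 0 < lam.card) :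
    τ.c ⟨0, hn⟩ = 0 := by
  unfold PSYT.c
  set b := τ.idx.symm ⟨0, hn⟩ with hb
  set d := boxOf b 0 0 (Nat.zero_le _) (Nat.zero_le _) with hd
  have h : b = d := by
    by_contra hne
    have := τ.idx_lt_of_le (b := d) (b' := b) (Nat.zero_le _) (Nat.zero_le _) (Ne.symm hne)
      (by rw [hp]; rfl)
    rw [hb, Equiv.apply_symm_apply] at this
    exact absurd this (Nat.not_lt_zero _)
  rw [h]
  simp [content, hd, boxOf]

/-- On the standard part `θ_1` is the identity, and both families satisfy the same recursion. Hence
the standard part is a module pulled back along `ρ_n`, as the induced module requires. -/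
lemma jm_smul {k : ℕ} (hk : k < lam.card) {x : Model lam} (hx : x ∈ withPow 0) :
    Hecke.jm lam.card k • x = opθ ⟨k, hk⟩ x := by
  induction k generalizing x with
  | zero =>
    rw [Hecke.jm, one_smul]
    refine withPow_induction (P := fun x => x = opθ ⟨0, hk⟩ x) ?_ ?_ ?_ ?_ hx
    · intro τ hτ
      rw [opθ_single, PSYT.weight, PSYT.c_zero hτ hk, PSYT.w, hτ]
      simp
    · rw [map_zero]
    · intro x y hx hy; rw [map_add, ← hx, ← hy]
    · intro k x hx; rw [map_smul, ← hx]
  | succ k ih =>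
    have h : k < lam.card - 1 := by omega
    rw [Hecke.jm, dif_pos h, smul_assoc, mul_smul, mul_smul, hecke_hinv_T_smul, hecke_hinv_T_smul,
      ih (by omega) (hinv_opT_mem_withPow _ hx)]
    have e := opθ_hi (⟨k, h⟩ : Fin (lam.card - 1))
    exact (LinearMap.congr_fun e x).symm

lemma thetaBar_smul (i : Fin lam.card) {x : Model lam} (hx : x ∈ withPow 0) :
    (Hecke.thetaBar i : Hecke lam.card) • x = opθ i x := jm_smul i.2 hx

lemma t_hinv_opT (i : Fin (lam.card - 1)) (x : Model lam) :
    t • hinv (opT i) x = opT i x + (t - 1) • x :=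
  (LinearMap.congr_fun (add_smul_one_eq (R := Module.End K (Model lam)) (opT i)) x).symm

lemma syt_mem (S : SYT lam) : Finsupp.single S.toPSYT 1 ∈ withPow (0 : Box lam → ℕ) :=
  single_mem_withPow S.toPSYT

lemma phi_aux {k M : Type*} [CommRing k] [AddCommGroup M] [Module k M] {a b g r : k}
    (e : a * g - a * g + a * (r - 1) - a * (r - 1) = 0) (v w : M) :
    (g • a • v + a • w + (r - 1) • a • v) - (g • a • v + b • w + (r - 1) • a • v) =
      (a - b) • w := by
  linear_combination (norm := module) e • v

/-- The diagonal part of `t T_i⁻¹` cancels in the commutator, leaving the swapped vector times the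
difference of the two weights. -/
lemma phiBar_smul {i : Fin (lam.card - 1)} {S S' : SYT lam}
    (h : SwapUp i S.toPSYT S'.toPSYT) :
    (Hecke.phiBar i : Hecke lam.card) • (Finsupp.single S.toPSYT 1 : Model lam) =
      (t ^ S.toPSYT.c (lo i) - t ^ S.toPSYT.c (hi i)) • Finsupp.single S'.toPSYT 1 := by
  have hw : ∀ S : SYT lam, ∀ k, S.toPSYT.weight k = t ^ S.toPSYT.c k := fun S k => by
    rw [PSYT.weight, PSYT.w, show S.toPSYT.pow = fun _ => 0 from rfl, pow_zero, one_mul]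
  have hc : S'.toPSYT.c (lo i) = S.toPSYT.c (hi i) := by
    have := congrArg Prod.snd (h.1.u (lo i))
    rwa [Hecke.s_lo] at this
  rw [Hecke.phiBar, sub_smul, mul_smul, mul_smul, smul_assoc, smul_assoc, hecke_hinv_T_smul,
    thetaBar_smul _ (syt_mem S), hecke_hinv_T_smul, t_hinv_opT, t_hinv_opT,
    thetaBar_smul _ (Submodule.add_mem _ (opT_mem_withPow i (syt_mem S))
      (Submodule.smul_mem _ _ (syt_mem S)))]
  simp only [opT_single_of_up h, map_add, map_smul, opθ_single, hw, hc, smul_add]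
  rw [smul_comm (t ^ S.toPSYT.c (lo i)) (diag _ _)]
  exact phi_aux (by ring) _ _

end Model

/-! ### The map from the induced module to the model -/

open Model in
/-- The map from the Specht module to the model. -/
def spechtToModel (lam : YoungDiagram) : Specht lam →ₗ[Hecke lam.card] Model lam :=
  Submodule.liftQ _ (Finsupp.linearCombination (Hecke lam.card)
    fun S : SYT lam => (Finsupp.single S.toPSYT 1 : Model lam)) <| by
    rw [Submodule.span_le]
    rintro z ⟨x, y, h, rfl⟩
    rw [SetLike.mem_coe, LinearMap.mem_ker, map_sub, sub_eq_zero]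
    have hw : ∀ S : SYT lam, ∀ k, S.toPSYT.weight k = t ^ S.toPSYT.c k := fun S k => by
      rw [PSYT.weight, PSYT.w, show S.toPSYT.pow = fun _ => 0 from rfl, pow_zero, one_mul]
    have hlt : ∀ (S : SYT lam) (i : Fin (lam.card - 1)),
        S.idx (S.idx.symm (lo i)) < S.idx (S.idx.symm (hi i)) := fun S i => by
      rw [Equiv.apply_symm_apply, Equiv.apply_symm_apply]; exact Hecke.lo_lt_hi i
    cases h with
    | weight S i =>
      rw [map_smul, LinearMap.map_smul_of_tower, Finsupp.linearCombination_single, one_smul,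
        thetaBar_smul _ (syt_mem S), Model.opθ_single, hw]
    | swap S S' i h =>
      rw [map_smul, LinearMap.map_smul_of_tower, Finsupp.linearCombination_single,
        Finsupp.linearCombination_single, one_smul, one_smul, phiBar_smul h]
    | row S i h =>
      rw [map_smul, Finsupp.linearCombination_single, one_smul, hecke_T_smul]
      refine opT_single_of_sameRow ⟨rfl, h, ?_⟩
      -- The defining relation only places the boxes in one row; which is on the left follows from
      -- `i < i + 1`.
      by_contra hc
      refine lt_asymm (hlt S i) (S.row_strict _ _ ⟨h.symm, lt_of_le_of_ne (not_lt.mp hc) ?_⟩)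
      intro e
      exact (Hecke.lo_lt_hi i).ne (S.idx.symm.injective (box_ext h e.symm))
    | col S i h =>
      rw [map_smul, LinearMap.map_smul_of_tower, Finsupp.linearCombination_single, one_smul,
        hecke_T_smul]
      refine opT_single_of_sameCol ⟨rfl, h, ?_⟩
      by_contra hc
      refine lt_asymm (hlt S i) (S.col_strict _ _ ⟨h.symm, lt_of_le_of_ne (not_lt.mp hc) ?_⟩)
      intro e
      exact (Hecke.lo_lt_hi i).ne (S.idx.symm.injective (box_ext e.symm h))

lemma spechtToModel_of (S : SYT lam) :
    spechtToModel lam (Specht.of S) = Finsupp.single S.toPSYT 1 := by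
  unfold spechtToModel Specht.of
  erw [Submodule.liftQ_apply]
  rw [Finsupp.linearCombination_single, one_smul]

lemma specht_induction {P : Specht lam → Prop} (of : ∀ S, P (Specht.of S)) (zero : P 0)
    (add : ∀ x y, P x → P y → P (x + y)) (smul : ∀ (a : Hecke lam.card) x, P x → P (a • x))
    (v : Specht lam) : P v := by
  obtain ⟨x, rfl⟩ := Submodule.Quotient.mk_surjective _ v
  induction x using Finsupp.induction_linear with
  | zero => exact zero
  | add x y hx hy => exact add _ _ hx hy
  | single S a =>
    have : (Finsupp.single S a : SYT lam →₀ Hecke lam.card) = a • Finsupp.single S 1 := by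
      rw [Finsupp.smul_single, smul_eq_mul, mul_one]
    rw [this]
    exact smul a _ (of S)

lemma spechtToModel_mem (v : Specht lam) :
    spechtToModel lam v ∈ Model.withPow (0 : Box lam → ℕ) := by
  induction v using specht_induction with
  | of S => rw [spechtToModel_of]; exact Model.syt_mem S
  | zero => rw [map_zero]; exact Submodule.zero_mem _
  | add x y hx hy => rw [map_add]; exact Submodule.add_mem _ hx hy
  | smul a x hx => rw [map_smul]; exact Model.hecke_smul_mem_withPow a hx

lemma spechtToModel_rho (a : Aff lam.card) (v : Specht lam) :
    spechtToModel lam (Aff.rho _ a • v) = Daha.ofAff _ a • spechtToModel lam v := by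
  induction a using Aff.induction generalizing v with
  | scalar r =>
    rw [AlgHom.commutes, AlgHom.commutes, algebraMap_smul, algebraMap_smul,
      LinearMap.map_smul_of_tower]
  | hT i =>
    rw [Aff.rho_T, Daha.ofAff_T, map_smul, Model.hecke_T_smul, Model.smul_def, Model.rep_T]
  | hθ i =>
    rw [Aff.rho_θ, Daha.ofAff_θ, map_smul, Model.thetaBar_smul _ (spechtToModel_mem v),
      Model.smul_def, Model.rep_θ]
  | mul a b ha hb => rw [map_mul, map_mul, mul_smul, mul_smul, ha, hb]
  | add a b ha hb => rw [map_add, map_add, add_smul, add_smul, map_add, ha, hb]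

open scoped TensorProduct in
/-- The map from the induced module to the model. -/
def toModel (lam : YoungDiagram) : V lam →ₗ[Daha lam.card] Model lam :=
  Submodule.liftQ _ (TensorProduct.AlgebraTensorModule.lift
    ((LinearMap.id : Daha lam.card →ₗ[Daha lam.card] Daha lam.card).smulRight
      ((spechtToModel lam).restrictScalars K))) <| by
    rw [Submodule.span_le]
    rintro z ⟨a, v, rfl⟩
    rw [SetLike.mem_coe, LinearMap.mem_ker, map_sub, sub_eq_zero,
      TensorProduct.AlgebraTensorModule.lift_tmul, TensorProduct.AlgebraTensorModule.lift_tmul]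
    simp only [LinearMap.smulRight_apply, LinearMap.smul_apply, LinearMap.id_apply, one_smul,
      LinearMap.restrictScalars_apply]
    exact (spechtToModel_rho a v).symm

lemma toModel_oneTmul (v : Specht lam) : toModel lam (oneTmul v) = spechtToModel lam v := by
  unfold toModel oneTmul
  erw [Submodule.liftQ_apply]
  rw [TensorProduct.AlgebraTensorModule.lift_tmul]
  simp

lemma toModel_of (S : SYT lam) :
    toModel lam (oneTmul (Specht.of S)) = Finsupp.single S.toPSYT 1 := by
  rw [toModel_oneTmul, spechtToModel_of]

end

end VVMac

namespace VVMac

noncomputable section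

variable {lam : YoungDiagram}

/-! ### Generators of the Specht module -/

lemma specht_rel {x y : SYT lam →₀ Hecke lam.card} (h : SpechtRel lam x y) :
    (Submodule.Quotient.mk x : Specht lam) = Submodule.Quotient.mk y :=
  (Submodule.Quotient.eq _).mpr (Submodule.subset_span ⟨x, y, h, rfl⟩)

lemma thetaBar_smul_of (S : SYT lam) (i : Fin lam.card) :
    (Hecke.thetaBar i : Hecke lam.card) • Specht.of S = t ^ S.toPSYT.c i • Specht.of S :=
  specht_rel (SpechtRel.weight S i)

lemma phiBar_smul_of {S S' : SYT lam} {i : Fin (lam.card - 1)}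
    (h : SwapUp i S.toPSYT S'.toPSYT) : (Hecke.phiBar i : Hecke lam.card) • Specht.of S =
      (t ^ S.toPSYT.c (lo i) - t ^ S.toPSYT.c (hi i)) • Specht.of S' :=
  specht_rel (SpechtRel.swap S S' i h)

lemma T_smul_of_of_sameRow {S : SYT lam} {i : Fin (lam.card - 1)} (h : S.toPSYT.SameRow i) :
    (Hecke.T i : Hecke lam.card) • Specht.of S = Specht.of S :=
  specht_rel (SpechtRel.row S i h.2.1)

lemma T_smul_of_of_sameCol {S : SYT lam} {i : Fin (lam.card - 1)} (h : S.toPSYT.SameCol i) :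
    (Hecke.T i : Hecke lam.card) • Specht.of S = -t • Specht.of S :=
  specht_rel (SpechtRel.col S i h.2.1)

lemma Hecke.t_hinv_T {n : ℕ} (i : Fin (n - 1)) :
    t • hinv (Hecke.T i : Hecke n) = Hecke.T i + (t - 1) • 1 :=
  (add_smul_one_eq _).symm

lemma Hecke.thetaBar_lo_mul {n : ℕ} (i : Fin (n - 1)) :
    (Hecke.thetaBar (lo i) : Hecke n) * (t • hinv (Hecke.T i)) =
      Hecke.T i * Hecke.thetaBar (hi i) := by
  rw [Hecke.thetaBar_step, mul_smul_comm, mul_smul_comm, ← mul_assoc, ← mul_assoc,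
    mul_hinv (Hecke.quad i), one_mul]

lemma sub_smul_aux {k M : Type*} [CommRing k] [AddCommGroup M] [Module k M] {a b c r : k}
    {v w y : M} (h : a • (w + (r - 1) • v) - b • w = c • y) :
    (a - b) • w = c • y - ((r - 1) * a) • v := by
  linear_combination (norm := module) h

/-- Because `θ̄_i (t T_i⁻¹) = T_i θ̄_{i+1}`, the relation for `φ̄_i` becomes a linear equation for
`T_i τ`. Its leading coefficient is a difference of distinct powers of `t` and can be divided out.
-/
lemma T_smul_of_of_swapUp {S S' : SYT lam} {i : Fin (lam.card - 1)}
    (h : SwapUp i S.toPSYT S'.toPSYT) :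
    ∃ r : K, (Hecke.T i : Hecke lam.card) • Specht.of S = Specht.of S' + r • Specht.of S := by
  have h1 := phiBar_smul_of h
  have e1 : (t • hinv (Hecke.T i : Hecke lam.card)) • Specht.of S =
      (Hecke.T i : Hecke lam.card) • Specht.of S + (t - 1) • Specht.of S := by
    rw [Hecke.t_hinv_T, add_smul, smul_assoc, one_smul]
  have e2 : ((t • hinv (Hecke.T i)) * Hecke.thetaBar (lo i) : Hecke lam.card) • Specht.of S =
      t ^ S.toPSYT.c (lo i) • (t • hinv (Hecke.T i : Hecke lam.card)) • Specht.of S := by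
    rw [mul_smul, thetaBar_smul_of]
    exact smul_comm _ _ _
  have e3 : (Hecke.thetaBar (lo i) * (t • hinv (Hecke.T i)) : Hecke lam.card) • Specht.of S =
      t ^ S.toPSYT.c (hi i) • (Hecke.T i : Hecke lam.card) • Specht.of S := by
    rw [Hecke.thetaBar_lo_mul, mul_smul, thetaBar_smul_of]
    exact smul_comm _ _ _
  rw [Hecke.phiBar, sub_smul, e2, e3, e1] at h1
  have h2 := sub_smul_aux h1
  have h3 : t ^ S.toPSYT.c (lo i) - t ^ S.toPSYT.c (hi i) ≠ 0 := by
    have := val_sub_ne_zero (S.toPSYT.u_lo_ne_u_hi i)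
    simpa [val, PSYT.u, PSYT.w, SYT.toPSYT] using this
  refine ⟨-((t ^ S.toPSYT.c (lo i) - t ^ S.toPSYT.c (hi i))⁻¹ *
    ((t - 1) * t ^ S.toPSYT.c (lo i))), ?_⟩
  rw [← inv_smul_smul₀ h3 ((Hecke.T i : Hecke lam.card) • Specht.of S), h2, smul_sub,
    inv_smul_smul₀ h3, smul_smul, neg_smul, sub_eq_add_neg]

lemma exists_syt_of_isSwap {S : SYT lam} {i : Fin (lam.card - 1)} {τ' : PSYT lam}
    (h : IsSwap i S.toPSYT τ') : ∃ S' : SYT lam, S'.toPSYT = τ' :=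
  ⟨τ'.toSYT fun b => by rw [h.1]; rfl, τ'.toSYT_toPSYT _⟩

/-- The `K`-span is stable under every `T_i`. Upward swaps are given directly, and for a downward
swap `τ` is expressed through `T_i τ'` and `τ'`, after which the quadratic relation applies. -/
lemma specht_span : Submodule.span K (Set.range (Specht.of (lam := lam))) = ⊤ := by
  set N := Submodule.span K (Set.range (Specht.of (lam := lam))) with hN
  have hof : ∀ S, Specht.of S ∈ N := fun S => Submodule.subset_span ⟨S, rfl⟩
  have hT : ∀ (i : Fin (lam.card - 1)) (v : Specht lam), v ∈ N →
      (Hecke.T i : Hecke lam.card) • v ∈ N := by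
    intro i v hv
    induction hv using Submodule.span_induction with
    | mem x hx =>
      obtain ⟨S, rfl⟩ := hx
      by_cases h1 : S.toPSYT.SameRow i
      · rw [T_smul_of_of_sameRow h1]; exact hof S
      by_cases h2 : S.toPSYT.SameCol i
      · rw [T_smul_of_of_sameCol h2]; exact N.smul_mem _ (hof S)
      obtain ⟨τ', h⟩ := PSYT.exists_swap h1 h2
      obtain ⟨S', rfl⟩ := exists_syt_of_isSwap h
      rcases h.up_or_up with h' | h'
      · obtain ⟨r, hr⟩ := T_smul_of_of_swapUp h'
        rw [hr]
        exact N.add_mem (hof S') (N.smul_mem _ (hof S))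
      · obtain ⟨r, hr⟩ := T_smul_of_of_swapUp h'
        have h3 : (Hecke.T i : Hecke lam.card) • (Hecke.T i : Hecke lam.card) • Specht.of S' =
            (1 - t) • (Hecke.T i : Hecke lam.card) • Specht.of S' + t • Specht.of S' := by
          rw [← mul_smul, Hecke.T_mul_T, add_smul, smul_assoc, smul_assoc, one_smul]
        have h4 : Specht.of S = (Hecke.T i : Hecke lam.card) • Specht.of S' - r • Specht.of S' := by
          rw [hr, add_sub_cancel_right]
        have h5 : (Hecke.T i : Hecke lam.card) • Specht.of S' ∈ N := by
          rw [hr]; exact N.add_mem (hof S) (N.smul_mem _ (hof S'))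
        rw [h4, smul_sub, h3, smul_comm (Hecke.T i)]
        exact N.sub_mem (N.add_mem (N.smul_mem _ h5) (N.smul_mem _ (hof S'))) (N.smul_mem _ h5)
    | zero => rw [smul_zero]; exact N.zero_mem
    | add x y _ _ hx hy => rw [smul_add]; exact N.add_mem hx hy
    | smul k x _ hx => rw [smul_comm]; exact N.smul_mem _ hx
  have hH : ∀ (a : Hecke lam.card) (v : Specht lam), v ∈ N → a • v ∈ N := by
    intro a
    induction a using Hecke.induction with
    | scalar r => intro v hv; rw [algebraMap_smul]; exact N.smul_mem _ hv
    | hT i => exact hT i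
    | mul a b ha hb => intro v hv; rw [mul_smul]; exact ha _ (hb v hv)
    | add a b ha hb => intro v hv; rw [add_smul]; exact N.add_mem (ha v hv) (hb v hv)
  rw [eq_top_iff]
  rintro v -
  induction v using specht_induction with
  | of S => exact hof S
  | zero => exact N.zero_mem
  | add x y hx hy => exact N.add_mem hx hy
  | smul a x hx => exact hH a x hx

/-! ### Generators of the induced module -/

open scoped TensorProduct in
/-- The map `v ↦ 1 ⊗ v`. -/
def oneTmulLin (lam : YoungDiagram) : Specht lam →ₗ[K] V lam :=
  ((Submodule.mkQ (Submodule.span (Daha lam.card)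
      {z : Daha lam.card ⊗[K] Specht lam | ∃ (a : Aff lam.card) (v : Specht lam),
        z = Daha.ofAff lam.card a ⊗ₜ[K] v - 1 ⊗ₜ[K] (Aff.rho lam.card a • v)})).restrictScalars K) ∘ₗ
    TensorProduct.mk K (Daha lam.card) (Specht lam) 1

lemma oneTmulLin_apply (v : Specht lam) : oneTmulLin lam v = oneTmul v := rfl

lemma ofAff_smul_oneTmul (a : Aff lam.card) (v : Specht lam) :
    Daha.ofAff _ a • oneTmul v = oneTmul (Aff.rho _ a • v) := by
  have : Daha.ofAff _ a • oneTmul v =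
      (Submodule.Quotient.mk (TensorProduct.tmul K (Daha.ofAff _ a) v) : V lam) := by
    unfold oneTmul
    rw [← Submodule.Quotient.mk_smul, TensorProduct.smul_tmul', smul_eq_mul, mul_one]
  rw [this]
  exact (Submodule.Quotient.eq _).mpr (Submodule.subset_span ⟨a, v, rfl⟩)

lemma V_induction {P : V lam → Prop} (one : ∀ v, P (oneTmul v)) (zero : P 0)
    (add : ∀ x y, P x → P y → P (x + y)) (smul : ∀ (d : Daha lam.card) x, P x → P (d • x))
    (x : V lam) : P x := by
  obtain ⟨y, rfl⟩ := Submodule.Quotient.mk_surjective _ x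
  induction y using TensorProduct.induction_on with
  | zero => exact zero
  | add x y hx hy => exact add _ _ hx hy
  | tmul d v =>
    have : TensorProduct.tmul K d v = d • TensorProduct.tmul K (1 : Daha lam.card) v := by
      rw [TensorProduct.smul_tmul', smul_eq_mul, mul_one]
    rw [this, Submodule.Quotient.mk_smul]
    exact smul d _ (one v)

namespace Daha

variable {n : ℕ}

lemma mk_rel {a b : FreeAlgebra K (DahaGen n)} (h : DahaRel n a b) : mk n a = mk n b :=
  RingQuot.mkAlgHom_rel K h

lemma ofHecke_quad (i : Fin (n - 1)) : (T i - 1) * (T i + algebraMap K (Daha n) t) = 0 := by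
  have := congrArg (ofHecke n) (Hecke.quad i)
  simpa only [map_mul, map_sub, map_add, map_one, map_zero, AlgHom.commutes, ofHecke_T] using this

lemma X_comm (i j : Fin n) : X i * X j = X j * X i := by
  have := mk_rel (DahaRel.comm i j)
  rwa [map_mul, map_mul] at this

lemma X_hi (i : Fin (n - 1)) : X (hi i) = t • (hinv (T i) * X (lo i) * hinv (T i)) := by
  have := mk_rel (DahaRel.step i)
  simp only [map_mul, map_smul, map_hinv] at this
  exact this

lemma T_mul_X {i : Fin (n - 1)} {j : Fin n} (h1 : j ≠ lo i) (h2 : j ≠ hi i) :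
    T i * X j = X j * T i := by
  have := mk_rel (DahaRel.far i j h1 h2)
  rwa [map_mul, map_mul] at this

lemma pi_mul_X (hn : 0 < n) (i : Fin (n - 1)) : pi hn * X (lo i) = X (hi i) * pi hn := by
  have := mk_rel (DahaRel.pi hn i)
  rwa [map_mul, map_mul, map_piOf] at this

lemma pi_mul_X_last (hn : 0 < n) : pi hn * X ⟨n - 1, Nat.sub_lt hn Nat.one_pos⟩ =
    q • (X ⟨0, hn⟩ * pi hn) := by
  have := mk_rel (DahaRel.pi_last hn)
  rwa [map_smul, map_mul, map_mul, map_piOf] at this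

lemma t_hinv_T (i : Fin (n - 1)) : t • hinv (T i : Daha n) = T i + (t - 1) • 1 :=
  (add_smul_one_eq _).symm

lemma T_mul_X_hi (i : Fin (n - 1)) :
    T i * X (hi i) = X (lo i) * T i + (t - 1) • X (lo i) := by
  rw [X_hi, mul_smul_comm, ← mul_assoc, ← mul_assoc, mul_hinv (ofHecke_quad i), one_mul,
    ← mul_smul_comm, t_hinv_T, mul_add, mul_smul_comm, mul_one]

lemma T_mul_X_lo (i : Fin (n - 1)) :
    T i * X (lo i) = X (hi i) * T i - (t - 1) • X (lo i) := by
  have h : X (hi i) * T i = (t • hinv (T i)) * X (lo i) := by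
    rw [X_hi, smul_mul_assoc, mul_assoc, hinv_mul (ofHecke_quad i), mul_one, smul_mul_assoc]
  rw [h, t_hinv_T, add_mul, smul_mul_assoc, one_mul, add_sub_cancel_right]

lemma θ_hi (i : Fin (n - 1)) : θ (hi i) = t • (hinv (T i) * θ (lo i) * hinv (T i)) := by
  have := mk_rel (DahaRel.aff (AffRel.step i))
  simp only [map_mul, map_smul, map_hinv] at this
  exact this

lemma ofAff_pi (hn : 0 < n) : ofAff n (piOf hn Aff.T Aff.θ) = pi hn := by
  rw [map_piOf]
  simp only [ofAff_T, ofAff_θ]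
  rfl

lemma X_pow_pairwise (a b : Fin n → ℕ) : ((Finset.univ : Finset (Fin n)) : Set (Fin n)).Pairwise
    fun i j => Commute ((X i : Daha n) ^ a i) (X j ^ b j) :=
  fun i _ j _ _ => (show Commute (X i) (X j) from X_comm i j).pow_pow _ _

/-- The monomial `X ^ a`. -/
def Xmon (a : Fin n → ℕ) : Daha n :=
  Finset.univ.noncommProd (fun i => X i ^ a i) (X_pow_pairwise a a)

lemma Xmon_zero : Xmon (0 : Fin n → ℕ) = 1 := by
  exact (Finset.noncommProd_eq_pow_card _ _ _ 1 (fun _ _ => pow_zero _)).trans (one_pow _)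

lemma Xmon_add (a b : Fin n → ℕ) : Xmon (a + b) = Xmon a * Xmon b := by
  refine Eq.trans ?_ (Finset.noncommProd_mul_distrib (s := Finset.univ)
    (fun i => (X i : Daha n) ^ a i) (fun i => X i ^ b i) (X_pow_pairwise a a)
    (X_pow_pairwise b b) (X_pow_pairwise b a))
  exact Finset.noncommProd_congr rfl (fun i _ => pow_add _ _ _) _

lemma Xmon_single (j : Fin n) : Xmon (Pi.single j 1) = X j := by
  have h1 : ∀ i ∈ Finset.univ.erase j, (X i : Daha n) ^ (Pi.single j 1 : Fin n → ℕ) i = 1 := by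
    intro i hi
    rw [Pi.single_eq_of_ne (Finset.ne_of_mem_erase hi), pow_zero]
  refine (Finset.mul_noncommProd_erase _ (Finset.mem_univ j) _ _).symm.trans ?_
  refine (congrArg _ (Finset.noncommProd_eq_pow_card _ _ _ 1 h1)).trans ?_
  rw [one_pow, mul_one, Pi.single_eq_same, pow_one]

end Daha

lemma exists_eq_single_add {n : ℕ} {a : Fin n → ℕ} {d : ℕ} (h : ∑ i, a i = d + 1) :
    ∃ (j : Fin n) (b : Fin n → ℕ), a = Pi.single j 1 + b ∧ ∑ i, b i = d := by
  obtain ⟨j, -, hj⟩ : ∃ j ∈ Finset.univ, a j ≠ 0 := by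
    apply Finset.exists_ne_zero_of_sum_ne_zero
    omega
  have e : a = Pi.single j 1 + (a - Pi.single j 1) := by
    funext i
    by_cases hij : i = j
    · subst hij; simp; omega
    · simp [hij]
  refine ⟨j, a - Pi.single j 1, e, ?_⟩
  have h2 : ∑ i, a i = ∑ i, ((Pi.single j 1 : Fin n → ℕ) i + (a - Pi.single j 1 : Fin n → ℕ) i) :=
    Finset.sum_congr rfl fun i _ => congrFun e i
  rw [Finset.sum_add_distrib, Finset.sum_pi_single', if_pos (Finset.mem_univ j)] at h2
  omega

/-- The spanning family `X ^ a ⊗ τ`. -/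
def spanFamily (x : SYT lam × (Fin lam.card → ℕ)) : V lam :=
  Daha.Xmon x.2 • oneTmul (Specht.of x.1)

/-- This is the spanning half of a Poincaré–Birkhoff–Witt statement. The `X_j` visibly preserve the
span, `T_i` and `π_n` can be pushed to the right through the `X_j`, and the `θ_i` are recovered from
`π_n` and the `T_i`. -/
lemma span_spanFamily : Submodule.span K (Set.range (spanFamily (lam := lam))) = ⊤ := by
  set N := Submodule.span K (Set.range (spanFamily (lam := lam))) with hN
  have hX : ∀ j, ∀ x ∈ N, (Daha.X j : Daha lam.card) • x ∈ N := by
    intro j x hx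
    induction hx using Submodule.span_induction with
    | mem x hx =>
      obtain ⟨⟨S, a⟩, rfl⟩ := hx
      refine Submodule.subset_span ⟨(S, Pi.single j 1 + a), ?_⟩
      simp only [spanFamily]
      rw [Daha.Xmon_add, Daha.Xmon_single, mul_smul]
    | zero => rw [smul_zero]; exact N.zero_mem
    | add x y _ _ hx hy => rw [smul_add]; exact N.add_mem hx hy
    | smul k x _ hx => rw [smul_comm]; exact N.smul_mem _ hx
  have hone : ∀ v : Specht lam, oneTmul v ∈ N := by
    intro v
    have hv : v ∈ Submodule.span K (Set.range (Specht.of (lam := lam))) := by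
      rw [specht_span]; trivial
    rw [← oneTmulLin_apply]
    induction hv using Submodule.span_induction with
    | mem x hx =>
      obtain ⟨S, rfl⟩ := hx
      refine Submodule.subset_span ⟨(S, 0), ?_⟩
      simp only [spanFamily]
      rw [Daha.Xmon_zero, one_smul, oneTmulLin_apply]
    | zero => rw [map_zero]; exact N.zero_mem
    | add x y _ _ hx hy => rw [map_add]; exact N.add_mem hx hy
    | smul k x _ hx => rw [map_smul]; exact N.smul_mem _ hx
  -- Induction on the degree of the monomial: moving `T_i` or `π_n` past one `X_j` leaves a monomial
  -- of lower degree, and in degree zero both act through `ρ_n`.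
  have hgood : ∀ x ∈ N, (∀ i, (Daha.T i : Daha lam.card) • x ∈ N) ∧
      ∀ hn, (Daha.pi hn : Daha lam.card) • x ∈ N := by
    have hstep : ∀ j x, x ∈ N → ((∀ i, (Daha.T i : Daha lam.card) • x ∈ N) ∧
        ∀ hn, (Daha.pi hn : Daha lam.card) • x ∈ N) →
        (∀ i, (Daha.T i : Daha lam.card) • (Daha.X j : Daha lam.card) • x ∈ N) ∧
          ∀ hn, (Daha.pi hn : Daha lam.card) • (Daha.X j : Daha lam.card) • x ∈ N := by
      rintro j x hx ⟨h1, h2⟩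
      constructor
      · intro i
        rw [← mul_smul]
        by_cases hl : j = lo i
        · rw [hl, Daha.T_mul_X_lo, sub_smul, mul_smul, smul_assoc]
          exact N.sub_mem (hX _ _ (h1 i)) (N.smul_mem _ (hX _ _ hx))
        by_cases hh : j = hi i
        · rw [hh, Daha.T_mul_X_hi, add_smul, mul_smul, smul_assoc]
          exact N.add_mem (hX _ _ (h1 i)) (N.smul_mem _ (hX _ _ hx))
        rw [Daha.T_mul_X hl hh, mul_smul]
        exact hX _ _ (h1 i)
      · intro hn
        rw [← mul_smul]
        by_cases hj : j.1 < lam.card - 1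
        · have e : j = lo ⟨j.1, hj⟩ := rfl
          rw [e, Daha.pi_mul_X, mul_smul]
          exact hX _ _ (h2 hn)
        · have e : j = ⟨lam.card - 1, Nat.sub_lt hn Nat.one_pos⟩ := Fin.ext (by
            have := j.2; simp only; omega)
          rw [e, Daha.pi_mul_X_last, smul_assoc, mul_smul]
          exact N.smul_mem _ (hX _ _ (h2 hn))
    have hmon : ∀ d, ∀ a : Fin lam.card → ℕ, ∑ i, a i = d → ∀ S : SYT lam,
        (∀ i, (Daha.T i : Daha lam.card) • spanFamily (S, a) ∈ N) ∧
          ∀ hn, (Daha.pi hn : Daha lam.card) • spanFamily (S, a) ∈ N := by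
      intro d
      induction d with
      | zero =>
        intro a ha S
        have : a = 0 := by
          funext i
          exact (Finset.sum_eq_zero_iff.mp ha) i (Finset.mem_univ i)
        subst this
        simp only [spanFamily, Daha.Xmon_zero, one_smul]
        constructor
        · intro i
          rw [← Daha.ofAff_T, ofAff_smul_oneTmul]
          exact hone _
        · intro hn
          rw [← Daha.ofAff_pi, ofAff_smul_oneTmul]
          exact hone _
      | succ d ih =>
        intro a ha S
        obtain ⟨j, b, rfl, hb⟩ := exists_eq_single_add ha
        have e : spanFamily (S, Pi.single j 1 + b) =
            (Daha.X j : Daha lam.card) • spanFamily (S, b) := by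
          simp only [spanFamily]
          rw [Daha.Xmon_add, Daha.Xmon_single, mul_smul]
        rw [e]
        exact hstep j _ (Submodule.subset_span ⟨_, rfl⟩) (ih b hb S)
    intro x hx
    induction hx using Submodule.span_induction with
    | mem x hx =>
      obtain ⟨⟨S, a⟩, rfl⟩ := hx
      exact hmon _ a rfl S
    | zero => simp only [smul_zero]; exact ⟨fun _ => N.zero_mem, fun _ => N.zero_mem⟩
    | add x y _ _ hx hy =>
      simp only [smul_add]
      exact ⟨fun i => N.add_mem (hx.1 i) (hy.1 i), fun hn => N.add_mem (hx.2 hn) (hy.2 hn)⟩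
    | smul k x _ hx =>
      refine ⟨fun i => ?_, fun hn => ?_⟩
      · rw [smul_comm]; exact N.smul_mem _ (hx.1 i)
      · rw [smul_comm]; exact N.smul_mem _ (hx.2 hn)
  have hS : ∀ i, ∀ x ∈ N, hinv (Daha.T i : Daha lam.card) • x ∈ N := by
    intro i x hx
    rw [hinv, smul_assoc, add_smul, algebraMap_smul]
    exact N.smul_mem _ (N.add_mem ((hgood x hx).1 i) (N.smul_mem _ hx))
  have hprod : ∀ l : List (Fin (lam.card - 1)), ∀ x ∈ N, ∃ y ∈ N,
      (l.map fun i => hinv (Daha.T i : Daha lam.card)).prod • y = x := by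
    intro l
    induction l with
    | nil => intro x hx; exact ⟨x, hx, by simp⟩
    | cons i l ih =>
      intro x hx
      obtain ⟨y, hy, hy'⟩ := ih _ ((hgood x hx).1 i)
      refine ⟨y, hy, ?_⟩
      rw [List.map_cons, List.prod_cons, mul_smul, hy', ← mul_smul, hinv_mul (Daha.ofHecke_quad i),
        one_smul]
  have hθ : ∀ k (hk : k < lam.card), ∀ x ∈ N, (Daha.θ ⟨k, hk⟩ : Daha lam.card) • x ∈ N := by
    intro k
    induction k with
    | zero =>
      intro hk x hx
      -- Writing `x` as `T_1⁻¹ ⋯ T_{n-1}⁻¹ y` turns `θ_1 x` into a multiple of `π_n y`.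
      obtain ⟨y, hy, rfl⟩ := hprod (List.ofFn id) x hx
      have e : (t ^ (lam.card - 1))⁻¹ • (Daha.pi hk : Daha lam.card) = Daha.θ ⟨0, hk⟩ *
          ((List.ofFn id).map fun i => hinv (Daha.T i : Daha lam.card)).prod := by
        rw [Daha.pi, piOf, smul_smul, inv_mul_cancel₀ (pow_ne_zero _ t_ne_zero), one_smul,
          List.map_ofFn]
        rfl
      rw [← mul_smul, ← e, smul_assoc]
      exact N.smul_mem _ ((hgood y hy).2 hk)
    | succ k ih =>
      intro hk x hx
      have e := Daha.θ_hi (⟨k, by omega⟩ : Fin (lam.card - 1))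
      have e' : (hi (⟨k, by omega⟩ : Fin (lam.card - 1))) = ⟨k + 1, hk⟩ := rfl
      rw [e'] at e
      rw [e, smul_assoc, mul_smul, mul_smul]
      exact N.smul_mem _ (hS _ _ (ih (by omega) _ (hS _ _ hx)))
  have hD : ∀ (d : Daha lam.card), ∀ x ∈ N, d • x ∈ N := by
    intro d
    induction d using Daha.induction with
    | scalar r => intro v hv; rw [algebraMap_smul]; exact N.smul_mem _ hv
    | hT i => exact fun x hx => (hgood x hx).1 i
    | hθ i => exact hθ i.1 i.2
    | hX i => exact hX i
    | mul a b ha hb => intro v hv; rw [mul_smul]; exact ha _ (hb v hv)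
    | add a b ha hb => intro v hv; rw [add_smul]; exact N.add_mem (ha v hv) (hb v hv)
  rw [eq_top_iff]
  rintro x -
  induction x using V_induction with
  | one v => exact hone v
  | zero => exact N.zero_mem
  | add x y hx hy => exact N.add_mem hx hy
  | smul d x hx => exact hD d x hx

end

end VVMac

namespace VVMac

noncomputable section

/-! ### The induced module is the model -/

/-- In each degree the source is finite-dimensional and, through `e`, its dimension is at most that
of the target. A surjection between the graded pieces is then injective. -/
lemma injective_of_graded {k A B : Type*} [Field k] {dA : A → ℕ} {dB : B → ℕ} {e : A → B}
    (he : Function.Injective e) (hd : ∀ a, dB (e a) = dA a)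
    (hfin : ∀ d, Finite {a // dA a = d}) (G : (A →₀ k) →ₗ[k] (B →₀ k))
    (hG : ∀ a, G (Finsupp.single a 1) ∈ Finsupp.supported k k {b | dB b = dA a})
    (hs : Function.Surjective G) : Function.Injective G := by
  classical
  let rA : ∀ d, (A →₀ k) →ₗ[k] ({a // dA a = d} →₀ k) := fun d =>
    Finsupp.lsubtypeDomain {a | dA a = d}
  let rB : ∀ d, (B →₀ k) →ₗ[k] ({b // dB b = d} →₀ k) := fun d =>
    Finsupp.lsubtypeDomain {b | dB b = d}
  let g : ∀ d, ({a // dA a = d} →₀ k) →ₗ[k] ({b // dB b = d} →₀ k) := fun d =>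
    rB d ∘ₗ G ∘ₗ Finsupp.lmapDomain k k Subtype.val
  have hrA : ∀ d x a, rA d x a = x a.1 := fun _ _ _ => rfl
  have hrB : ∀ d x b, rB d x b = x b.1 := fun _ _ _ => rfl
  -- Since `G` preserves degrees, it commutes with restriction to coordinates of degree `d`.
  have hg : ∀ d x, rB d (G x) = g d (rA d x) := by
    intro d x
    suffices h : rB d ∘ₗ G = g d ∘ₗ rA d from LinearMap.congr_fun h x
    ext1 a
    ext1
    simp only [LinearMap.comp_apply, Finsupp.lsingle_apply]
    by_cases ha : dA a = d
    · have h1 : rA d (Finsupp.single a 1) = Finsupp.single ⟨a, ha⟩ 1 := by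
        ext ⟨a', ha'⟩
        rw [hrA]
        simp only [Finsupp.single_apply, Subtype.mk.injEq]
      rw [h1]
      simp only [g, LinearMap.comp_apply, Finsupp.lmapDomain_apply, Finsupp.mapDomain_single]
    · have h1 : rA d (Finsupp.single a 1) = 0 := by
        ext ⟨a', ha'⟩
        have : a ≠ a' := fun h => ha (h ▸ ha')
        rw [hrA]
        simp only [Finsupp.single_apply, this, if_false, Finsupp.coe_zero, Pi.zero_apply]
      rw [h1, map_zero]
      ext ⟨b, hb⟩
      rw [hrB, Finsupp.coe_zero, Pi.zero_apply]
      exact (Finsupp.mem_supported' k _).mp (hG a) b fun h => ha (h.symm.trans hb)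
  have hsd : ∀ d, Function.Surjective (g d) := by
    intro d y
    obtain ⟨x, hx⟩ := hs (Finsupp.lmapDomain k k Subtype.val y)
    refine ⟨rA d x, ?_⟩
    rw [← hg, hx]
    ext ⟨b, hb⟩
    rw [hrB]
    exact Finsupp.mapDomain_apply Subtype.val_injective y ⟨b, hb⟩
  have hid : ∀ d, Function.Injective (g d) := by
    intro d
    have := hfin d
    have hfinB : Module.Finite k ({b // dB b = d} →₀ k) := Module.Finite.of_surjective _ (hsd d)
    let ι : {a // dA a = d} → {b // dB b = d} := fun a => ⟨e a.1, (hd a.1).trans a.2⟩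
    have hι : Function.Injective ι := fun a a' h => Subtype.ext (he (congrArg Subtype.val h))
    exact OrzechProperty.injective_of_surjective_of_injective (Finsupp.lmapDomain k k ι) (g d)
      (Finsupp.mapDomain_injective hι) (hsd d)
  rw [injective_iff_map_eq_zero]
  intro x hx
  ext a
  have h1 : rA (dA a) x = 0 := by
    apply hid
    rw [← hg, hx, map_zero, map_zero]
  exact DFunLike.congr_fun h1 ⟨a, rfl⟩

variable {lam : YoungDiagram}

namespace Model

/-- The span of the tableaux whose exponents have sum `d`. -/
def homog (lam : YoungDiagram) (d : ℕ) : Submodule K (Model lam) :=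
  Finsupp.supported K K {τ | τ.deg = d}

lemma single_mem_homog (τ : PSYT lam) : Finsupp.single τ 1 ∈ homog lam τ.deg :=
  Finsupp.single_mem_supported K 1 rfl

/-- `f` raises degrees by `k`. -/
def Raises (f : Module.End K (Model lam)) (k : ℕ) : Prop :=
  ∀ d, ∀ x ∈ homog lam d, f x ∈ homog lam (d + k)

lemma raises_of_single {f : Module.End K (Model lam)} {k : ℕ}
    (h : ∀ τ : PSYT lam, f (Finsupp.single τ 1) ∈ homog lam (τ.deg + k)) : Raises f k := by
  intro d x hx
  rw [homog, Finsupp.supported_eq_span_single] at hx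
  induction hx using Submodule.span_induction with
  | mem x hx => obtain ⟨τ, rfl, rfl⟩ := hx; exact h τ
  | zero => rw [map_zero]; exact Submodule.zero_mem _
  | add x y _ _ hx hy => rw [map_add]; exact Submodule.add_mem _ hx hy
  | smul k x _ hx => rw [map_smul]; exact Submodule.smul_mem _ _ hx

lemma Raises.mul {f g : Module.End K (Model lam)} {k l : ℕ} (hf : Raises f k)
    (hg : Raises g l) : Raises (f * g) (l + k) := fun d x hx => by
  rw [← add_assoc]
  exact hf _ _ (hg _ _ hx)

lemma Raises.smul {f : Module.End K (Model lam)} {k : ℕ} (hf : Raises f k) (r : K) :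
    Raises (r • f) k := fun d x hx => Submodule.smul_mem _ _ (hf d x hx)

lemma Raises.hinv {f : Module.End K (Model lam)} (hf : Raises f 0) :
    Raises (VVMac.hinv f) 0 := fun d x hx => by
  have e : VVMac.hinv f x = t⁻¹ • (f x + (t - 1) • x) := rfl
  rw [e]
  exact Submodule.smul_mem _ _ (Submodule.add_mem _ (hf d x hx) (Submodule.smul_mem _ _ hx))

lemma raises_opT (i : Fin (lam.card - 1)) : Raises (opT (lam := lam) i) 0 := by
  refine raises_of_single fun τ => ?_
  rw [opT_single]
  refine Submodule.add_mem _ (Submodule.smul_mem _ _ (single_mem_homog τ))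
    (Submodule.smul_mem _ _ ?_)
  have : τ.deg = (τ.swap i).deg := by rw [PSYT.deg, PSYT.deg, pow_swap]
  rw [add_zero, this]
  exact single_mem_homog _

lemma raises_natT (k : ℕ) : Raises (natT lam k) 0 := by
  unfold natT
  split_ifs
  · exact raises_opT _
  · exact fun d x hx => Submodule.zero_mem _

lemma raises_opω (hn : 0 < lam.card) : Raises (opω hn) 1 := by
  refine raises_of_single fun τ => ?_
  rw [opω_single, ← PSYT.deg_Psi hn]
  exact Submodule.smul_mem _ _ (single_mem_homog _)

lemma raises_up_natT (k : ℕ) : Raises (up (natT lam) k) 0 := by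
  induction k with
  | zero => exact fun d x hx => hx
  | succ k ih => exact ih.mul (raises_natT k)

lemma raises_x (hn : 0 < lam.card) (k : ℕ) : Raises ((isExtended hn).x k) 1 := by
  induction k with
  | zero => exact (raises_up_natT _).mul (raises_opω hn)
  | succ k ih =>
    exact (((raises_natT k).hinv.mul ih).mul (raises_natT k).hinv).smul t

lemma raises_rep_X (j : Fin lam.card) : Raises (rep lam (Daha.X j)) 1 := by
  rw [rep_X, opX_eq (lt_of_le_of_lt (Nat.zero_le _) j.2)]
  exact raises_x _ _

end Model

lemma toModel_spanFamily_mem (x : SYT lam × (Fin lam.card → ℕ)) :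
    toModel lam (spanFamily x) ∈ Model.homog lam (∑ i, x.2 i) := by
  obtain ⟨S, a⟩ := x
  induction h : ∑ i, a i generalizing a with
  | zero =>
    have : a = 0 := by
      funext i
      exact (Finset.sum_eq_zero_iff.mp h) i (Finset.mem_univ i)
    subst this
    rw [spanFamily, Daha.Xmon_zero, one_smul, toModel_of]
    have hd : S.toPSYT.deg = 0 := Finset.sum_eq_zero fun _ _ => rfl
    rw [← hd]
    exact Model.single_mem_homog _
  | succ d ih =>
    obtain ⟨j, b, rfl, hb⟩ := exists_eq_single_add h
    have := Model.raises_rep_X j _ _ (ih b hb)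
    have e : spanFamily (S, Pi.single j 1 + b) = Daha.X j • spanFamily (S, b) := by
      rw [spanFamily, spanFamily, Daha.Xmon_add, Daha.Xmon_single, mul_smul]
    rw [e, map_smul, Model.smul_def]
    exact this

lemma Model.hinv_natT_mem {k : ℕ} (hk : k < lam.card - 1)
    (R : Submodule (Daha lam.card) (Model lam)) {x : Model lam} (hx : x ∈ R) :
    hinv (Model.natT lam k) x ∈ R := by
  have h := R.smul_mem (hinv (Daha.T ⟨k, hk⟩)) hx
  rwa [Model.smul_def, Model.rep_hinv, Model.rep_T, ← Model.natT_of_lt hk] at h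

/-- Although `ω` is not a generator, it acts as `(T_1 ⋯ T_{n-1})⁻¹ X_1`. -/
lemma Model.opω_mem (hn : 0 < lam.card) (R : Submodule (Daha lam.card) (Model lam))
    {x : Model lam} (hx : x ∈ R) : Model.opω hn x ∈ R := by
  have h1 : Model.opω hn = down (fun j => hinv (Model.natT lam j)) (lam.card - 1) *
      (Model.isExtended hn).x 0 := by
    rw [IsExtended.x, conjSeq, ← mul_assoc, down_mul_up fun j hj =>
      hinv_mul (R := Module.End K (Model lam)) ((Model.isExtended hn).quad j hj), one_mul]
  have h2 : ∀ k ≤ lam.card - 1, ∀ y ∈ R, down (fun j => hinv (Model.natT lam j)) k y ∈ R := by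
    intro k
    induction k with
    | zero => exact fun _ y hy => hy
    | succ k ih => exact fun hk y hy => Model.hinv_natT_mem hk R (ih (by omega) y hy)
  rw [h1]
  refine h2 _ le_rfl _ ?_
  have h := R.smul_mem (Daha.X ⟨0, hn⟩) hx
  rwa [Model.smul_def, Model.rep_X, Model.opX_eq hn] at h

/-- The range contains the standard tableaux and is stable under `T_i` and `ω`, which produce
`s_i(τ)` and `Ψ(τ)` up to known terms and nonzero scalars. -/
lemma toModel_surjective : Function.Surjective (toModel lam) := by
  rw [← LinearMap.range_eq_top]
  set R := LinearMap.range (toModel lam) with hR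
  have hK : ∀ (r : K) (x : Model lam), x ∈ R → r • x ∈ R := fun r x hx => by
    rw [← algebraMap_smul (Daha lam.card)]
    exact R.smul_mem _ hx
  have hs : ∀ τ : PSYT lam, Finsupp.single τ 1 ∈ R := by
    intro τ
    induction τ using PSYT.up_induction with
    | syt S => exact ⟨_, toModel_of S⟩
    | swap i τ τ' h ih =>
      have h1 : (Daha.T i : Daha lam.card) • (Finsupp.single τ 1 : Model lam) ∈ R :=
        R.smul_mem _ ih
      rw [Model.smul_def, Model.rep_T, Model.opT_single_of_up h] at h1
      exact (R.add_mem_iff_right (hK _ _ ih)).mp h1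
    | psi hn τ ih =>
      have h1 := Model.opω_mem hn R ih
      rw [Model.opω_single] at h1
      have h2 := hK (t ^ τ.c ⟨0, hn⟩)⁻¹ _ h1
      rwa [inv_smul_smul₀ (zpow_ne_zero _ t_ne_zero)] at h2
  rw [eq_top_iff]
  rintro x -
  induction x using Finsupp.induction_linear with
  | zero => exact R.zero_mem
  | add x y hx hy => exact R.add_mem hx hy
  | single τ r =>
    have : (Finsupp.single τ r : Model lam) = r • Finsupp.single τ 1 := by
      rw [Finsupp.smul_single, smul_eq_mul, mul_one]
    rw [this]
    exact hK _ _ (hs τ)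

instance : Finite (SYT lam) :=
  Finite.of_injective SYT.idx fun _ _ h => SYT.ext h

lemma finite_sum_eq (n d : ℕ) : Finite {a : Fin n → ℕ // ∑ i, a i = d} := by
  refine Finite.of_injective
    (fun a => (fun i => ⟨a.1 i, Nat.lt_succ_of_le (le_trans
      (Finset.single_le_sum (fun _ _ => Nat.zero_le _) (Finset.mem_univ i)) a.2.le)⟩ :
      Fin n → Fin (d + 1))) fun a b h => ?_
  ext i
  exact congrArg Fin.val (congrFun h i)

/-- Composing with the spanning family `X^a ⊗ τ` gives a degree-preserving surjection to which the
dimension count applies. Injectivity of the composite forces injectivity of the map itself, the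
spanning family being surjective. -/
lemma toModel_injective : Function.Injective (toModel lam) := by
  set l : (SYT lam × (Fin lam.card → ℕ) →₀ K) →ₗ[K] V lam :=
    Finsupp.linearCombination K spanFamily with hl
  have hls : Function.Surjective l := by
    rw [← LinearMap.range_eq_top, hl, Finsupp.range_linearCombination, span_spanFamily]
  have hinj : Function.Injective ((toModel lam).restrictScalars K ∘ₗ l) := by
    refine injective_of_graded (dA := fun x => ∑ i, x.2 i) (dB := PSYT.deg)
      destandardize_injective deg_destandardize (fun d => ?_) _ (fun x => ?_)
      (toModel_surjective.comp hls)
    · have := finite_sum_eq lam.card d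
      exact Finite.of_injective
        (fun x : {x : SYT lam × (Fin lam.card → ℕ) // ∑ i, x.2 i = d} =>
          (x.1.1, (⟨x.1.2, x.2⟩ : {a : Fin lam.card → ℕ // ∑ i, a i = d})))
        fun x y h => Subtype.ext (Prod.ext (congrArg Prod.fst h :)
          (congrArg (fun z => z.2.1) h :))
    · rw [LinearMap.comp_apply, hl, Finsupp.linearCombination_single, one_smul]
      exact toModel_spanFamily_mem x
  intro x y h
  obtain ⟨x, rfl⟩ := hls x
  obtain ⟨y, rfl⟩ := hls y
  rw [hinj h]

/-- The identification of the induced module with the model. -/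
def equivModel (lam : YoungDiagram) : V lam ≃ₗ[Daha lam.card] Model lam :=
  LinearEquiv.ofBijective (toModel lam) ⟨toModel_injective, toModel_surjective⟩

lemma equivModel_of (S : SYT lam) :
    equivModel lam (oneTmul (Specht.of S)) = Finsupp.single S.toPSYT 1 := toModel_of S

/-- The identification of the induced module with the model as vector spaces. -/
def equivModelK (lam : YoungDiagram) : V lam ≃ₗ[K] Model lam :=
  (equivModel lam).restrictScalars K

end

end VVMac

namespace VVMac

noncomputable section

variable {lam : YoungDiagram}

/-! ### Non-symmetric Macdonald polynomials -/

namespace Model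

/-- The inverse of `θ_i`. -/
def opθinv (i : Fin lam.card) : Module.End K (Model lam) :=
  Finsupp.linearCombination K fun τ : PSYT lam => (τ.weight i)⁻¹ • Finsupp.single τ 1

lemma opθinv_single (i : Fin lam.card) (τ : PSYT lam) :
    opθinv i (Finsupp.single τ 1) = (τ.weight i)⁻¹ • Finsupp.single τ 1 := by
  rw [opθinv, Finsupp.linearCombination_single, one_smul]

lemma weight_ne_zero (τ : PSYT lam) (i : Fin lam.card) : τ.weight i ≠ 0 :=
  val_ne_zero (τ.u i)

lemma opθ_mul_opθinv (i : Fin lam.card) : opθ i * opθinv i = (1 : Module.End K (Model lam)) :=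
  end_ext fun τ => by
    rw [Module.End.mul_apply, opθinv_single, map_smul, opθ_single,
      inv_smul_smul₀ (weight_ne_zero τ i), Module.End.one_apply]

lemma opθinv_mul_opθ (i : Fin lam.card) : opθinv i * opθ i = (1 : Module.End K (Model lam)) :=
  end_ext fun τ => by
    rw [Module.End.mul_apply, opθ_single, map_smul, opθinv_single,
      smul_inv_smul₀ (weight_ne_zero τ i), Module.End.one_apply]

/-- The inverse of `π_n`. -/
def opPiInv (hn : 0 < lam.card) : Module.End K (Model lam) :=
  (t ^ (lam.card - 1))⁻¹ • (down (natT lam) (lam.card - 1) * opθinv ⟨0, hn⟩)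

lemma up_hinv_mul_down (hn : 0 < lam.card) :
    up (fun j => hinv (natT lam j)) (lam.card - 1) * down (natT lam) (lam.card - 1) = 1 :=
  up_mul_down fun j hj =>
    hinv_mul (R := Module.End K (Model lam)) ((isExtended hn).quad j hj)

lemma down_mul_up_hinv (hn : 0 < lam.card) :
    down (natT lam) (lam.card - 1) * up (fun j => hinv (natT lam j)) (lam.card - 1) = 1 :=
  down_mul_up fun j hj =>
    mul_hinv (R := Module.End K (Model lam)) ((isExtended hn).quad j hj)

lemma pi_mul_opPiInv (hn : 0 < lam.card) : (isExtended hn).π * opPiInv hn = 1 := by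
  rw [IsExtended.π, opPiInv, natθ_of_lt hn, smul_mul_assoc, mul_smul_comm,
    smul_inv_smul₀ (pow_ne_zero _ t_ne_zero), mul_assoc, ← mul_assoc (up _ _),
    up_hinv_mul_down hn, one_mul, opθ_mul_opθinv]

lemma opPiInv_mul_pi (hn : 0 < lam.card) : opPiInv hn * (isExtended hn).π = 1 := by
  rw [IsExtended.π, opPiInv, natθ_of_lt hn, smul_mul_assoc, mul_smul_comm,
    inv_smul_smul₀ (pow_ne_zero _ t_ne_zero), mul_assoc, ← mul_assoc (opθinv _),
    opθinv_mul_opθ, one_mul, down_mul_up_hinv hn]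

/-- The products of the `T_i` in `X_n` and in `π_n⁻¹` cancel. On a basis vector the right side is
diagonal followed by `Ψ`, which explains the last recursion for the `F_τ`. -/
lemma opX_last_mul_opPiInv (hn : 0 < lam.card) :
    opX ⟨lam.card - 1, Nat.sub_lt hn Nat.one_pos⟩ * opPiInv hn = opω hn * opθinv ⟨0, hn⟩ := by
  have h : opX ⟨lam.card - 1, Nat.sub_lt hn Nat.one_pos⟩ =
      t ^ (lam.card - 1) • (opω hn * up (fun j => hinv (natT lam j)) (lam.card - 1)) :=
    (opX_eq hn _).trans (isExtended hn).x_last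
  rw [h, opPiInv, smul_mul_assoc, mul_smul_comm, smul_inv_smul₀ (pow_ne_zero _ t_ne_zero),
    mul_assoc, ← mul_assoc (up _ _), up_hinv_mul_down hn, one_mul]

lemma swap_aux {k M : Type*} [CommRing k] [AddCommGroup M] [Module k M] {d r c : k} {v w : M}
    (h : d + (r - 1) + c = 0) : (d • v + w) + (r - 1) • v + c • v = w := by
  linear_combination (norm := module) h • v

lemma t_hinv_opT_single {i : Fin (lam.card - 1)} {τ τ' : PSYT lam} (h : SwapUp i τ τ') :
    t • hinv (opT i) (Finsupp.single τ 1) +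
      ((t - 1) * τ.weight (hi i) / (τ.weight (lo i) - τ.weight (hi i))) • Finsupp.single τ 1 =
        Finsupp.single τ' 1 := by
  rw [t_hinv_opT, opT_single_of_up h]
  refine swap_aux ?_
  have h1 := val_sub_ne_zero (τ.u_lo_ne_u_hi i)
  rw [diag]
  rw [PSYT.val_u, PSYT.val_u] at h1 ⊢
  field_simp
  ring

end Model

lemma equivModelK_act (d : Daha lam.card) (x : V lam) :
    equivModelK lam (act d x) = Model.rep lam d (equivModelK lam x) :=
  map_smul (equivModel lam) d x

lemma act_symm (d : Daha lam.card) (x : Model lam) :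
    act d ((equivModelK lam).symm x) = (equivModelK lam).symm (Model.rep lam d x) := by
  rw [LinearEquiv.eq_symm_apply, equivModelK_act, LinearEquiv.apply_symm_apply]

lemma act_pi_symm (hn : 0 < lam.card) (x : Model lam) :
    act (Daha.pi hn) ((equivModelK lam).symm x) =
      (equivModelK lam).symm ((Model.isExtended hn).π x) := by
  rw [act_symm, Model.rep_pi]

/-- The inverse of the action of `π_n`. -/
def actPiInv (hn : 0 < lam.card) : Module.End K (V lam) :=
  (equivModelK lam).symm.toLinearMap ∘ₗ Model.opPiInv hn ∘ₗ (equivModelK lam).toLinearMap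

lemma actPiInv_symm (hn : 0 < lam.card) (x : Model lam) :
    actPiInv hn ((equivModelK lam).symm x) = (equivModelK lam).symm (Model.opPiInv hn x) :=
  congrArg (fun y => (equivModelK lam).symm (Model.opPiInv hn y))
    ((equivModelK lam).apply_symm_apply x)

lemma act_pi_mul_actPiInv (hn : 0 < lam.card) :
    (act (Daha.pi hn) : Module.End K (V lam)) * actPiInv hn = 1 := by
  refine LinearMap.ext fun y => ?_
  obtain ⟨y, rfl⟩ := (equivModelK lam).symm.surjective y
  rw [Module.End.mul_apply, actPiInv_symm, act_pi_symm, Module.End.one_apply]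
  exact congrArg _ (LinearMap.congr_fun (Model.pi_mul_opPiInv hn) y)

lemma actPiInv_mul_act_pi (hn : 0 < lam.card) :
    actPiInv hn * (act (Daha.pi hn) : Module.End K (V lam)) = 1 := by
  refine LinearMap.ext fun y => ?_
  obtain ⟨y, rfl⟩ := (equivModelK lam).symm.surjective y
  rw [Module.End.mul_apply, act_pi_symm, actPiInv_symm, Module.End.one_apply]
  exact congrArg _ (LinearMap.congr_fun (Model.opPiInv_mul_pi hn) y)

lemma inverse_act_pi (hn : 0 < lam.card) :
    Ring.inverse (act (Daha.pi hn) : Module.End K (V lam)) = actPiInv hn :=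
  Ring.inverse_unit ⟨_, _, act_pi_mul_actPiInv hn, actPiInv_mul_act_pi hn⟩

/-- The non-symmetric Macdonald polynomial `F_τ`. -/
def nonsymMacdonald (τ : PSYT lam) : V lam := (equivModelK lam).symm (Finsupp.single τ 1)

lemma equivModelK_nonsymMacdonald (τ : PSYT lam) :
    equivModelK lam (nonsymMacdonald τ) = Finsupp.single τ 1 :=
  LinearEquiv.apply_symm_apply _ _

lemma isNonsymMacdonald : IsNonsymMacdonald (nonsymMacdonald (lam := lam)) := by
  let b : Module.Basis (PSYT lam) K (V lam) := Module.Basis.ofRepr (equivModelK lam)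
  have hb : ⇑b = nonsymMacdonald := by
    funext τ
    rfl
  refine ⟨?_, ?_, ?_, ?_, ?_, ?_⟩
  · rw [← hb]; exact b.linearIndependent
  · rw [← hb]; exact b.span_eq
  · intro τ i
    rw [nonsymMacdonald, act_symm, Model.rep_θ, Model.opθ_single, map_smul]
  · intro S
    rw [nonsymMacdonald, LinearEquiv.symm_apply_eq]
    exact (equivModel_of S).symm
  · intro i τ τ' h
    rw [nonsymMacdonald, nonsymMacdonald, act_symm, Model.rep_hinv, Model.rep_T,
      ← Model.t_hinv_opT_single h, map_add, map_smul, map_smul]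
  · intro hn τ
    rw [nonsymMacdonald, nonsymMacdonald, inverse_act_pi, actPiInv_symm, act_symm,
      Model.rep_X]
    have h := LinearMap.congr_fun (Model.opX_last_mul_opPiInv hn) (Finsupp.single τ 1)
    rw [Module.End.mul_apply, Module.End.mul_apply, Model.opθinv_single, map_smul,
      Model.opω_single] at h
    rw [h, ← map_smul, smul_smul, smul_smul, PSYT.weight]
    have h1 : q ^ τ.w ⟨0, hn⟩ ≠ 0 := pow_ne_zero _ q_ne_zero
    have h2 : t ^ τ.c ⟨0, hn⟩ ≠ 0 := zpow_ne_zero _ t_ne_zero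
    -- Inverting `θ_1` contributes `q^{-w} t^{-c}` and `ω` contributes `t^c`; the prefactor `q^w` in
    -- the recursion compensates exactly.
    have h3 : q ^ τ.w ⟨0, hn⟩ * ((q ^ τ.w ⟨0, hn⟩ * t ^ τ.c ⟨0, hn⟩)⁻¹ * t ^ τ.c ⟨0, hn⟩) = 1 := by
      field_simp
    rw [← mul_assoc] at h3
    rw [mul_assoc, ← mul_assoc, h3, one_smul]

/-- The values at standard tableaux and the two recursions already determine the whole family. -/
lemma IsNonsymMacdonald.eq {F : PSYT lam → V lam} (h : IsNonsymMacdonald F) :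
    F = nonsymMacdonald := by
  have h' := isNonsymMacdonald (lam := lam)
  funext τ
  induction τ using PSYT.up_induction with
  | syt S => rw [h.syt, h'.syt]
  | swap i τ τ' hs ih => rw [← h.swap i τ τ' hs, ← h'.swap i τ τ' hs, ih]
  | psi hn τ ih => rw [h.psi hn, h'.psi hn, ih]

lemma existsUnique_isNonsymMacdonald (lam : YoungDiagram) :
    ∃! F : PSYT lam → V lam, IsNonsymMacdonald F :=
  ⟨nonsymMacdonald, isNonsymMacdonald, fun _ h => h.eq⟩

end

end VVMac

namespace VVMac

noncomputable section

variable {lam : YoungDiagram}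

/-! ### Invariants of the finite Hecke algebra -/

lemma PSYT.swap_swap (i : Fin (lam.card - 1)) (τ : PSYT lam) : (τ.swap i).swap i = τ := by
  by_cases h : ∃ τ', IsSwap i τ τ'
  · obtain ⟨τ', h⟩ := h
    rw [h.swap_eq, h.symm.swap_eq]
  · have h' : τ.swap i = τ := by rw [PSYT.swap, dif_neg h]
    rw [h', h']

lemma PSYT.SameRow.not_isSwap {i : Fin (lam.card - 1)} {τ : PSYT lam} (h : τ.SameRow i) :
    ¬ ∃ τ', IsSwap i τ τ' := by
  rintro ⟨τ', h'⟩
  have h1 := h.1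
  have h2 := h.c_hi
  rcases h'.up_or_up with hu | hu
  · have h4 := hu.up
    simp only [Up, PSYT.u] at h4
    omega
  · have h4 := hu.up
    rw [h'.u, h'.u, Hecke.s_lo, Hecke.s_hi] at h4
    simp only [Up, PSYT.u] at h4
    omega

lemma PSYT.SameCol.not_isSwap {i : Fin (lam.card - 1)} {τ : PSYT lam} (h : τ.SameCol i) :
    ¬ ∃ τ', IsSwap i τ τ' := by
  rintro ⟨τ', h'⟩
  have h1 := h.1
  have h2 := h.c_lo
  rcases h'.up_or_up with hu | hu
  · have h4 := hu.up
    simp only [Up, PSYT.u] at h4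
    omega
  · have h4 := hu.up
    rw [h'.u, h'.u, Hecke.s_lo, Hecke.s_hi] at h4
    simp only [Up, PSYT.u] at h4
    omega

/-- The coefficient that relates the coordinates of an invariant vector. -/
def invCoeff (x y : ℕ × ℤ) : K := 1 - diag x y

/-- Since `1 - diag x y = (t x - y) / (x - y)`, the two factors are those of `offProd`. Hence the
invariance equations at the two ends of a swap are compatible. -/
lemma invCoeff_mul {x y : ℕ × ℤ} (h : x ≠ y) :
    invCoeff x y * invCoeff y x = offProd x y := by
  have h1 := val_sub_ne_zero h
  have h2 := val_sub_ne_zero h.symm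
  have e : val y - val x = -(val x - val y) := by ring
  unfold invCoeff diag offProd
  rw [e, div_neg]
  field_simp
  ring

namespace Model

lemma opT_apply (i : Fin (lam.card - 1)) (x : Model lam) (τ : PSYT lam) :
    opT i x τ = diag (τ.u (lo i)) (τ.u (hi i)) * x τ +
      off ((τ.swap i).u (lo i)) ((τ.swap i).u (hi i)) * x (τ.swap i) := by
  classical
  suffices h : Finsupp.lapply τ ∘ₗ opT i = diag (τ.u (lo i)) (τ.u (hi i)) • Finsupp.lapply τ +
      off ((τ.swap i).u (lo i)) ((τ.swap i).u (hi i)) • Finsupp.lapply (τ.swap i) from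
    LinearMap.congr_fun h x
  refine end_ext fun σ => ?_
  simp only [LinearMap.comp_apply, opT_single, LinearMap.add_apply, LinearMap.smul_apply, map_add,
    map_smul, Finsupp.lapply_apply, smul_eq_mul, Finsupp.single_apply]
  congr 1
  · by_cases h : σ = τ
    · rw [h]
    · rw [if_neg h, mul_zero, mul_zero]
  · by_cases h : σ = τ.swap i
    · rw [h, PSYT.swap_swap, if_pos rfl, if_pos rfl]
    · have h' : σ.swap i ≠ τ := fun h' => h (by rw [← h', PSYT.swap_swap])
      rw [if_neg h, if_neg h', mul_zero, mul_zero]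

/-- The vectors fixed by all `T_i`. -/
def inv (lam : YoungDiagram) : Submodule K (Model lam) where
  carrier := {x | ∀ i, opT i x = x}
  add_mem' ha hb i := by rw [map_add, ha i, hb i]
  zero_mem' i := map_zero _
  smul_mem' k x hx i := by rw [map_smul, hx i]

lemma apply_of_mem_inv {x : Model lam} (hx : x ∈ inv lam) {i : Fin (lam.card - 1)}
    {τ τ' : PSYT lam} (h : SwapUp i τ τ') :
    x τ = invCoeff (τ.u (hi i)) (τ.u (lo i)) * x τ' := by
  -- The equation is read at the upper tableau, where the coefficient coming from `τ` is `1`.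
  have h1 := DFunLike.congr_fun (hx i) τ'
  have e1 : τ'.u (lo i) = τ.u (hi i) := by rw [h.1.u, Hecke.s_lo]
  have e2 : τ'.u (hi i) = τ.u (lo i) := by rw [h.1.u, Hecke.s_hi]
  rw [opT_apply, h.1.symm.swap_eq, off, if_pos h.up, e1, e2, one_mul] at h1
  rw [invCoeff]
  linear_combination h1

lemma opT_apply_of_not_isSwap {i : Fin (lam.card - 1)} {τ : PSYT lam}
    (h : ¬ ∃ τ', IsSwap i τ τ') (x : Model lam) :
    opT i x τ = diag (τ.u (lo i)) (τ.u (hi i)) * x τ := by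
  have h' : τ.swap i = τ := by rw [PSYT.swap, dif_neg h]
  rw [opT_apply, h', PSYT.off_eq_zero h, zero_mul, add_zero]

lemma opT_apply_of_sameRow {i : Fin (lam.card - 1)} {τ : PSYT lam} (h : τ.SameRow i)
    (x : Model lam) : opT i x τ = x τ := by
  have h' := DFunLike.congr_fun (opT_single_of_sameRow h) τ
  rw [opT_apply_of_not_isSwap h.not_isSwap, Finsupp.single_eq_same, mul_one] at h'
  rw [opT_apply_of_not_isSwap h.not_isSwap, h', one_mul]

lemma opT_apply_of_sameCol {i : Fin (lam.card - 1)} {τ : PSYT lam} (h : τ.SameCol i)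
    (x : Model lam) : opT i x τ = -t * x τ := by
  have h' := DFunLike.congr_fun (opT_single_of_sameCol h) τ
  rw [opT_apply_of_not_isSwap h.not_isSwap, Finsupp.smul_apply, Finsupp.single_eq_same,
    smul_eq_mul, mul_one, mul_one] at h'
  rw [opT_apply_of_not_isSwap h.not_isSwap, h']

/-- Here `T_i` multiplies the coordinate by `-t`, and `-t ≠ 1`. -/
lemma apply_of_mem_inv_of_sameCol {x : Model lam} (hx : x ∈ inv lam) {i : Fin (lam.card - 1)}
    {τ : PSYT lam} (h : τ.SameCol i) : x τ = 0 := by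
  have h1 := DFunLike.congr_fun (hx i) τ
  rw [opT_apply_of_sameCol h] at h1
  have h8 : (1 + t) * x τ = 0 := by linear_combination -h1
  exact (mul_eq_zero.mp h8).resolve_left one_add_t_ne_zero

lemma mem_inv_of {x : Model lam}
    (h1 : ∀ i τ τ', SwapUp i τ τ' → x τ = invCoeff (τ.u (hi i)) (τ.u (lo i)) * x τ')
    (h2 : ∀ i (τ : PSYT lam), τ.SameCol i → x τ = 0) : x ∈ inv lam := by
  intro i
  ext τ
  by_cases hr : τ.SameRow i
  · exact opT_apply_of_sameRow hr x
  by_cases hc : τ.SameCol i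
  · rw [opT_apply_of_sameCol hc, h2 i τ hc, mul_zero]
  obtain ⟨τ', h⟩ := PSYT.exists_swap hr hc
  have e1 : τ'.u (lo i) = τ.u (hi i) := by rw [h.u, Hecke.s_lo]
  have e2 : τ'.u (hi i) = τ.u (lo i) := by rw [h.u, Hecke.s_hi]
  rw [opT_apply, h.swap_eq, e1, e2]
  rcases h.up_or_up with hu | hu
  · have h3 := h1 i τ τ' hu
    have h4 := invCoeff_mul (τ.u_lo_ne_u_hi i).symm
    have h5 : off (τ.u (hi i)) (τ.u (lo i)) = offProd (τ.u (hi i)) (τ.u (lo i)) := by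
      rw [off, if_neg (not_up_symm hu.up)]
    rw [h5, ← h4, h3]
    simp only [invCoeff]
    ring
  · have h3 := h1 i τ' τ hu
    have h5 : off (τ.u (hi i)) (τ.u (lo i)) = 1 := by
      rw [off, if_pos]
      rw [← e1, ← e2]
      exact hu.up
    rw [e1, e2] at h3
    rw [h5, h3, invCoeff]
    ring

/-- An invariant vector is determined by its coordinates at the top tableaux. -/
lemma eq_zero_of_mem_inv {x : Model lam} (hx : x ∈ inv lam) {τ : PSYT lam}
    (h : x τ.toRYT.top = 0) : x τ = 0 := by
  induction τ using PSYT.top_induction with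
  | top T => exact h
  | swap i τ τ' hs _ ih =>
    rw [apply_of_mem_inv hx hs, ih (by rwa [hs.1.toRYT_eq]), mul_zero]

end Model

/-! ### Tops of strict tableaux -/

lemma RSSYT.lt_of_lt_of_le (T : RSSYT lam) {b b' : Box lam} (h1 : b.1.1 < b'.1.1)
    (h2 : b.1.2 ≤ b'.1.2) : T.val b' < T.val b := by
  let d : Box lam := boxOf b' b'.1.1 b.1.2 le_rfl h2
  have h3 : T.val d < T.val b := T.col_strict b d ⟨rfl, h1⟩
  rcases h2.eq_or_lt with h | h
  · have : d = b' := box_ext rfl h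
    rwa [← this]
  · exact (T.row_weak d b' ⟨rfl, h⟩).trans_lt h3

lemma RSSYT.toRYT_injective : Function.Injective (RSSYT.toRYT (lam := lam)) := by
  rintro ⟨v, _, _⟩ ⟨v', _, _⟩ h
  obtain rfl : v = v' := congrArg RYT.val h
  rfl

/-- A reverse Young tableau with strict columns, as a semi-standard one. -/
def RYT.toRSSYT (T : RYT lam) (h : ∀ b b', ColLT b b' → T.val b' < T.val b) : RSSYT lam :=
  ⟨T.val, T.row_weak, h⟩

/-- With column-strict exponents, a box strictly below and weakly to the right has a smaller
exponent. A swap that goes up between equal exponents therefore has `i + 1` strictly to the left, so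
every upward swap corrects a pair in the wrong order. -/
lemma SwapUp.topLT (T : RSSYT lam) {i : Fin (lam.card - 1)} {τ τ' : PSYT lam}
    (h : SwapUp i τ τ') (hp : τ.pow = T.val) :
    TopLT τ.pow (τ.idx.symm (hi i)) (τ.idx.symm (lo i)) := by
  rcases h.up with h1 | ⟨h1, h2⟩
  · exact Or.inl h1
  refine Or.inr ⟨h1.symm, ?_⟩
  by_contra hcon
  have h3 := T.lt_of_lt_of_le (b := τ.idx.symm (lo i)) (b' := τ.idx.symm (hi i))
    (by simp only [PSYT.u, PSYT.c, content] at h2; omega) (by omega)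
  rw [← hp] at h3
  exact h3.ne' h1

lemma not_sameCol_of_pow_eq (T : RSSYT lam) {i : Fin (lam.card - 1)} {τ : PSYT lam}
    (hp : τ.pow = T.val) : ¬ τ.SameCol i := fun h => by
  have h1 := T.col_strict _ _ h.2
  rw [← hp] at h1
  exact h1.ne' h.1

/-- By monotonicity the box directly below `b` has the exponent of `b`. Boxes with equal exponents
are numbered column by column in the top tableau, so these two receive consecutive indices. -/
lemma RYT.exists_sameCol_top {T : RYT lam} {b b' : Box lam} (h : ColLT b b')
    (hT : T.val b ≤ T.val b') : ∃ i, T.top.SameCol i := by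
  obtain ⟨h1, h2⟩ := h
  let d : Box lam := boxOf b' (b.1.1 + 1) b.1.2 h2 h1.le
  have hpd : T.val d = T.val b := by
    have e1 : T.val d ≤ T.val b := T.col_weak b d ⟨rfl, Nat.lt_succ_self _⟩
    have e2 : T.val b' ≤ T.val d := by
      by_cases hd : b.1.1 + 1 = b'.1.1
      · rw [show d = b' from box_ext hd h1]
      · exact T.col_weak d b' ⟨h1, lt_of_le_of_ne h2 hd⟩
    omega
  have hlt : T.top.idx b < T.top.idx d :=
    RYT.top_idx_lt (Or.inr ⟨hpd.symm, Or.inr ⟨rfl, Nat.lt_succ_self _⟩⟩)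
  have hd : (T.top.idx d).1 = (T.top.idx b).1 + 1 := by
    by_contra hne
    have hd2 := (T.top.idx d).2
    rw [Fin.lt_def] at hlt
    let k : Fin lam.card := ⟨(T.top.idx b).1 + 1, by omega⟩
    obtain ⟨z, hz⟩ := T.top.idx.surjective k
    have hz1 : TopLT T.val b z := RYT.top_idx_lt_iff.mp (by rw [hz, Fin.lt_def]; simp [k])
    have hz2 : TopLT T.val z d := RYT.top_idx_lt_iff.mp (by
      rw [hz, Fin.lt_def]; simp only [k]; omega)
    have e1 : d.1.1 = b.1.1 + 1 := rfl
    have e2 : d.1.2 = b.1.2 := rfl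
    unfold TopLT at hz1 hz2
    omega
  have hlo : (T.top.idx b).1 < lam.card - 1 := by
    have := (T.top.idx d).2
    omega
  have e1 : lo ⟨(T.top.idx b).1, hlo⟩ = T.top.idx b := rfl
  have e2 : hi ⟨(T.top.idx b).1, hlo⟩ = T.top.idx d := Fin.ext hd.symm
  refine ⟨⟨(T.top.idx b).1, hlo⟩, ?_, ?_⟩
  · simp only [PSYT.w, e1, e2, Equiv.symm_apply_apply]
    exact hpd.symm
  · rw [e1, e2, Equiv.symm_apply_apply, Equiv.symm_apply_apply]
    exact ⟨rfl, Nat.lt_succ_self _⟩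

/-- Top tableaux whose exponents are not column-strict contribute nothing: they contain adjacent
indices in one column, where invariant vectors vanish. -/
lemma Model.eq_zero_of_top {x : Model lam} (hx : x ∈ Model.inv lam)
    (h : ∀ T : RSSYT lam, x T.toRYT.top = 0) : x = 0 := by
  ext τ
  refine Model.eq_zero_of_mem_inv hx ?_
  by_cases hT : ∀ b b', ColLT b b' → τ.toRYT.val b' < τ.toRYT.val b
  · exact h (τ.toRYT.toRSSYT hT)
  · push Not at hT
    obtain ⟨b, b', hb, hT⟩ := hT
    obtain ⟨i, hi'⟩ := RYT.exists_sameCol_top hb hT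
    exact Model.apply_of_mem_inv_of_sameCol hx hi'

/-! ### The symmetric Macdonald polynomials in the model -/

/-- The weight of a box. -/
def boxU (p : Box lam → ℕ) (b : Box lam) : ℕ × ℤ := (p b, content b)

/-- The coefficient of `F_τ` in the symmetric Macdonald polynomial. -/
def symCoeff (τ : PSYT lam) : K :=
  ∏ p ∈ τ.disorder, invCoeff (boxU τ.pow p.1) (boxU τ.pow p.2)

lemma symCoeff_top (T : RYT lam) : symCoeff T.top = 1 := by
  have : T.top.disorder = ∅ := by
    rw [Finset.eq_empty_iff_forall_notMem]
    intro p hp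
    rw [PSYT.mem_disorder] at hp
    exact lt_asymm hp.2 (RYT.top_idx_lt hp.1)
  rw [symCoeff, this, Finset.prod_empty]

lemma symCoeff_of_swapUp {i : Fin (lam.card - 1)} {τ τ' : PSYT lam} (hs : SwapUp i τ τ')
    (h : TopLT τ.pow (τ.idx.symm (hi i)) (τ.idx.symm (lo i))) :
    symCoeff τ = invCoeff (τ.u (hi i)) (τ.u (lo i)) * symCoeff τ' := by
  obtain ⟨h1, h2⟩ := hs.disorder h
  rw [symCoeff, h1, Finset.prod_insert h2, symCoeff, hs.1.1]
  rfl

lemma finite_psytOver (T : RYT lam) : (PSYTOver T).Finite :=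
  Set.Finite.of_injOn (t := Set.univ) (f := PSYT.idx) (fun _ _ => Set.mem_univ _)
    (fun τ h τ' h' e => PSYT.ext e ((show τ.pow = T.val from h).trans
      (show τ'.pow = T.val from h').symm)) Set.finite_univ

open Classical in
/-- The symmetric Macdonald polynomial `P_T`. -/
def Model.sym (T : RSSYT lam) : Model lam :=
  Finsupp.onFinset (finite_psytOver T.toRYT).toFinset
    (fun τ => if τ.pow = T.val then symCoeff τ else 0) fun τ h => by
      rw [Set.Finite.mem_toFinset]
      by_contra h'
      exact h (if_neg h')

namespace Model

lemma sym_apply_of_eq {T : RSSYT lam} {τ : PSYT lam} (h : τ.pow = T.val) :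
    sym T τ = symCoeff τ := by
  rw [sym, Finsupp.onFinset_apply, if_pos h]

lemma sym_apply_of_ne {T : RSSYT lam} {τ : PSYT lam} (h : τ.pow ≠ T.val) : sym T τ = 0 := by
  rw [sym, Finsupp.onFinset_apply, if_neg h]

lemma sym_mem_withPow (T : RSSYT lam) : sym T ∈ withPow T.val :=
  (Finsupp.mem_supported' K _).mpr fun _ h => sym_apply_of_ne h

lemma sym_mem_inv (T : RSSYT lam) : sym T ∈ inv lam := by
  refine mem_inv_of (fun i τ τ' h => ?_) (fun i τ h => ?_)
  · by_cases hp : τ.pow = T.val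
    · rw [sym_apply_of_eq hp, sym_apply_of_eq (h.1.1.trans hp)]
      exact symCoeff_of_swapUp h (h.topLT T hp)
    · rw [sym_apply_of_ne hp, sym_apply_of_ne (by rwa [h.1.1]), mul_zero]
  · by_cases hp : τ.pow = T.val
    · exact absurd h (not_sameCol_of_pow_eq T hp)
    · exact sym_apply_of_ne hp

open Classical in
-- Top coordinates are dual to the vectors `sym T`, so linear independence and spanning can both be
-- read off from them.
lemma sym_top (T T' : RSSYT lam) : sym T T'.toRYT.top = if T' = T then 1 else 0 := by
  split_ifs with h
  · rw [h, sym_apply_of_eq rfl, symCoeff_top]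
  · refine sym_apply_of_ne fun h' => h ?_
    apply RSSYT.toRYT_injective
    have : T'.toRYT.val = T.toRYT.val := h'
    cases hT : T.toRYT
    cases hT' : T'.toRYT
    simp only [hT, hT'] at this
    simp only [this]

/-- An invariant vector supported on `PSYT(λ; T)` is determined by its top coordinate. -/
lemma eq_of_top_eq {T : RSSYT lam} {x y : Model lam} (hx : x ∈ inv lam) (hy : y ∈ inv lam)
    (hx' : x ∈ withPow T.val) (hy' : y ∈ withPow T.val)
    (h : x T.toRYT.top = y T.toRYT.top) : x = y := by
  rw [← sub_eq_zero]
  have hz := (inv lam).sub_mem hx hy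
  have hz' := (withPow T.val).sub_mem hx' hy'
  refine eq_zero_of_top hz fun T' => ?_
  by_cases hT : T'.toRYT.top.pow = T.val
  · have : T' = T := by
      by_contra hne
      classical
      have h1 := sym_top T T'
      rw [if_neg hne, sym_apply_of_eq hT, symCoeff_top] at h1
      exact one_ne_zero h1
    rw [this, Finsupp.sub_apply, h, sub_self]
  · exact (Finsupp.mem_supported' K _).mp hz' _ hT

end Model

end
end VVMac

namespace VVMac

noncomputable section

variable {lam : YoungDiagram}

/-! ### The greatest tableau -/

lemma deg_le_of_le {τ τ' : PSYT lam} (h : τ.Le τ') : τ.deg ≤ τ'.deg := by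
  induction h with
  | refl => exact le_rfl
  | tail _ h ih =>
    refine ih.trans ?_
    cases h with
    | psi hn τ => rw [PSYT.deg_Psi hn]; exact Nat.le_succ _
    | swap i τ τ' h => rw [PSYT.deg, PSYT.deg, h.1.1]

/-- Another greatest element would be reached from the top tableau by a nonempty chain. Its first
step cannot be `Ψ`, which raises the degree, nor an upward swap, which needs a pair in the wrong
order. -/
lemma isTop_iff {T : RSSYT lam} {τ : PSYT lam} : IsTop T.toRYT τ ↔ τ = T.toRYT.top := by
  refine ⟨fun h => ?_, fun h => h ▸ T.toRYT.isTop_top⟩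
  have h1 : τ.deg = T.toRYT.top.deg := 
    congrArg (fun p : Box lam → ℕ => ∑ b, p b) h.1
  have h2 : T.toRYT.top.Le τ := h.2 _ T.toRYT.isTop_top.1
  rcases Relation.ReflTransGen.cases_head h2 with h3 | ⟨σ, h3, h4⟩
  · exact h3.symm
  have h5 := deg_le_of_le h4
  generalize hτ0 : T.toRYT.top = τ0 at h3
  cases h3 with
  | psi hn => rw [← hτ0, PSYT.deg_Psi hn, h1] at h5; omega
  | swap i _ _ hs =>
    subst hτ0
    have h6 := RYT.top_idx_lt (hs.topLT T rfl)
    rw [Equiv.apply_symm_apply, Equiv.apply_symm_apply, Fin.lt_def] at h6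
    simp only [lo, hi] at h6
    omega

/-! ### The idempotent -/

namespace Model

lemma eps_smul_mem_inv (x : Model lam) : (Hecke.eps lam.card) • x ∈ inv lam := fun i => by
  rw [← hecke_T_smul, ← mul_smul, Hecke.T_mul_eps]

lemma eps_smul_of_mem_inv {x : Model lam} (hx : x ∈ inv lam) : (Hecke.eps lam.card) • x = x :=
  Hecke.eps_smul_of_invariant fun i => by rw [hecke_T_smul, hx i]

end Model

lemma equivModelK_eps (x : V lam) : equivModelK lam (act (Daha.eps lam.card) x) =
    Hecke.eps lam.card • equivModelK lam x := by
  rw [equivModelK_act, Daha.eps_eq]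
  rfl

/-- The symmetrizer has invariant image and fixes invariant vectors. -/
lemma mem_W_iff {x : V lam} : x ∈ W lam ↔ equivModelK lam x ∈ Model.inv lam := by
  constructor
  · rintro ⟨y, rfl⟩
    rw [equivModelK_eps]
    exact Model.eps_smul_mem_inv _
  · intro h
    refine ⟨x, (equivModelK lam).injective ?_⟩
    rw [equivModelK_eps, Model.eps_smul_of_mem_inv h]

lemma mem_span_nonsymMacdonald {s : Set (PSYT lam)} {x : V lam} :
    x ∈ Submodule.span K (nonsymMacdonald '' s) ↔
      equivModelK lam x ∈ Finsupp.supported K K s := by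
  have h : nonsymMacdonald '' s = (equivModelK lam).symm.toLinearMap ''
      ((fun τ => (Finsupp.single τ 1 : Model lam)) '' s) := by
    rw [Set.image_image]
    rfl
  rw [h, Submodule.span_image, ← Finsupp.supported_eq_span_single]
  exact Submodule.mem_map_equiv (e := (equivModelK lam).symm) _

lemma mem_map_eps_U_iff {T : RYT lam} {x : V lam} :
    x ∈ (U nonsymMacdonald T).map (act (Daha.eps lam.card)) ↔
      equivModelK lam x ∈ Model.withPow T.val ∧ equivModelK lam x ∈ Model.inv lam := by
  constructor
  · rintro ⟨y, hy, rfl⟩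
    rw [equivModelK_eps]
    exact ⟨Model.hecke_smul_mem_withPow _ (mem_span_nonsymMacdonald.mp hy),
      Model.eps_smul_mem_inv _⟩
  · rintro ⟨h1, h2⟩
    refine ⟨x, mem_span_nonsymMacdonald.mpr h1, (equivModelK lam).injective ?_⟩
    rw [equivModelK_eps, Model.eps_smul_of_mem_inv h2]

/-! ### Symmetric Macdonald polynomials -/

/-- The prescribed form says that the top coordinate is `1`, which singles out one invariant vector
over `T`. -/
lemma isSymMacdonald_iff {T : RSSYT lam} {p : V lam} :
    IsSymMacdonald nonsymMacdonald T p ↔ equivModelK lam p = Model.sym T := by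
  classical
  have htop : T.toRYT.top.pow = T.val := rfl
  have hs1 : Model.sym T T.toRYT.top = 1 := by rw [Model.sym_top, if_pos rfl]
  constructor
  · rintro ⟨h1, τ, h2, h3⟩
    rw [isTop_iff] at h2
    subst h2
    rw [mem_map_eps_U_iff] at h1
    rw [mem_span_nonsymMacdonald, map_sub, equivModelK_nonsymMacdonald] at h3
    refine Model.eq_of_top_eq h1.2 (Model.sym_mem_inv T) h1.1 (Model.sym_mem_withPow T) ?_
    have h4 := (Finsupp.mem_supported' K _).mp h3 T.toRYT.top fun h => h.2 rfl
    rw [Finsupp.sub_apply, Finsupp.single_eq_same, sub_eq_zero] at h4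
    rw [h4, hs1]
  · intro h
    refine ⟨?_, T.toRYT.top, T.toRYT.isTop_top, ?_⟩
    · rw [mem_map_eps_U_iff, h]
      exact ⟨Model.sym_mem_withPow T, Model.sym_mem_inv T⟩
    · rw [mem_span_nonsymMacdonald, map_sub, equivModelK_nonsymMacdonald, h,
        Finsupp.mem_supported']
      intro τ hτ
      rw [Finsupp.sub_apply]
      by_cases hτ' : τ = T.toRYT.top
      · rw [hτ', hs1, Finsupp.single_eq_same, sub_self]
      · rw [Finsupp.single_eq_of_ne hτ', sub_zero]
        exact Model.sym_apply_of_ne fun h' => hτ ⟨h', hτ'⟩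

lemma existsUnique_isSymMacdonald (T : RSSYT lam) :
    ∃! p : V lam, IsSymMacdonald nonsymMacdonald T p := by
  refine ⟨(equivModelK lam).symm (Model.sym T), ?_, fun p hp => ?_⟩
  · exact isSymMacdonald_iff.mpr (LinearEquiv.apply_symm_apply _ _)
  · rw [LinearEquiv.eq_symm_apply]
    exact isSymMacdonald_iff.mp hp

lemma Model.linearIndependent_sym : LinearIndependent K (Model.sym (lam := lam)) := by
  classical
  rw [linearIndependent_iff]
  intro l hl
  ext T
  have h := DFunLike.congr_fun hl T.toRYT.top
  rw [Finsupp.linearCombination_apply, Finsupp.sum, Finsupp.finsetSum_apply] at h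
  simp only [Finsupp.smul_apply, Model.sym_top, smul_eq_mul, mul_ite, mul_one, mul_zero,
    Finset.sum_ite_eq, Finsupp.coe_zero, Pi.zero_apply, Finsupp.mem_support_iff, ne_eq,
    ite_not, ite_eq_left_iff] at h
  by_contra h'
  exact h' (h h')

lemma RSSYT.top_injective : Function.Injective fun T : RSSYT lam => T.toRYT.top := by
  classical
  intro T T' h
  by_contra hne
  have h1 := Model.sym_top T' T
  have h2 := Model.sym_top T' T'
  rw [if_neg hne] at h1
  rw [if_pos rfl, ← show T.toRYT.top = T'.toRYT.top from h, h1] at h2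
  exact zero_ne_one h2

lemma Model.span_sym : Submodule.span K (Set.range (Model.sym (lam := lam))) = Model.inv lam := by
  classical
  apply le_antisymm
  · rw [Submodule.span_le]
    rintro _ ⟨T, rfl⟩
    exact Model.sym_mem_inv T
  · intro x hx
    -- The top coordinates of `x` serve as coefficients; the difference is invariant with zero top
    -- coordinates, hence zero.
    let l : RSSYT lam →₀ K := x.comapDomain (fun T => T.toRYT.top) RSSYT.top_injective.injOn
    have hl : Finsupp.linearCombination K Model.sym l ∈
        Submodule.span K (Set.range (Model.sym (lam := lam))) := by
      rw [← Finsupp.range_linearCombination]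
      exact ⟨l, rfl⟩
    have hl' : Finsupp.linearCombination K Model.sym l ∈ Model.inv lam := by
      refine (Submodule.span_le.mpr ?_) hl
      rintro _ ⟨T, rfl⟩
      exact Model.sym_mem_inv T
    have h : x - Finsupp.linearCombination K Model.sym l = 0 := by
      refine Model.eq_zero_of_top ((Model.inv lam).sub_mem hx hl') fun T => ?_
      have h1 : Finsupp.linearCombination K Model.sym l T.toRYT.top = l T := by
        rw [Finsupp.linearCombination_apply, Finsupp.sum, Finsupp.finsetSum_apply]
        simp only [Finsupp.smul_apply, Model.sym_top, smul_eq_mul, mul_ite, mul_one, mul_zero,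
          Finset.sum_ite_eq, Finsupp.mem_support_iff, ne_eq, ite_not]
        split_ifs with h0
        · exact h0.symm
        · rfl
      rw [Finsupp.sub_apply, h1, Finsupp.comapDomain_apply, sub_self]
    rw [sub_eq_zero.mp h]
    exact hl

/-! ### Weights -/

lemma prod_ofFn_apply {k M : Type*} [CommRing k] [AddCommGroup M] [Module k M] {v : M} :
    ∀ {n : ℕ} {g : Fin n → Module.End k M} {c : Fin n → k}, (∀ i, g i v = c i • v) →
      (List.ofFn g).prod v = (∏ i, c i) • v
  | 0, _, _, _ => by simp
  | n + 1, g, c, h => by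
    rw [List.ofFn_succ, List.prod_cons, Module.End.mul_apply,
      prod_ofFn_apply (g := fun i => g i.succ) (c := fun i => c i.succ) (fun i => h i.succ),
      map_smul, h, smul_smul, Fin.prod_univ_succ, mul_comm]

lemma pow_apply_of_eigen {k M : Type*} [CommRing k] [AddCommGroup M] [Module k M] {v : M}
    {f : Module.End k M} {c : k} (h : f v = c • v) : ∀ m : ℕ, (f ^ m) v = c ^ m • v
  | 0 => by simp
  | m + 1 => by
    rw [pow_succ, Module.End.mul_apply, h, map_smul, pow_apply_of_eigen h m, smul_smul, pow_succ']

namespace Model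

lemma rep_evalθ_single (f : MvPolynomial (Fin lam.card) K) (τ : PSYT lam) :
    rep lam (Daha.evalθ f) (Finsupp.single τ 1) =
      MvPolynomial.eval τ.weight f • Finsupp.single τ 1 := by
  have h : ∀ m : Fin lam.card →₀ ℕ,
      rep lam (List.ofFn fun i => Daha.θ i ^ m i).prod (Finsupp.single τ 1) =
        (∏ i, τ.weight i ^ m i) • Finsupp.single τ 1 := by
    intro m
    rw [map_list_prod, List.map_ofFn]
    refine prod_ofFn_apply fun i => ?_
    rw [Function.comp_apply, map_pow, rep_θ]
    exact pow_apply_of_eigen (opθ_single i τ) (m i)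
  rw [Daha.evalθ, map_sum, LinearMap.sum_apply, MvPolynomial.eval_eq', Finset.sum_smul]
  refine Finset.sum_congr rfl fun m _ => ?_
  rw [map_smul, LinearMap.smul_apply, h, smul_smul]

lemma rep_sum_pow_single (l : ℕ) (τ : PSYT lam) :
    rep lam (∑ i, Daha.θ i ^ l) (Finsupp.single τ 1) =
      (∑ i, τ.weight i ^ l) • Finsupp.single τ 1 := by
  rw [map_sum, LinearMap.sum_apply, Finset.sum_smul]
  refine Finset.sum_congr rfl fun i _ => ?_
  rw [map_pow, rep_θ]
  exact pow_apply_of_eigen (opθ_single i τ) l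

lemma apply_of_mem_withPow {p : Box lam → ℕ} {f : Module.End K (Model lam)} {c : K}
    (h : ∀ τ : PSYT lam, τ.pow = p → f (Finsupp.single τ 1) = c • Finsupp.single τ 1)
    {x : Model lam} (hx : x ∈ withPow p) : f x = c • x := by
  refine withPow_induction (P := fun x => f x = c • x) h ?_ ?_ ?_ hx
  · rw [map_zero, smul_zero]
  · intro x y hx hy; rw [map_add, hx, hy, smul_add]
  · intro k x hx; rw [map_smul, hx, smul_comm]

end Model

lemma PSYT.weight_eq {T : RSSYT lam} {τ : PSYT lam} (h : τ.pow = T.val) (i : Fin lam.card) :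
    τ.weight i = T.boxWeight (τ.idx.symm i) := by
  rw [PSYT.weight, PSYT.w, h]
  rfl

lemma eval_comp_equiv {n : ℕ} {X : Type*} {R : Type*} [CommRing R] {f : MvPolynomial (Fin n) R}
    (hf : f.IsSymmetric) (e e' : Fin n ≃ X) (w : X → R) :
    MvPolynomial.eval (fun i => w (e i)) f = MvPolynomial.eval (fun i => w (e' i)) f := by
  conv_rhs => rw [← hf (e.trans e'.symm), MvPolynomial.eval_rename]
  congr 2
  funext i
  simp

lemma act_evalθ {T : RSSYT lam} {p : V lam} (hp : equivModelK lam p = Model.sym T)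
    {f : MvPolynomial (Fin lam.card) K} (hf : f.IsSymmetric) (e : Fin lam.card ≃ Box lam) :
    act (Daha.evalθ f) p = MvPolynomial.eval (fun i => T.boxWeight (e i)) f • p := by
  apply (equivModelK lam).injective
  rw [equivModelK_act, map_smul, hp]
  refine Model.apply_of_mem_withPow (fun τ hτ => ?_) (Model.sym_mem_withPow T)
  rw [Model.rep_evalθ_single, eval_comp_equiv hf e τ.idx.symm]
  congr 3
  funext i
  exact PSYT.weight_eq hτ i

lemma RSSYT.boxWeight_pow (T : RSSYT lam) (b : Box lam) (l : ℕ) :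
    T.boxWeight b ^ l = q ^ (l * T.val b) * t ^ ((l : ℤ) * content b) := by
  rw [RSSYT.boxWeight, mul_pow, ← pow_mul, mul_comm l, mul_comm (l : ℤ), zpow_mul, zpow_natCast]

lemma act_P0 {T : RSSYT lam} {p : V lam} (hp : equivModelK lam p = Model.sym T) (l : ℕ) :
    act (Daha.P0 lam.card l) p =
      (∑ b : Box lam, q ^ (l * T.val b) * t ^ ((l : ℤ) * content b)) • p := by
  have h1 : act (Daha.eps lam.card) p = p := by
    apply (equivModelK lam).injective
    rw [equivModelK_eps, hp, Model.eps_smul_of_mem_inv (Model.sym_mem_inv T)]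
  have h2 : act (∑ i, Daha.θ i ^ l : Daha lam.card) p =
      (∑ b : Box lam, q ^ (l * T.val b) * t ^ ((l : ℤ) * content b)) • p := by
    apply (equivModelK lam).injective
    rw [equivModelK_act, map_smul, hp]
    refine Model.apply_of_mem_withPow (fun τ hτ => ?_) (Model.sym_mem_withPow T)
    rw [Model.rep_sum_pow_single, ← τ.idx.symm.sum_comp]
    congr 1
    refine Finset.sum_congr rfl fun i _ => ?_
    rw [PSYT.weight_eq hτ, RSSYT.boxWeight_pow]
  have h3 : act (Daha.P0 lam.card l) p =
      act (Daha.eps lam.card) (act (∑ i, Daha.θ i ^ l : Daha lam.card)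
        (act (Daha.eps lam.card) p)) := by
    show Daha.P0 lam.card l • p = Daha.eps lam.card • (∑ i, Daha.θ i ^ l : Daha lam.card) •
      Daha.eps lam.card • p
    rw [← mul_smul, ← mul_smul]
    rfl
  rw [h3, h1, h2, map_smul, h1]

/-! ### Distinct weights -/

lemma RSSYT.val_le_of_le (T : RSSYT lam) {b b' : Box lam} (hc : content b = content b')
    (h : b.1.1 ≤ b'.1.1) : T.val b' ≤ T.val b := by
  rcases h.eq_or_lt with h' | h'
  · have : b = b' := box_ext h' (by unfold content at hc; omega)
    rw [this]
  · exact (T.lt_of_lt_of_le h' (by unfold content at hc; omega)).le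

/-- Entries decrease down a diagonal, so the boxes weakly above `b` on its diagonal all have entries
at least `T.val b` in `T`. If `T'.val b` were smaller, only boxes strictly above `b` could reach
this bound in `T'`, and the counts would differ. -/
lemma RSSYT.val_le_of_count (T T' : RSSYT lam)
    (h : ∀ (c : ℤ) (m : ℕ), (Finset.univ.filter fun b => content b = c ∧ m ≤ T.val b).card =
      (Finset.univ.filter fun b => content b = c ∧ m ≤ T'.val b).card) (b : Box lam) :
    T.val b ≤ T'.val b := by
  by_contra! hlt
  have h1 : (Finset.univ.filter fun b' : Box lam => content b' = content b ∧ b'.1.1 ≤ b.1.1) ⊆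
      Finset.univ.filter fun b' => content b' = content b ∧ T.val b ≤ T.val b' := by
    intro b' hb'
    rw [Finset.mem_filter] at hb' ⊢
    exact ⟨hb'.1, hb'.2.1, T.val_le_of_le hb'.2.1 hb'.2.2⟩
  have h2 : (Finset.univ.filter fun b' => content b' = content b ∧ T.val b ≤ T'.val b') ⊂
      Finset.univ.filter fun b' : Box lam => content b' = content b ∧ b'.1.1 ≤ b.1.1 := by
    refine (Finset.ssubset_iff_of_subset fun b' hb' => ?_).mpr ⟨b, by simp, by simp [hlt]⟩
    rw [Finset.mem_filter] at hb' ⊢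
    refine ⟨hb'.1, hb'.2.1, ?_⟩
    by_contra! hrow
    have := T'.val_le_of_le hb'.2.1.symm hrow.le
    have := hb'.2.2
    omega
  have h3 := Finset.card_le_card h1
  have h4 := Finset.card_lt_card h2
  rw [h] at h3
  omega

/-- The weights determine exponent and content, so the multiset of weights yields the number of
boxes of each content with entry above any given bound. -/
lemma RSSYT.eq_of_map_eq {T T' : RSSYT lam}
    (h : (Finset.univ : Finset (Box lam)).val.map T.boxWeight =
      (Finset.univ : Finset (Box lam)).val.map T'.boxWeight) : T = T' := by
  have h1 : (Finset.univ : Finset (Box lam)).val.map (boxU T.val) =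
      (Finset.univ : Finset (Box lam)).val.map (boxU T'.val) := by
    apply Multiset.map_injective val_injective
    rw [Multiset.map_map, Multiset.map_map]
    exact h
  have h2 : ∀ (c : ℤ) (m : ℕ), (Finset.univ.filter fun b => content b = c ∧ m ≤ T.val b).card =
      (Finset.univ.filter fun b => content b = c ∧ m ≤ T'.val b).card := by
    intro c m
    have h3 := congrArg (Multiset.countP fun x : ℕ × ℤ => x.2 = c ∧ m ≤ x.1) h1
    rw [Multiset.countP_map, Multiset.countP_map] at h3
    exact h3
  have h3 : T.val = T'.val := funext fun b =>
    le_antisymm (T.val_le_of_count T' h2 b)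
      (T'.val_le_of_count T (fun c m => (h2 c m).symm) b)
  cases T
  cases T'
  simp only at h3
  simp only [h3]

instance : Infinite K :=
  Infinite.of_injective (fun n : ℕ => t ^ n) fun m n h => by
    have h' : val (0, (m : ℤ)) = val (0, (n : ℤ)) := by simpa [val] using h
    exact Int.ofNat.inj (congrArg Prod.snd (val_injective h'))

/-- The separating function is `∏ (z - X_i)` for a suitable scalar `z`. If none worked, the two
monic polynomials with these roots would agree at every point of the infinite field `K`, and so
would their root multisets. -/
lemma exists_symmetric_ne {T T' : RSSYT lam} (h : T ≠ T') :
    ∃ f : MvPolynomial (Fin lam.card) K, f.IsSymmetric ∧ ∀ e : Fin lam.card ≃ Box lam,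
      MvPolynomial.eval (fun i => T.boxWeight (e i)) f ≠
        MvPolynomial.eval (fun i => T'.boxWeight (e i)) f := by
  obtain ⟨z, hz⟩ : ∃ z : K, ∏ b, (z - T.boxWeight b) ≠ ∏ b, (z - T'.boxWeight b) := by
    by_contra! hcon
    apply h
    apply RSSYT.eq_of_map_eq
    have h1 : ∏ b, (Polynomial.X - Polynomial.C (T.boxWeight b)) =
        ∏ b, (Polynomial.X - Polynomial.C (T'.boxWeight b)) := by
      apply Polynomial.funext
      intro z
      simpa only [Polynomial.eval_prod, Polynomial.eval_sub, Polynomial.eval_X,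
        Polynomial.eval_C] using hcon z
    have h2 : ∀ w : Box lam → K, (∏ b, (Polynomial.X - Polynomial.C (w b))).roots =
        (Finset.univ : Finset (Box lam)).val.map w := by
      intro w
      have h3 := Polynomial.roots_multiset_prod_X_sub_C
        ((Finset.univ : Finset (Box lam)).val.map w)
      rwa [Multiset.map_map] at h3
    rw [← h2, ← h2, h1]
  refine ⟨∏ i, (MvPolynomial.C z - MvPolynomial.X i), ?_, fun e => ?_⟩
  · intro σ
    simp only [map_prod, map_sub, MvPolynomial.rename_C, MvPolynomial.rename_X]
    exact Equiv.prod_comp σ fun i => (MvPolynomial.C z - MvPolynomial.X i : MvPolynomial _ K)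
  · simp only [map_prod, map_sub, MvPolynomial.eval_C, MvPolynomial.eval_X]
    rw [e.prod_comp fun b => z - T.boxWeight b, e.prod_comp fun b => z - T'.boxWeight b]
    exact hz

lemma linearIndependent_of_equiv {P : RSSYT lam → V lam}
    (hP : ∀ T, equivModelK lam (P T) = Model.sym T) : LinearIndependent K P := by
  have h : (equivModelK lam).toLinearMap ∘ P = Model.sym := funext hP
  have h1 := Model.linearIndependent_sym (lam := lam)
  rw [← h] at h1
  exact LinearIndependent.of_comp _ h1

lemma span_eq_W_of_equiv {P : RSSYT lam → V lam}
    (hP : ∀ T, equivModelK lam (P T) = Model.sym T) :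
    Submodule.span K (Set.range P) = W lam := by
  have h : P = (equivModelK lam).symm.toLinearMap ∘ Model.sym := by
    funext T
    exact ((equivModelK lam).symm_apply_eq.mpr (hP T).symm).symm
  rw [h, Set.range_comp, Submodule.span_image, Model.span_sym]
  ext x
  rw [mem_W_iff]
  exact Submodule.mem_map_equiv (e := (equivModelK lam).symm) _

end

end VVMac

theorem mainTheorem8 (lam : YoungDiagram) :
    -- the non-symmetric Macdonald polynomials `F_τ` are well defined
    (∃! F : VVMac.PSYT lam → VVMac.V lam, VVMac.IsNonsymMacdonald F) ∧
    ∀ F : VVMac.PSYT lam → VVMac.V lam, VVMac.IsNonsymMacdonald F →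
      -- the symmetric Macdonald polynomials `P_T` are well defined
      (∀ T : VVMac.RSSYT lam, ∃! p : VVMac.V lam, VVMac.IsSymMacdonald F T p) ∧
      ∀ P : VVMac.RSSYT lam → VVMac.V lam, (∀ T, VVMac.IsSymMacdonald F T (P T)) →
        -- the `P_T` form a basis of `W_lam`
        (LinearIndependent VVMac.K P ∧ Submodule.span VVMac.K (Set.range P) = VVMac.W lam) ∧
        -- of weight vectors for the symmetric polynomials in `θ_1, …, θ_n`
        (∀ (T : VVMac.RSSYT lam) (f : MvPolynomial (Fin lam.card) VVMac.K), f.IsSymmetric →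
          ∀ e : Fin lam.card ≃ VVMac.Box lam,
            VVMac.act (VVMac.Daha.evalθ f) (P T) =
              MvPolynomial.eval (fun i => T.boxWeight (e i)) f • P T) ∧
        -- with pairwise distinct weights
        (∀ T T' : VVMac.RSSYT lam, T ≠ T' →
          ∃ f : MvPolynomial (Fin lam.card) VVMac.K, f.IsSymmetric ∧
            ∀ e : Fin lam.card ≃ VVMac.Box lam,
              MvPolynomial.eval (fun i => T.boxWeight (e i)) f ≠
                MvPolynomial.eval (fun i => T'.boxWeight (e i)) f) ∧
        -- and `P_{0,ℓ}` acts on `P_T` by the stated scalar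
        (∀ (T : VVMac.RSSYT lam) (l : ℕ), 0 < l →
          VVMac.act (VVMac.Daha.P0 lam.card l) (P T) =
            (∑ b : VVMac.Box lam, VVMac.q ^ (l * T.val b) * VVMac.t ^ ((l : ℤ) * VVMac.content b)) •
              P T) := by
  refine ⟨VVMac.existsUnique_isNonsymMacdonald lam, fun F hF => ?_⟩
  -- By uniqueness the given family is the one constructed from the model.
  obtain rfl := hF.eq
  refine ⟨VVMac.existsUnique_isSymMacdonald, fun P hP => ?_⟩
  have hP' := fun T => VVMac.isSymMacdonald_iff.mp (hP T)
  exact ⟨⟨VVMac.linearIndependent_of_equiv hP', VVMac.span_eq_W_of_equiv hP'⟩,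
    fun T f hf e => VVMac.act_evalθ (hP' T) hf e, fun T T' h => VVMac.exists_symmetric_ne h,
    fun T l _ => VVMac.act_P0 (hP' T) l⟩
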